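/- Let $d,k,p\ge 1$ be integers. Choose $pk$ independent random vectors $\varphi_s^i\in\mathbb{C}^d$ ($1\le s\le p$, $1\le i\le k$), each uniformly distributed on the unit sphere of $\mathbb{C}^d$, let $\varphi_s=\varphi_s^1\otimes\cdots\otimes\varphi_s^k\in(\mathbb{C}^d)^{\otimes k}$, and let $$M_{p,d,k}=\sum_{s=1}^p |\varphi_s\rangle\langle\varphi_s| .$$ Let $\hat M_{p,d,k}$ be defined in the same way from independent Gaussian vectors $\hat\varphi_s^i\in\mathbb{C}^d$, whose coordinates are independent of the form $a+\mathrm{i}b$ with $a,b$ independent real Gaussians of mean $0$ and variance $\frac1{2d}$ (so that $\mathbb{E}\|\hat\varphi_s^i\|^2=1$). Write $x=p/d^k$, and let $\|\cdot\|$ be the operator norm. Fix $k\ge 1$ and $0<a\le b$. There is a constant $C>0$, depending only on $k,a,b$, such that for all $d\ge 2$ and all $p$ with $a\le x\le b$, the random variable $\|M_{p,d,k}\|$ is integrable and $$(1+\sqrt{x})^2-C\,\frac{\ln d}{\sqrt d}\;\le\;\mathbb{E}\big[\|M_{p,d,k}\|\big]\;\le\;(1+\sqrt{x})^2+C\,\frac{\ln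 d}{d^{1/(2k)}},$$ and the same holds (with the same $C$) for $\|\hat M_{p,d,k}\|$. -/

import Mathlib

open MeasureTheory ProbabilityTheory

namespace RandomTensor

noncomputable section

/-- The local space `ℂ^d` with its Hermitian inner product. -/
abbrev LocalSpace (d : ℕ) : Type := EuclideanSpace ℂ (Fin d)

/-- The uniform probability distribution on the unit sphere of `ℂ^d`, as a measure on `ℂ^d`:
the surface measure of the unit sphere of `ℂ^d ≅ ℝ^(2d)`, normalized to total mass one. -/
def uniformUnitVector (d : ℕ) : Measure (LocalSpace d) :=
  let σ : Measure (Metric.sphere (0 : LocalSpace d) 1) :=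
    (volume : Measure (LocalSpace d)).toSphere
  ((σ Set.univ)⁻¹ • σ).map Subtype.val

/-- The law of `a + i b` with `a`, `b` independent real Gaussians of mean zero and variance `v`. -/
def complexGaussian (v : NNReal) : Measure ℂ :=
  ((gaussianReal 0 v).prod (gaussianReal 0 v)).map fun z : ℝ × ℝ => (⟨z.1, z.2⟩ : ℂ)

/-- The law of a Gaussian vector of `ℂ^d` with independent coordinates `a_j + i b_j`, where
`a_j`, `b_j` have variance `1 / (2d)`, so that the expected squared norm is one. -/
def gaussianVector (d : ℕ) : Measure (LocalSpace d) :=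
  (Measure.pi fun _ : Fin d => complexGaussian (1 / (2 * (d : NNReal)))).map (WithLp.toLp 2)

/-- The joint law of `p * k` independent vectors of `ℂ^d`, each with law `ν`. -/
def iidFamily (p d k : ℕ) (ν : Measure (LocalSpace d)) :
    Measure (Fin p → Fin k → LocalSpace d) :=
  Measure.pi fun _ : Fin p => Measure.pi fun _ : Fin k => ν

/-- The normalized product ensemble: independent uniform unit vectors. -/
def normalizedEnsemble (p d k : ℕ) : Measure (Fin p → Fin k → LocalSpace d) :=
  iidFamily p d k (uniformUnitVector d)

/-- The Gaussian product ensemble: independent Gaussian vectors. -/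
def gaussianEnsemble (p d k : ℕ) : Measure (Fin p → Fin k → LocalSpace d) :=
  iidFamily p d k (gaussianVector d)

/-- The product vector `v 0 ⊗ ⋯ ⊗ v (k-1)` of `(ℂ^d)^{⊗ k}`, in coordinates with respect to the
product basis, which is indexed by `Fin k → Fin d`. -/
def productVector {d k : ℕ} (v : Fin k → LocalSpace d) : (Fin k → Fin d) → ℂ :=
  fun j => ∏ i, v i (j i)

/-- The matrix `∑ s, |φ_s⟩⟨φ_s|` with `φ_s = φ_s^1 ⊗ ⋯ ⊗ φ_s^k`. -/
def tensorSum {p d k : ℕ} (φ : Fin p → Fin k → LocalSpace d) :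
    Matrix (Fin k → Fin d) (Fin k → Fin d) ℂ :=
  ∑ s, Matrix.vecMulVec (productVector (φ s)) (star (productVector (φ s)))

/-- The operator norm of a complex matrix with respect to the Hermitian norm on vectors. -/
def opNorm {ι : Type*} [Fintype ι] [DecidableEq ι] (A : Matrix ι ι ℂ) : ℝ :=
  ‖Matrix.toEuclideanCLM (n := ι) (𝕜 := ℂ) A‖

end

end RandomTensor

namespace RandomTensor

/-! The trace of the `m`-th power of the matrix is a sum over words of length `m` in the letters `1,
…, p`; for each word it is a product, over the tensor factors, of traces of products of rank one
matrices. The factors are independent and identically distributed, so the expected trace is `∑ w,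
E(w) ^ k`, where `E(w)` is the expected trace for a single factor (`integral_trace_tensorSum_pow`).
Moments with `m` of order `√d` suffice, because the `m`-th root of a polynomial in `d` is `1 + O(log
d / √d)`. For such `m` the sphere and the Gaussian law give words the same weight up to a bounded
factor, since the two differ only by moments of the radius (`gaussianWord_le`).

Upper bound. On the sphere `E(w)` is at most `d ^ (1 - r)` if `w` has `r` distinct letters
(`sphereWord_mul_pow_le`), so `k - 1` of the `k` factors can be traded for a penalty `d ^ (-(k -
1))` per distinct letter. Because `E(w)` depends only on which letters coincide, this penalty
amounts to dividing the number of letters by `d ^ (k - 1)`, up to `m` additional letters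
(`wordSum_pattern_le`). What remains is a Wishart matrix with about `x * d` vectors in dimension
`d`. Its moments are vacuum expectations of sums of creation and annihilation operators on
polynomials, whose norms in bounded degree are elementary (`fockNormSq_fieldOp_le`,
`coeff_sum_stepOp_pow_le`).

Lower bound. Words obtained by nesting loops of new letters have expectations that are multiples of
the identity, and these scalars multiply. Their total weight dominates the Catalan-like recursion of
the Marchenko-Pastur moments (`weightedCatalan_le_wordSum`), which grows like `(1 + √x) ^ (2 * n)`
up to a polynomial factor (`pow_le_weightedCatalan`). A large moment bounds `𝔼‖M‖` from below only
if the moment is concentrated. The Gaussian Poincaré inequality, carried to the sphere and applied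
to `(1 + tr M ^ m) ^ θ` for `θ = 1/2, 1/4, …, 1/m`, gives `𝔼 tr M ^ m ≤ 2 e d ^ k (𝔼‖M‖) ^ m` when
`5 k m ^ 2 ≤ d` (`integral_traceMoment_le_integral_opNorm_pow`).

Finally, averaging the Gaussian matrix over the radii returns the normalized one, so `𝔼‖M‖ ≤ 𝔼‖M̂‖`
by convexity. It is therefore enough to bound the normalized ensemble from below and the Gaussian
one from above. -/

/-! ### Gaussian vectors: density, polar decomposition and moments of the radius. -/

lemma measurable_complex_mk : Measurable fun z : ℝ × ℝ => (⟨z.1, z.2⟩ : ℂ) :=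
  Complex.measurableEquivRealProd.symm.measurable

open Complex in
lemma charFun_complexGaussian (v : NNReal) (t : ℂ) :
    charFun (complexGaussian v) t = exp (-(v * ‖t‖ ^ 2 / 2)) := by
  rw [charFun_apply, complexGaussian, integral_map measurable_complex_mk.aemeasurable (by fun_prop)]
  have h : ∀ x : ℝ × ℝ, exp ((inner ℝ (⟨x.1, x.2⟩ : ℂ) t : ℝ) * I) =
      exp (t.re * x.1 * I) * exp (t.im * x.2 * I) := by
    intro x
    rw [← Complex.exp_add, Complex.inner]
    simp
    ring_nf
  simp_rw [h]
  rw [integral_prod_mul (μ := gaussianReal 0 v) (ν := gaussianReal 0 v)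
    (fun x : ℝ => exp (t.re * x * I)) (fun x : ℝ => exp (t.im * x * I)),
    ← charFun_apply_real, ← charFun_apply_real, charFun_gaussianReal, charFun_gaussianReal,
    ← Complex.exp_add]
  have h2 : (‖t‖ : ℂ) ^ 2 = t.re ^ 2 + t.im ^ 2 := by
    rw [← ofReal_pow, Complex.sq_norm, Complex.normSq_apply]
    push_cast
    ring
  rw [h2]
  push_cast
  ring_nf

instance (v : NNReal) : IsProbabilityMeasure (complexGaussian v) :=
  Measure.isProbabilityMeasure_map measurable_complex_mk.aemeasurable

instance (d : ℕ) : IsProbabilityMeasure (gaussianVector d) :=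
  Measure.isProbabilityMeasure_map (by fun_prop)

open Complex in
lemma charFun_gaussianVector {d : ℕ} (t : LocalSpace d) :
    charFun (gaussianVector d) t = exp (-(‖t‖ ^ 2 / (4 * d))) := by
  rw [gaussianVector, charFun_pi]
  simp_rw [charFun_complexGaussian]
  rw [← Complex.exp_sum, ← ofReal_pow, EuclideanSpace.norm_sq_eq, Finset.sum_neg_distrib]
  push_cast
  rw [Finset.sum_div]
  congr 2
  refine Finset.sum_congr rfl fun i _ => ?_
  field_simp
  ring

lemma finrank_localSpace (d : ℕ) : Module.finrank ℝ (LocalSpace d) = 2 * d := by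
  rw [← Module.finrank_mul_finrank ℝ ℂ]
  simp

lemma integrable_gaussian_density {d : ℕ} (hd : 0 < d) :
    Integrable (fun x : LocalSpace d => Real.exp (-d * ‖x‖ ^ 2)) := by
  have h := GaussianFourier.integral_rexp_neg_mul_sq_norm (V := LocalSpace d)
    (b := d) (by positivity)
  -- A non-integrable function has Bochner integral zero, while the known value of this integral is
  -- positive.
  by_contra hc
  rw [integral_undef hc] at h
  have : (0 : ℝ) < (Real.pi / d) ^ (Module.finrank ℝ (LocalSpace d) / 2 : ℝ) := by positivity
  exact this.ne h

open Complex in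
-- Finite measures with the same characteristic function coincide; the density side is a Gaussian
-- Fourier integral in real dimension `2 * d`.
lemma gaussianVector_eq_withDensity {d : ℕ} (hd : 0 < d) :
    gaussianVector d = (volume : Measure (LocalSpace d)).withDensity
      (fun x => ENNReal.ofReal ((d / Real.pi) ^ d * Real.exp (-d * ‖x‖ ^ 2))) := by
  have hint := (integrable_gaussian_density hd).const_mul ((d / Real.pi) ^ d)
  have : IsFiniteMeasure ((volume : Measure (LocalSpace d)).withDensity
      (fun x => ENNReal.ofReal ((d / Real.pi) ^ d * Real.exp (-d * ‖x‖ ^ 2)))) :=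
    isFiniteMeasure_withDensity_ofReal hint.2
  apply Measure.ext_of_charFun
  ext t
  rw [charFun_gaussianVector, charFun_apply,
    integral_withDensity_eq_integral_toReal_smul (by fun_prop) (by simp)]
  have h1 : ∀ x : LocalSpace d,
      (ENNReal.ofReal ((d / Real.pi) ^ d * Real.exp (-d * ‖x‖ ^ 2))).toReal •
        exp ((inner ℝ x t : ℝ) * I) =
      ((d : ℂ) / Real.pi) ^ d * exp (-(d : ℂ) * ‖x‖ ^ 2 + I * (inner ℝ t x : ℝ)) := by
    intro x
    rw [ENNReal.toReal_ofReal (by positivity), Complex.exp_add, real_inner_comm, Complex.real_smul]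
    push_cast
    ring_nf
  simp_rw [h1]
  have hd' : (d : ℂ) ≠ 0 := by exact_mod_cast hd.ne'
  rw [integral_const_mul, GaussianFourier.integral_cexp_neg_mul_sq_norm_add
    (by simpa using hd), finrank_localSpace]
  have h2 : ((2 * d : ℕ) : ℂ) / 2 = d := by push_cast; ring
  rw [h2, Complex.cpow_natCast, ← mul_assoc, ← mul_pow, div_mul_div_comm, mul_comm (d : ℂ),
    div_self (by simp [hd']), one_pow, one_mul, I_sq]
  ring_nf

/-- The law of the norm of a Gaussian vector. -/
noncomputable def radialLaw (d : ℕ) : Measure ℝ := (gaussianVector d).map norm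

instance (d : ℕ) : IsProbabilityMeasure (radialLaw d) :=
  Measure.isProbabilityMeasure_map (by fun_prop)

/-- The unnormalized radial part of the Gaussian law in polar coordinates. -/
noncomputable def radialDensity (d : ℕ) : Measure (Set.Ioi (0 : ℝ)) :=
  (Measure.volumeIoiPow (2 * d - 1)).withDensity
    fun r => ENNReal.ofReal ((d / Real.pi) ^ d * Real.exp (-d * r.1 ^ 2))

/-- The density depends on the norm only, so in polar coordinates it belongs entirely to the radial
factor. -/
lemma lintegral_gaussianVector {d : ℕ} (hd : 0 < d) {f : LocalSpace d → ENNReal}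
    (hf : Measurable f) :
    ∫⁻ x, f x ∂gaussianVector d =
      ∫⁻ u, ∫⁻ r, f (r.1 • u.1) ∂radialDensity d
        ∂(volume : Measure (LocalSpace d)).toSphere := by
  have : Nontrivial (LocalSpace d) := by
    have : Nonempty (Fin d) := ⟨⟨0, hd⟩⟩
    infer_instance
  have hdm : Measurable fun r : Set.Ioi (0 : ℝ) =>
      ENNReal.ofReal ((d / Real.pi) ^ d * Real.exp (-d * r.1 ^ 2)) := by fun_prop
  have hmp := (volume : Measure (LocalSpace d)).measurePreserving_homeomorphUnitSphereProd
  rw [finrank_localSpace] at hmp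
  rw [gaussianVector_eq_withDensity hd, lintegral_withDensity_eq_lintegral_mul _ (by fun_prop) hf]
  simp only [radialDensity]
  have h3 : ∀ u : Metric.sphere (0 : LocalSpace d) 1,
      ∫⁻ r, f (r.1 • u.1) ∂(Measure.volumeIoiPow (2 * d - 1)).withDensity
        (fun r => ENNReal.ofReal ((d / Real.pi) ^ d * Real.exp (-d * r.1 ^ 2))) =
      ∫⁻ r, ENNReal.ofReal ((d / Real.pi) ^ d * Real.exp (-d * r.1 ^ 2)) * f (r.1 • u.1)
        ∂Measure.volumeIoiPow (2 * d - 1) := fun u =>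
    lintegral_withDensity_eq_lintegral_mul _ hdm (hf.comp (by fun_prop))
  simp_rw [h3]
  rw [← lintegral_prod (fun q : Metric.sphere (0 : LocalSpace d) 1 × Set.Ioi (0 : ℝ) =>
      ENNReal.ofReal ((d / Real.pi) ^ d * Real.exp (-d * q.2.1 ^ 2)) * f (q.2.1 • q.1.1))
    (by fun_prop), ← hmp.lintegral_comp (by fun_prop),
    ← restrict_compl_singleton (μ := (volume : Measure (LocalSpace d))) 0,
    ← map_comap_subtype_coe (measurableSet_singleton _).compl,
    lintegral_map (by fun_prop) measurable_subtype_coe,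
    map_comap_subtype_coe (measurableSet_singleton _).compl]
  rw [restrict_compl_singleton (μ := (volume : Measure (LocalSpace d))) 0]
  refine lintegral_congr fun x => ?_
  have hx : ‖(x : LocalSpace d)‖ ≠ 0 := norm_ne_zero_iff.2 x.2
  simp [smul_smul, hx]

lemma toSphere_univ_ne {d : ℕ} (hd : 0 < d) :
    (volume : Measure (LocalSpace d)).toSphere Set.univ ≠ 0 := by
  rw [Measure.toSphere_apply_univ, finrank_localSpace]
  exact mul_ne_zero (by simpa using hd.ne') (Metric.isOpen_ball.measure_ne_zero _ (by simp))

instance (d : ℕ) : SFinite (radialDensity d) := by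
  unfold radialDensity
  infer_instance

lemma radialLaw_eq {d : ℕ} (hd : 0 < d) :
    radialLaw d = (volume : Measure (LocalSpace d)).toSphere Set.univ •
      (radialDensity d).map Subtype.val := by
  ext s hs
  rw [radialLaw, Measure.map_apply (by fun_prop) hs, ← lintegral_indicator_one (measurable_norm hs),
    lintegral_gaussianVector hd (measurable_one.indicator (measurable_norm hs))]
  have h : ∀ (u : Metric.sphere (0 : LocalSpace d) 1) (r : Set.Ioi (0 : ℝ)),
      (norm ⁻¹' s).indicator (1 : LocalSpace d → ENNReal) (r.1 • u.1) =
      (Subtype.val ⁻¹' s).indicator (1 : Set.Ioi (0 : ℝ) → ENNReal) r := by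
    intro u r
    have : ‖(r.1 • u.1 : LocalSpace d)‖ = r.1 := by
      rw [norm_smul, norm_eq_of_mem_sphere, mul_one, Real.norm_of_nonneg r.2.out.le]
    have hiff : (r.1 • u.1 : LocalSpace d) ∈ norm ⁻¹' s ↔ r ∈ Subtype.val ⁻¹' s := by
      rw [Set.mem_preimage, Set.mem_preimage, this]
    by_cases hr : r ∈ Subtype.val ⁻¹' s
    · rw [Set.indicator_of_mem hr, Set.indicator_of_mem (hiff.2 hr)]
      rfl
    · rw [Set.indicator_of_notMem hr, Set.indicator_of_notMem (mt hiff.1 hr)]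
  simp_rw [h]
  rw [lintegral_const, lintegral_indicator_one (measurable_subtype_coe hs), Measure.smul_apply,
    Measure.map_apply measurable_subtype_coe hs, smul_eq_mul, mul_comm]

lemma isProbabilityMeasure_uniformUnitVector {d : ℕ} (hd : 0 < d) :
    IsProbabilityMeasure (uniformUnitVector d) := by
  constructor
  rw [uniformUnitVector]
  rw [Measure.map_apply measurable_subtype_coe .univ]
  simp only [Set.preimage_univ, Measure.smul_apply, smul_eq_mul]
  exact ENNReal.inv_mul_cancel (toSphere_univ_ne hd) (measure_ne_top _ _)

/-- The direction and the norm of a Gaussian vector are independent, and the direction is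
uniform. -/
lemma gaussianVector_eq_map_smul {d : ℕ} (hd : 0 < d) :
    gaussianVector d =
      ((uniformUnitVector d).prod (radialLaw d)).map fun q => q.2 • q.1 := by
  ext s hs
  have hm : Measurable fun q : LocalSpace d × ℝ => q.2 • q.1 := by fun_prop
  have h0 := toSphere_univ_ne hd
  have h1 := measure_ne_top (volume : Measure (LocalSpace d)).toSphere Set.univ
  have hms := hm hs
  have hg : Measurable ((fun q : LocalSpace d × ℝ => q.2 • q.1) ⁻¹' s |>.indicator
      (1 : LocalSpace d × ℝ → ENNReal)) := measurable_one.indicator hms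
  rw [Measure.map_apply hm hs, ← lintegral_indicator_one hs, ← lintegral_indicator_one hms,
    lintegral_gaussianVector hd (measurable_one.indicator hs),
    lintegral_prod _ hg.aemeasurable, radialLaw_eq hd, uniformUnitVector,
    lintegral_map (Measurable.lintegral_prod_right' hg) measurable_subtype_coe,
    lintegral_smul_measure]
  simp_rw [lintegral_smul_measure]
  have h2 : ∀ u : Metric.sphere (0 : LocalSpace d) 1,
      ∫⁻ r, ((fun q : LocalSpace d × ℝ => q.2 • q.1) ⁻¹' s).indicator
        (1 : LocalSpace d × ℝ → ENNReal) (u.1, r) ∂(radialDensity d).map Subtype.val =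
      ∫⁻ r, s.indicator 1 (r.1 • u.1) ∂radialDensity d := by
    intro u
    exact lintegral_map (f := fun r : ℝ => ((fun q : LocalSpace d × ℝ => q.2 • q.1) ⁻¹' s).indicator
      (1 : LocalSpace d × ℝ → ENNReal) (u.1, r)) (hg.comp measurable_prodMk_left)
      measurable_subtype_coe
  simp_rw [h2, smul_eq_mul]
  rw [lintegral_const_mul' _ _ h1, ← mul_assoc, ENNReal.inv_mul_cancel h0 h1, one_mul]

lemma ae_norm_uniformUnitVector (d : ℕ) : ∀ᵐ u ∂uniformUnitVector d, ‖u‖ = 1 := by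
  rw [uniformUnitVector, ae_map_iff measurable_subtype_coe.aemeasurable
    (measurableSet_eq_fun (by fun_prop) (by fun_prop))]
  exact Filter.Eventually.of_forall fun u => norm_eq_of_mem_sphere u

lemma ae_pos_radialLaw {d : ℕ} (hd : 0 < d) : ∀ᵐ r ∂radialLaw d, 0 < r := by
  rw [radialLaw_eq hd]
  refine Measure.ae_smul_measure ?_ _
  rw [ae_map_iff measurable_subtype_coe.aemeasurable measurableSet_Ioi]
  exact Filter.Eventually.of_forall fun u => u.2

lemma lintegral_radialLaw {d : ℕ} (hd : 0 < d) {h : ℝ → ENNReal} (hh : Measurable h) :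
    ∫⁻ r, h r ∂radialLaw d = (volume : Measure (LocalSpace d)).toSphere Set.univ *
      ENNReal.ofReal ((d / Real.pi) ^ d) *
      ∫⁻ r in Set.Ioi (0 : ℝ), ENNReal.ofReal (r ^ (2 * d - 1) * Real.exp (-d * r ^ 2)) * h r := by
  rw [radialLaw_eq hd, lintegral_smul_measure, lintegral_map hh measurable_subtype_coe,
    radialDensity, lintegral_withDensity_eq_lintegral_mul _ (by fun_prop) (by fun_prop),
    Measure.volumeIoiPow, lintegral_withDensity_eq_lintegral_mul _ (by fun_prop) (by fun_prop),
    smul_eq_mul, mul_assoc]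
  congr 1
  rw [← lintegral_const_mul' _ _ (by simp), ← lintegral_subtype_comap measurableSet_Ioi]
  refine lintegral_congr fun r => ?_
  have hr : (0 : ℝ) < r.1 := r.2
  simp only [Pi.mul_apply]
  rw [ENNReal.ofReal_mul (by positivity), ENNReal.ofReal_mul (by positivity)]
  ring

open Real in
-- The normalizing constant of the radial density is never computed: the case `s = 0`, where the
-- integral is the total mass one, eliminates it.
lemma lintegral_rpow_radialLaw {d : ℕ} (hd : 0 < d) {s : ℝ} (hs : 0 < 2 * d + s) :
    ∫⁻ r, ENNReal.ofReal (r ^ s) ∂radialLaw d =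
      ENNReal.ofReal ((d : ℝ) ^ (-s / 2) * Gamma (d + s / 2) / Gamma d) := by
  have hd' : (0 : ℝ) < d := by exact_mod_cast hd
  have key : ∀ t : ℝ, 0 < 2 * d + t →
      ∫⁻ r in Set.Ioi (0 : ℝ), ENNReal.ofReal (r ^ (2 * d - 1) * exp (-d * r ^ 2)) *
        ENNReal.ofReal (r ^ t) =
      ENNReal.ofReal ((d : ℝ) ^ (-(2 * d + t) / 2) * (1 / 2) * Gamma (d + t / 2)) := by
    intro t ht
    have h1 := integral_rpow_mul_exp_neg_mul_rpow (p := 2) (q := 2 * d - 1 + t) (b := d)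
      two_pos (by linarith) hd'
    have hpos : 0 < (d : ℝ) ^ (-(2 * d + t) / 2) * (1 / 2) * Gamma (d + t / 2) := by
      have : 0 < Gamma (d + t / 2) := Gamma_pos_of_pos (by linarith)
      positivity
    have e1 : (2 * d - 1 + t + 1 : ℝ) = 2 * d + t := by ring
    have e2 : ((2 * d + t) / 2 : ℝ) = d + t / 2 := by ring
    rw [e1, e2] at h1
    have hint : IntegrableOn (fun x : ℝ => x ^ (2 * d - 1 + t : ℝ) * exp (-d * x ^ (2 : ℝ)))
        (Set.Ioi 0) := by
      by_contra hc
      rw [integral_undef hc] at h1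
      exact hpos.ne h1
    rw [← h1, ofReal_integral_eq_lintegral_ofReal hint
      ((ae_restrict_mem measurableSet_Ioi).mono fun x (hx : 0 < x) => by positivity)]
    refine setLIntegral_congr_fun measurableSet_Ioi fun x (hx : 0 < x) => ?_
    rw [← ENNReal.ofReal_mul (by positivity), rpow_add hx, rpow_two,
      show (2 * d - 1 : ℝ) = ((2 * d - 1 : ℕ) : ℝ) by
        rw [Nat.cast_sub (by omega)]; push_cast; ring, rpow_natCast]
    ring_nf
  have h0 := lintegral_radialLaw hd (h := fun r => ENNReal.ofReal (r ^ (0 : ℝ))) (by fun_prop)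
  rw [lintegral_radialLaw hd (by fun_prop), key s hs]
  rw [key 0 (by linarith)] at h0
  simp only [rpow_zero, ENNReal.ofReal_one, lintegral_one, measure_univ, add_zero, zero_div] at h0
  have hG : 0 < Gamma d := Gamma_pos_of_pos hd'
  have hG' : 0 < Gamma (d + s / 2) := Gamma_pos_of_pos (by linarith)
  have h2 : (d : ℝ) ^ (-(2 * d + s) / 2) * (1 / 2) * Gamma (d + s / 2) =
      ((d : ℝ) ^ (-(2 * d : ℝ) / 2) * (1 / 2) * Gamma d) *
        ((d : ℝ) ^ (-s / 2) * Gamma (d + s / 2) / Gamma d) := by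
    rw [show (-(2 * d + s) / 2 : ℝ) = -(2 * d) / 2 + -s / 2 by ring, rpow_add hd']
    field_simp
  rw [h2, ENNReal.ofReal_mul (by positivity), ← mul_assoc, ← h0, one_mul]

/-- The quotient of Gamma functions is a rising factorial. In particular the second moment is one,
and all even moments lie between `1` and `exp (n ^ 2 / (2 * d))`; this is what makes the two
ensembles comparable for words of length `O(√d)`. -/
lemma integral_pow_radialLaw {d : ℕ} (hd : 0 < d) (n : ℕ) :
    Integrable (fun r => r ^ (2 * n)) (radialLaw d) ∧
      ∫ r, r ^ (2 * n) ∂radialLaw d = ∏ j ∈ Finset.range n, (1 + j / d : ℝ) := by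
  have hd' : (0 : ℝ) < d := by exact_mod_cast hd
  have h := lintegral_rpow_radialLaw hd (s := (2 * n : ℕ)) (by positivity)
  simp_rw [Real.rpow_natCast] at h
  have hI : Integrable (fun r => r ^ (2 * n)) (radialLaw d) := by
    refine ⟨by fun_prop, ?_⟩
    rw [hasFiniteIntegral_iff_ofReal
      (Filter.Eventually.of_forall fun r => (even_two_mul n).pow_nonneg r), h]
    exact ENNReal.ofReal_lt_top
  refine ⟨hI, ?_⟩
  rw [integral_eq_lintegral_of_nonneg_ae
    (Filter.Eventually.of_forall fun r => (even_two_mul n).pow_nonneg r) (by fun_prop), h]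
  have hG : 0 < Real.Gamma d := Real.Gamma_pos_of_pos hd'
  have key : (d : ℝ) ^ (-(2 * n : ℕ) / 2 : ℝ) * Real.Gamma (d + (2 * n : ℕ) / 2) /
      Real.Gamma d = ∏ j ∈ Finset.range n, (1 + j / d : ℝ) := by
    have e1 : (-(2 * n : ℕ) / 2 : ℝ) = -(n : ℝ) := by push_cast; ring
    have e2 : (d + (2 * n : ℕ) / 2 : ℝ) = d + n := by push_cast; ring
    rw [e1, e2, Real.rpow_neg hd'.le, Real.rpow_natCast]
    clear e1 e2 hI h
    induction n with
    | zero => simp [hG.ne']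
    | succ n ih =>
      rw [Finset.prod_range_succ, ← ih]
      push_cast
      rw [← add_assoc, Real.Gamma_add_one (by positivity), pow_succ]
      field_simp
  rw [key, ENNReal.toReal_ofReal (Finset.prod_nonneg fun j _ => by positivity)]

lemma one_le_integral_pow_radialLaw {d : ℕ} (hd : 0 < d) (n : ℕ) :
    1 ≤ ∫ r, r ^ (2 * n) ∂radialLaw d := by
  rw [(integral_pow_radialLaw hd n).2]
  refine Finset.prod_induction _ (1 ≤ ·) (fun _ _ => one_le_mul_of_one_le_of_one_le) le_rfl
    fun j _ => ?_
  have : (0 : ℝ) ≤ j / d := by positivity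
  linarith

lemma integral_pow_radialLaw_le {d : ℕ} (hd : 0 < d) (n : ℕ) :
    ∫ r, r ^ (2 * n) ∂radialLaw d ≤ Real.exp (n ^ 2 / (2 * d)) := by
  rw [(integral_pow_radialLaw hd n).2]
  have hd' : (0 : ℝ) < d := by exact_mod_cast hd
  calc ∏ j ∈ Finset.range n, (1 + j / d : ℝ) ≤ ∏ j ∈ Finset.range n, Real.exp (j / d) := by
        refine Finset.prod_le_prod (fun j _ => by positivity) fun j _ => ?_
        linarith [Real.add_one_le_exp (j / d : ℝ)]
    _ = Real.exp ((∑ j ∈ Finset.range n, (j : ℝ)) / d) := by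
        rw [← Real.exp_sum, Finset.sum_div]
    _ ≤ _ := by
        have h : (∑ j ∈ Finset.range n, (j : ℝ)) ≤ n ^ 2 / 2 := by
          clear hd hd'
          induction n with
          | zero => simp
          | succ n ih => rw [Finset.sum_range_succ]; push_cast; nlinarith
        rw [← div_div]
        gcongr

/-- The exact value is `d / (d - 1)`. The inverse square of the radius appears in the gradient of
the normalization `v ↦ v / ‖v‖`; the requirement `2 ≤ d` makes it integrable. -/
lemma integral_inv_sq_radialLaw {d : ℕ} (hd : 2 ≤ d) :
    Integrable (fun r => (r ^ 2)⁻¹) (radialLaw d) ∧ ∫ r, (r ^ 2)⁻¹ ∂radialLaw d ≤ 2 := by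
  have hd0 : 0 < d := by omega
  have hd' : (2 : ℝ) ≤ d := by exact_mod_cast hd
  have h := lintegral_rpow_radialLaw hd0 (s := -2) (by linarith)
  have hc : ∫⁻ r, ENNReal.ofReal (r ^ (-2 : ℝ)) ∂radialLaw d =
      ∫⁻ r, ENNReal.ofReal (r ^ 2)⁻¹ ∂radialLaw d := by
    refine lintegral_congr_ae ((ae_pos_radialLaw hd0).mono fun r hr => ?_)
    simp only
    rw [Real.rpow_neg hr.le, Real.rpow_two]
  rw [hc] at h
  have h0 : 0 ≤ᵐ[radialLaw d] fun r => (r ^ 2)⁻¹ :=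
    Filter.Eventually.of_forall fun r => by positivity
  refine ⟨⟨by fun_prop, ?_⟩, ?_⟩
  · rw [hasFiniteIntegral_iff_ofReal h0, h]
    exact ENNReal.ofReal_lt_top
  · rw [integral_eq_lintegral_of_nonneg_ae h0 (by fun_prop), h]
    have hg := Real.Gamma_add_one (s := (d : ℝ) - 1) (by linarith)
    have hG : 0 < Real.Gamma ((d : ℝ) - 1) := Real.Gamma_pos_of_pos (by linarith)
    rw [sub_add_cancel] at hg
    have e1 : (-(-2) / 2 : ℝ) = 1 := by norm_num
    have e2 : (d + -2 / 2 : ℝ) = d - 1 := by ring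
    rw [e1, e2, Real.rpow_one, hg, mul_div_mul_right _ _ hG.ne']
    rw [ENNReal.toReal_ofReal (div_nonneg (by linarith) (by linarith)),
      div_le_iff₀ (by linarith)]
    linarith

/-! ### The Fock space of polynomials, with creation and annihilation operators. -/

section Fock

open MvPolynomial

variable {J : Type*}

/-- The product of the factorials of the exponents. -/
def fockWeight (α : J →₀ ℕ) : ℝ := α.prod fun _ n => (n.factorial : ℝ)

lemma fockWeight_pos (α : J →₀ ℕ) : 0 < fockWeight α :=
  Finset.prod_pos fun _ _ => by positivity

lemma fockWeight_add_single (α : J →₀ ℕ) (j : J) :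
    fockWeight (α + Finsupp.single j 1) = (α j + 1) * fockWeight α := by
  classical
  unfold fockWeight
  have h1 : (α + Finsupp.single j 1).prod (fun _ n => (n.factorial : ℝ)) =
      ∏ i ∈ insert j α.support, (((α + Finsupp.single j 1 : J →₀ ℕ) i).factorial : ℝ) := by
    refine Finsupp.prod_of_support_subset _ ?_ _ (by simp)
    intro i hi
    by_cases h : i = j
    · simp [h]
    · rw [Finsupp.mem_support_iff, Finsupp.add_apply, Finsupp.single_eq_of_ne h, add_zero] at hi
      exact Finset.mem_insert_of_mem (Finsupp.mem_support_iff.2 hi)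
  have h2 : α.prod (fun _ n => (n.factorial : ℝ)) =
      ∏ i ∈ insert j α.support, ((α i).factorial : ℝ) :=
    Finsupp.prod_of_support_subset _ (Finset.subset_insert _ _) _ (by simp)
  rw [h1, h2, ← Finset.mul_prod_erase _ _ (Finset.mem_insert_self j α.support),
    ← Finset.mul_prod_erase _ (fun i => ((α i).factorial : ℝ)) (Finset.mem_insert_self j α.support)]
  have h3 : ∏ x ∈ (insert j α.support).erase j, (((α + Finsupp.single j 1 : J →₀ ℕ) x).factorial : ℝ) =
      ∏ x ∈ (insert j α.support).erase j, ((α x).factorial : ℝ) := by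
    refine Finset.prod_congr rfl fun x hx => ?_
    rw [Finsupp.add_apply, Finsupp.single_eq_of_ne (Finset.ne_of_mem_erase hx), add_zero]
  rw [h3, Finsupp.add_apply, Finsupp.single_eq_same, Nat.factorial_succ]
  push_cast
  ring

/-- The inner product on polynomials that makes multiplication by a variable adjoint to the
partial derivative. -/
noncomputable def fockForm : MvPolynomial J ℝ →ₗ[ℝ] MvPolynomial J ℝ →ₗ[ℝ] ℝ :=
  LinearMap.mk₂ ℝ (fun f g => ∑ α ∈ f.support, fockWeight α * coeff α f * coeff α g)
    (fun f f' g => by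
      classical
      have key : ∀ (h : MvPolynomial J ℝ) (s : Finset (J →₀ ℕ)), h.support ⊆ s →
          ∑ α ∈ h.support, fockWeight α * coeff α h * coeff α g =
          ∑ α ∈ s, fockWeight α * coeff α h * coeff α g := fun h s hs =>
        Finset.sum_subset hs fun α _ hα => by simp [notMem_support_iff.1 hα]
      rw [key (f + f') (f.support ∪ f'.support) MvPolynomial.support_add,
        key f _ Finset.subset_union_left, key f' _ Finset.subset_union_right,
        ← Finset.sum_add_distrib]
      exact Finset.sum_congr rfl fun α _ => by rw [coeff_add]; ring)
    (fun c f g => by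
      rw [smul_eq_mul, Finset.mul_sum, Finset.sum_subset (support_smul (S₁ := ℝ) (a := c) (f := f))
        fun α _ hα => by simp [notMem_support_iff.1 hα]]
      exact Finset.sum_congr rfl fun α _ => by rw [coeff_smul, smul_eq_mul]; ring)
    (fun f g g' => by
      rw [← Finset.sum_add_distrib]
      exact Finset.sum_congr rfl fun α _ => by rw [coeff_add]; ring)
    (fun c f g => by
      rw [smul_eq_mul, Finset.mul_sum]
      exact Finset.sum_congr rfl fun α _ => by rw [coeff_smul, smul_eq_mul]; ring)

lemma fockForm_apply (f g : MvPolynomial J ℝ) :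
    fockForm f g = ∑ α ∈ f.support, fockWeight α * coeff α f * coeff α g := rfl

lemma fockForm_eq_sum {f g : MvPolynomial J ℝ} {s : Finset (J →₀ ℕ)} (hs : f.support ⊆ s) :
    fockForm f g = ∑ α ∈ s, fockWeight α * coeff α f * coeff α g :=
  Finset.sum_subset hs fun α _ hα => by simp [notMem_support_iff.1 hα]

lemma fockForm_comm (f g : MvPolynomial J ℝ) : fockForm f g = fockForm g f := by
  classical
  rw [fockForm_eq_sum (Finset.subset_union_left (s₂ := g.support)),
    fockForm_eq_sum (Finset.subset_union_right (s₁ := f.support))]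
  exact Finset.sum_congr rfl fun α _ => by ring

lemma fockForm_self_nonneg (f : MvPolynomial J ℝ) : 0 ≤ fockForm f f :=
  Finset.sum_nonneg fun α _ => by
    rw [mul_assoc]
    exact mul_nonneg (fockWeight_pos α).le (mul_self_nonneg _)

lemma fockForm_one_left (f : MvPolynomial J ℝ) : fockForm 1 f = coeff 0 f := by
  rw [fockForm_apply, support_one]
  simp [fockWeight]

lemma fockForm_monomial (α β : J →₀ ℕ) (a b : ℝ) [Decidable (α = β)] :
    fockForm (monomial α a) (monomial β b) = if α = β then fockWeight α * a * b else 0 := by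
  classical
  rw [fockForm_eq_sum support_monomial_subset, Finset.sum_singleton, coeff_monomial, coeff_monomial]
  by_cases h : α = β
  · simp [h]
  · simp [h, Ne.symm h]

/-- On monomials both sides vanish unless the exponents differ by one unit at `j`, and then the
identity is the recursion `(n + 1)! = (n + 1) * n!` of the weights. -/
lemma fockForm_X_mul (j : J) (f g : MvPolynomial J ℝ) :
    fockForm (X j * f) g = fockForm f (pderiv j g) := by
  classical
  induction f using MvPolynomial.induction_on' with
  | add p q hp hq => rw [mul_add, map_add, map_add, LinearMap.add_apply, LinearMap.add_apply, hp, hq]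
  | monomial α a =>
    induction g using MvPolynomial.induction_on' with
    | add p q hp hq => rw [map_add, map_add, map_add, hp, hq]
    | monomial β b =>
      rw [X, monomial_mul, pderiv_monomial, fockForm_monomial, fockForm_monomial, one_mul]
      by_cases h : Finsupp.single j 1 + α = β
      · subst h
        rw [if_pos rfl, add_comm, fockWeight_add_single]
        simp
        ring
      · rw [if_neg h]
        -- The subtraction is truncated: equality here without equality in `h` forces `β j = 0`, and
        -- the derivative then carries the factor zero.
        by_cases h2 : α = β - Finsupp.single j 1
        · have : β j = 0 := by
            by_contra h3
            apply h
            rw [h2, add_comm]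
            exact tsub_add_cancel_of_le (Finsupp.single_le_iff.2 (Nat.one_le_iff_ne_zero.2 h3))
          simp [this]
        · rw [if_neg h2]

/-- Positivity of the form at `t • f - g`. This weighted inequality plays the role of Cauchy-Schwarz
below. -/
lemma fockForm_add_le (f g : MvPolynomial J ℝ) {t : ℝ} (ht : 0 < t) :
    2 * fockForm f g ≤ t * fockForm f f + t⁻¹ * fockForm g g := by
  have h := fockForm_self_nonneg (t • f - g)
  simp only [map_sub, map_smul, LinearMap.sub_apply, LinearMap.smul_apply, smul_eq_mul] at h
  rw [fockForm_comm g f] at h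
  have h2 := mul_le_mul_of_nonneg_left h (inv_pos.2 ht).le
  have h3 : t⁻¹ * t = 1 := inv_mul_cancel₀ ht.ne'
  have h4 : t⁻¹ * (t * (t * fockForm f f) - t * fockForm f g - (t * fockForm f g - fockForm g g)) =
    (t⁻¹ * t) * (t * fockForm f f) - 2 * ((t⁻¹ * t) * fockForm f g) + t⁻¹ * fockForm g g := by ring
  rw [h3] at h4
  nlinarith

lemma coeff_X_mul_pderiv (j : J) (f : MvPolynomial J ℝ) (α : J →₀ ℕ) :
    coeff α (X j * pderiv j f) = α j * coeff α f := by
  classical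
  induction f using MvPolynomial.induction_on' with
  | add p q hp hq => rw [map_add, mul_add, coeff_add, coeff_add, hp, hq]; ring
  | monomial β b =>
    rw [X_mul_pderiv_monomial, coeff_smul, coeff_monomial]
    by_cases h : β = α
    · simp [h]
    · simp [h]

/-- By adjointness the left side is the form of the number operator `∑ X_j ∂_j`, which is diagonal
on monomials with the degree as eigenvalue. -/
lemma sum_fockForm_pderiv_le [Fintype J] {n : ℕ} {f : MvPolynomial J ℝ} (hf : f.totalDegree ≤ n) :
    ∑ j, fockForm (pderiv j f) (pderiv j f) ≤ n * fockForm f f := by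
  have h : ∀ j, fockForm (pderiv j f) (pderiv j f) =
      ∑ α ∈ f.support, (α j : ℝ) * (fockWeight α * coeff α f * coeff α f) := by
    intro j
    rw [← fockForm_X_mul, fockForm_comm, fockForm_apply]
    exact Finset.sum_congr rfl fun α _ => by rw [coeff_X_mul_pderiv]; ring
  simp_rw [h]
  rw [Finset.sum_comm, fockForm_apply, Finset.mul_sum]
  refine Finset.sum_le_sum fun α hα => ?_
  rw [← Finset.sum_mul]
  have h1 : 0 ≤ fockWeight α * coeff α f * coeff α f := by
    rw [mul_assoc]
    exact mul_nonneg (fockWeight_pos α).le (mul_self_nonneg _)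
  refine mul_le_mul_of_nonneg_right ?_ h1
  have h2 := (le_totalDegree hα).trans hf
  rw [Finsupp.sum_fintype _ _ (by simp)] at h2
  exact_mod_cast h2

section Vector

variable {I O : Type*} [Fintype I] [Fintype O]

/-- The squared norm of a vector of polynomials. -/
noncomputable def fockNormSq (Ψ : I → MvPolynomial J ℝ) : ℝ := ∑ i, fockForm (Ψ i) (Ψ i)

lemma fockNormSq_nonneg (Ψ : I → MvPolynomial J ℝ) : 0 ≤ fockNormSq Ψ :=
  Finset.sum_nonneg fun _ _ => fockForm_self_nonneg _

lemma sum_fockForm_pderiv_le_of_injective [Fintype J] {e : O → I → J}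
    (he : Function.Injective (Function.uncurry e)) {n : ℕ} {f : MvPolynomial J ℝ}
    (hf : f.totalDegree ≤ n) :
    ∑ o, ∑ i, fockForm (pderiv (e o i) f) (pderiv (e o i) f) ≤ n * fockForm f f := by
  classical
  refine le_trans ?_ (sum_fockForm_pderiv_le hf)
  rw [← Fintype.sum_prod_type' (fun o i => fockForm (pderiv (e o i) f) (pderiv (e o i) f)),
    ← Finset.sum_image (f := fun j => fockForm (pderiv j f) (pderiv j f))
    (g := fun x : O × I => e x.1 x.2) (fun x _ y _ h => he h)]
  exact Finset.sum_le_sum_of_subset_of_nonneg (Finset.subset_univ _)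
    fun _ _ _ => fockForm_self_nonneg _

/-- Moving the variables across the form by the commutation relation leaves a diagonal part, worth
`card O` times the norm, and the exchange terms `⟨∂_{o i'} Ψ_i, ∂_{o i} Ψ_{i'}⟩`. Those are split by
Cauchy-Schwarz and bounded by the number operator; injectivity of `e` ensures that each mode is
counted at most once. -/
lemma fockNormSq_creation_le [Fintype J] {e : O → I → J}
    (he : Function.Injective (Function.uncurry e)) {n : ℕ} {Ψ : I → MvPolynomial J ℝ}
    (hΨ : ∀ i, (Ψ i).totalDegree ≤ n) :
    fockNormSq (fun o => ∑ i, X (e o i) * Ψ i) ≤ (Fintype.card O + n) * fockNormSq Ψ := by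
  classical
  have h1 : ∀ o i i', fockForm (X (e o i) * Ψ i) (X (e o i') * Ψ i') =
      (if i = i' then fockForm (Ψ i) (Ψ i') else 0) +
        fockForm (pderiv (e o i') (Ψ i)) (pderiv (e o i) (Ψ i')) := by
    intro o i i'
    rw [fockForm_X_mul, pderiv_mul, pderiv_X, map_add]
    congr 1
    · by_cases h : i = i'
      · subst h
        simp
      · have hne : e o i' ≠ e o i := fun h' => h (by
          have := @he (o, i') (o, i) h'
          simpa using (congrArg Prod.snd this).symm)
        simp [h, Pi.single_eq_of_ne hne]
    · rw [fockForm_comm, fockForm_X_mul, fockForm_comm]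
  have h2 : ∀ o i i', fockForm (pderiv (e o i') (Ψ i)) (pderiv (e o i) (Ψ i')) ≤
      1 / 2 * fockForm (pderiv (e o i') (Ψ i)) (pderiv (e o i') (Ψ i)) +
      1 / 2 * fockForm (pderiv (e o i) (Ψ i')) (pderiv (e o i) (Ψ i')) := by
    intro o i i'
    have := fockForm_add_le (pderiv (e o i') (Ψ i)) (pderiv (e o i) (Ψ i')) one_pos
    rw [inv_one, one_mul, one_mul] at this
    linarith
  have h3 : ∑ o, ∑ i, ∑ i', fockForm (pderiv (e o i') (Ψ i)) (pderiv (e o i') (Ψ i)) ≤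
      n * fockNormSq Ψ := by
    rw [Finset.sum_comm, fockNormSq, Finset.mul_sum]
    exact Finset.sum_le_sum fun i _ => sum_fockForm_pderiv_le_of_injective he (hΨ i)
  have h4 : ∑ o, ∑ i, ∑ i', fockForm (pderiv (e o i) (Ψ i')) (pderiv (e o i) (Ψ i')) =
      ∑ o, ∑ i, ∑ i', fockForm (pderiv (e o i') (Ψ i)) (pderiv (e o i') (Ψ i)) :=
    Finset.sum_congr rfl fun o _ => Finset.sum_comm
  calc fockNormSq (fun o => ∑ i, X (e o i) * Ψ i)
      = ∑ o : O, ∑ i, ∑ i', ((if i = i' then fockForm (Ψ i) (Ψ i') else 0) +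
        fockForm (pderiv (e o i') (Ψ i)) (pderiv (e o i) (Ψ i'))) := by
        simp_rw [fockNormSq, map_sum, LinearMap.sum_apply, h1]
        exact Finset.sum_congr rfl fun o _ => Finset.sum_comm
    _ ≤ ∑ o : O, ∑ i, ∑ i', ((if i = i' then fockForm (Ψ i) (Ψ i') else 0) +
        (1 / 2 * fockForm (pderiv (e o i') (Ψ i)) (pderiv (e o i') (Ψ i)) +
        1 / 2 * fockForm (pderiv (e o i) (Ψ i')) (pderiv (e o i) (Ψ i')))) := by
        gcongr with o _ i _ i' _
        exact h2 o i i'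
    _ = Fintype.card O * fockNormSq Ψ +
        ∑ o, ∑ i, ∑ i', fockForm (pderiv (e o i') (Ψ i)) (pderiv (e o i') (Ψ i)) := by
        simp_rw [Finset.sum_add_distrib, ← Finset.mul_sum, h4, Finset.sum_ite_eq,
          Finset.mem_univ, if_true, Finset.sum_const, Finset.card_univ, nsmul_eq_mul]
        rw [fockNormSq]
        ring
    _ ≤ _ := by rw [add_mul]; gcongr

lemma totalDegree_pderiv_le (j : J) (f : MvPolynomial J ℝ) :
    (pderiv j f).totalDegree ≤ f.totalDegree := by
  classical
  conv_lhs => rw [f.as_sum, map_sum]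
  refine totalDegree_finsetSum_le fun α hα => ?_
  rw [pderiv_monomial]
  refine (totalDegree_monomial_le _ _).trans ((?_ : _ ≤ _).trans (le_totalDegree hα))
  exact Finsupp.degree_mono tsub_le_self

lemma totalDegree_sum_le {ι : Type*} [Fintype ι] {n : ℕ} {f : ι → MvPolynomial J ℝ}
    (hf : ∀ i, (f i).totalDegree ≤ n) : (∑ i, f i).totalDegree ≤ n :=
  totalDegree_finsetSum_le fun i _ => hf i

/-- This operator is adjoint to a creation operator with the roles of `I` and `O` exchanged, and
differentiation does not raise the degree, so the creation bound passes to it by duality. -/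
lemma fockNormSq_annihilation_le [Fintype J] [Nonempty I] {e : O → I → J}
    (he : Function.Injective (Function.uncurry e)) {n : ℕ} {Ψ : I → MvPolynomial J ℝ}
    (hΨ : ∀ i, (Ψ i).totalDegree ≤ n) :
    fockNormSq (fun o => ∑ i, pderiv (e o i) (Ψ i)) ≤ (Fintype.card I + n) * fockNormSq Ψ := by
  set χ : O → MvPolynomial J ℝ := fun o => ∑ i, pderiv (e o i) (Ψ i) with hχ
  have hK : (0 : ℝ) < Fintype.card I + n := by
    have : 0 < Fintype.card I := Fintype.card_pos
    positivity
  have hdeg : ∀ o, (χ o).totalDegree ≤ n := fun o =>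
    totalDegree_sum_le fun i => (totalDegree_pderiv_le _ _).trans (hΨ i)
  have h1 := fockNormSq_creation_le (e := fun i o => e o i)
    (fun x y h => Prod.swap_injective (he h)) hdeg
  have h2 : 2 * fockNormSq χ ≤ (Fintype.card I + n : ℝ)⁻¹ *
      fockNormSq (fun i => ∑ o, X (e o i) * χ o) + (Fintype.card I + n) * fockNormSq Ψ := by
    have : fockNormSq χ = ∑ i, fockForm (∑ o, X (e o i) * χ o) (Ψ i) := by
      simp_rw [map_sum, LinearMap.sum_apply, fockForm_X_mul]
      rw [Finset.sum_comm, fockNormSq]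
      exact Finset.sum_congr rfl fun o _ => by rw [← map_sum]
    rw [this, fockNormSq, fockNormSq, Finset.mul_sum, Finset.mul_sum, Finset.mul_sum,
      ← Finset.sum_add_distrib]
    refine Finset.sum_le_sum fun i _ => ?_
    have := fockForm_add_le (∑ o, X (e o i) * χ o) (Ψ i) (inv_pos.2 hK)
    rwa [inv_inv] at this
  have h3 : (Fintype.card I + n : ℝ)⁻¹ * fockNormSq (fun i => ∑ o, X (e o i) * χ o) ≤
      fockNormSq χ := by
    rw [inv_mul_le_iff₀ hK]
    exact h1
  linarith

lemma fockNormSq_add_le (Ψ χ : I → MvPolynomial J ℝ) {α β S : ℝ} (hα : 0 < α) (hβ : 0 < β)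
    (h1 : fockNormSq Ψ ≤ α ^ 2 * S) (h2 : fockNormSq χ ≤ β ^ 2 * S) :
    fockNormSq (fun i => Ψ i + χ i) ≤ (α + β) ^ 2 * S := by
  -- This weight turns the bound on the cross term into exactly `(α + β) ^ 2`.
  have ht : 0 < β / α := by positivity
  have h : fockNormSq (fun i => Ψ i + χ i) ≤
      (1 + β / α) * fockNormSq Ψ + (1 + (β / α)⁻¹) * fockNormSq χ := by
    simp_rw [fockNormSq, Finset.mul_sum, ← Finset.sum_add_distrib]
    refine Finset.sum_le_sum fun i _ => ?_
    have := fockForm_add_le (Ψ i) (χ i) ht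
    simp only [map_add, LinearMap.add_apply]
    rw [fockForm_comm (χ i) (Ψ i)]
    linarith
  calc _ ≤ _ := h
    _ ≤ (1 + β / α) * (α ^ 2 * S) + (1 + (β / α)⁻¹) * (β ^ 2 * S) := by gcongr
    _ = _ := by field_simp; ring

end Vector

/-- The sum of an annihilation and a creation operator. -/
noncomputable def fieldOp (a b : J) : Module.End ℝ (MvPolynomial J ℝ) :=
  (pderiv a).toLinearMap + LinearMap.mulLeft ℝ (X b)

lemma fieldOp_apply (a b : J) (f : MvPolynomial J ℝ) :
    fieldOp a b f = pderiv a f + X b * f := rfl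

lemma fockForm_fieldOp (a b : J) (f g : MvPolynomial J ℝ) :
    fockForm (fieldOp a b f) g = fockForm f (fieldOp b a g) := by
  rw [fieldOp_apply, fieldOp_apply, map_add, map_add, LinearMap.add_apply, fockForm_X_mul,
    fockForm_comm (pderiv a f) g, ← fockForm_X_mul, fockForm_comm, add_comm]

lemma totalDegree_fieldOp_le {a b : J} {n : ℕ} {f : MvPolynomial J ℝ} (hf : f.totalDegree ≤ n) :
    (fieldOp a b f).totalDegree ≤ n + 1 := by
  rw [fieldOp_apply]
  refine (totalDegree_add _ _).trans (max_le ?_ ?_)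
  · exact (totalDegree_pderiv_le _ _).trans (hf.trans n.le_succ)
  · refine (totalDegree_mul _ _).trans ?_
    rw [totalDegree_X]
    omega

/-- The Fock space form of the norm `√(card I) + √(card O)` of a rectangular Gaussian matrix: the
annihilation part has norm `√(card I + n)`, the creation part `√(card O + n)`, on vectors of degree
at most `n`. -/
lemma fockNormSq_fieldOp_le {I O : Type*} [Fintype I] [Fintype O] [Nonempty I] [Nonempty O]
    [Fintype J] {e e' : O → I → J} (he : Function.Injective (Function.uncurry e))
    (he' : Function.Injective (Function.uncurry e')) {n : ℕ} {Ψ : I → MvPolynomial J ℝ}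
    (hΨ : ∀ i, (Ψ i).totalDegree ≤ n) :
    fockNormSq (fun o => ∑ i, fieldOp (e o i) (e' o i) (Ψ i)) ≤
      (√(Fintype.card I + n) + √(Fintype.card O + n)) ^ 2 * fockNormSq Ψ := by
  have hI : (0 : ℝ) < Fintype.card I := by exact_mod_cast Fintype.card_pos
  have hO : (0 : ℝ) < Fintype.card O := by exact_mod_cast Fintype.card_pos
  have h := fockNormSq_add_le (fun o => ∑ i, pderiv (e o i) (Ψ i))
    (fun o => ∑ i, X (e' o i) * Ψ i) (α := √(Fintype.card I + n)) (β := √(Fintype.card O + n))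
    (S := fockNormSq Ψ) (by positivity) (by positivity)
    (by rw [Real.sq_sqrt (by positivity)]; exact fockNormSq_annihilation_le he hΨ)
    (by rw [Real.sq_sqrt (by positivity)]; exact fockNormSq_creation_le he' hΨ)
  simpa only [← Finset.sum_add_distrib, ← fieldOp_apply] using h

section VarOp

variable {E : Type*}

/-- Multiplication by the variable `x`, the variables being indexed by pairs of a mode and a flag
that tells whether the variable is conjugated. -/
noncomputable def varOp (x : Bool × E) : Module.End ℝ (MvPolynomial (Bool × E) ℝ) :=
  fieldOp x (!x.1, x.2)

lemma pderiv_varOp [DecidableEq E] (x y : Bool × E) (f : MvPolynomial (Bool × E) ℝ) :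
    pderiv x (varOp y f) = varOp y (pderiv x f) + if y = (!x.1, x.2) then f else 0 := by
  have hcomm : pderiv x (pderiv y f) = pderiv y (pderiv x f) := by
    have h : ⁅pderiv (R := ℝ) x, pderiv (R := ℝ) y⁆ = 0 := by
      classical
      refine MvPolynomial.derivation_ext fun i => ?_
      rw [Derivation.commutator_apply]
      simp [pderiv_X, Pi.single_apply, apply_ite]
    have := congrArg (fun D => D f) h
    rw [Derivation.commutator_apply] at this
    exact sub_eq_zero.1 this
  rw [varOp, fieldOp_apply, fieldOp_apply, map_add, hcomm, pderiv_mul, pderiv_X, Pi.single_apply]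
  obtain ⟨a, i⟩ := x
  obtain ⟨b, j⟩ := y
  by_cases h : (b, j) = (!a, i)
  · obtain ⟨rfl, rfl⟩ := Prod.mk.inj h
    simp
    ring
  · have h' : ¬ ((!b, j) = (a, i)) := by
      rintro h2
      obtain ⟨rfl, rfl⟩ := Prod.mk.inj h2
      simp at h
    rw [if_neg h, if_neg h']
    ring

/-- The commutator of the annihilation part of `x` with the creation part of `y` cancels the one
with the roles exchanged, as `y` is the conjugate of `x` exactly when `x` is the conjugate of `y`.
Hence these operators can stand for commuting random variables. -/
lemma commute_varOp (x y : Bool × E) : Commute (varOp x) (varOp y) := by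
  classical
  refine LinearMap.ext fun f => ?_
  rw [Module.End.mul_apply, Module.End.mul_apply]
  have h1 : varOp x (varOp y f) = pderiv x (varOp y f) + X (!x.1, x.2) * varOp y f := rfl
  have h2 : varOp y (varOp x f) = pderiv y (varOp x f) + X (!y.1, y.2) * varOp x f := rfl
  have h3 : varOp y f = pderiv y f + X (!y.1, y.2) * f := rfl
  have h4 : varOp x f = pderiv x f + X (!x.1, x.2) * f := rfl
  have h5 : varOp y (pderiv x f) = pderiv y (pderiv x f) + X (!y.1, y.2) * pderiv x f := rfl
  rw [h2, h1, pderiv_varOp, h3, h4, h5, map_add, pderiv_mul, pderiv_X, Pi.single_apply]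
  obtain ⟨a, i⟩ := x
  obtain ⟨b, j⟩ := y
  by_cases h : (b, j) = (!a, i)
  · obtain ⟨rfl, rfl⟩ := Prod.mk.inj h
    simp
    ring
  · have h' : ¬ ((!a, i) = (b, j)) := fun h2 => h h2.symm
    rw [if_neg h, if_neg h']
    ring

lemma pderiv_list_prod_varOp [DecidableEq E] (x : Bool × E) (l : List (Bool × E)) :
    pderiv x ((l.map varOp).prod 1) =
      (l.count (!x.1, x.2) : ℝ) • ((l.erase (!x.1, x.2)).map varOp).prod 1 := by
  induction l with
  | nil => simp
  | cons y l ih =>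
    rw [List.map_cons, List.prod_cons, Module.End.mul_apply, pderiv_varOp, ih, map_smul]
    by_cases h : y = (!x.1, x.2)
    · subst h
      rw [if_pos rfl, List.count_cons_self, List.erase_cons_head]
      by_cases hm : (!x.1, x.2) ∈ l
      · have : ((l.map varOp).prod : Module.End ℝ _) =
            varOp (!x.1, x.2) * ((l.erase (!x.1, x.2)).map varOp).prod := by
          rw [← List.prod_cons, ← List.map_cons]
          refine ((List.perm_cons_erase hm).map varOp).prod_eq' ?_
          exact (List.pairwise_map.2 (List.pairwise_of_forall fun x y => commute_varOp x y))
        rw [this, Module.End.mul_apply]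
        push_cast
        rw [add_smul, one_smul]
      · rw [List.count_eq_zero_of_not_mem hm]
        simp
    · rw [if_neg h, add_zero, List.count_cons_of_ne h, List.erase_cons_tail (by simpa using h),
        List.map_cons, List.prod_cons, Module.End.mul_apply]

/-- The vacuum expectation of a product of variables. -/
noncomputable def vacuumMoment (l : List (Bool × E)) : ℝ := coeff 0 ((l.map varOp).prod 1)

lemma vacuumMoment_nil : vacuumMoment ([] : List (Bool × E)) = 1 := by
  simp [vacuumMoment]

/-- Wick's recursion: the creation part of the leftmost variable has no constant term, and the
annihilation part pairs it with each occurrence of its conjugate. -/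
lemma vacuumMoment_cons [DecidableEq E] (x : Bool × E) (l : List (Bool × E)) :
    vacuumMoment (x :: l) =
      l.count (!x.1, x.2) * vacuumMoment (l.erase (!x.1, x.2)) := by
  rw [vacuumMoment, List.map_cons, List.prod_cons, Module.End.mul_apply, varOp, fieldOp_apply,
    coeff_add, pderiv_list_prod_varOp, coeff_smul, smul_eq_mul, vacuumMoment,
    coeff_X_mul']
  simp

lemma vacuumMoment_nonneg (l : List (Bool × E)) : 0 ≤ vacuumMoment l := by
  classical
  induction h : l.length using Nat.strong_induction_on generalizing l with
  | _ n ih =>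
    cases l with
    | nil => rw [vacuumMoment_nil]; exact zero_le_one
    | cons x l =>
      rw [vacuumMoment_cons]
      refine mul_nonneg (Nat.cast_nonneg _) (ih _ ?_ _ rfl)
      have := List.length_erase_le (a := (!x.1, x.2)) (l := l)
      simp only [List.length_cons] at h
      omega

end VarOp

/-! ### Products of rank one matrices as operators on Fock space; the Wishart moment bound. -/

section Words

variable {d p : ℕ}

/-- The operator that stands for the rank one matrix attached to the letter `s`. -/
noncomputable def stepOp (s : Fin p) :
    Module.End ℝ (Fin d → MvPolynomial (Bool × (Fin d × Fin p)) ℝ) :=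
  LinearMap.pi fun c => varOp (false, (c, s)) ∘ₗ
    ∑ c', varOp (true, (c', s)) ∘ₗ LinearMap.proj c'

lemma stepOp_apply (s : Fin p) (Ψ : Fin d → MvPolynomial (Bool × (Fin d × Fin p)) ℝ) (c : Fin d) :
    stepOp s Ψ c = varOp (false, (c, s)) (∑ c', varOp (true, (c', s)) (Ψ c')) := by
  simp [stepOp]

lemma sum_stepOp_apply (Ψ : Fin d → MvPolynomial (Bool × (Fin d × Fin p)) ℝ) :
    (∑ s, stepOp s) Ψ = fun c => ∑ s, fieldOp (false, (c, s)) (true, (c, s))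
      (∑ c', fieldOp (true, (c', s)) (false, (c', s)) (Ψ c')) := by
  ext1 c
  rw [LinearMap.sum_apply, Finset.sum_apply]
  exact Finset.sum_congr rfl fun s _ => stepOp_apply s Ψ c

/-- The adjoint of `fieldOp a b` is `fieldOp b a`, so the two factors of each step are adjoint to
each other and their product is symmetric. -/
lemma fockForm_sum_stepOp (Ψ χ : Fin d → MvPolynomial (Bool × (Fin d × Fin p)) ℝ) :
    ∑ c, fockForm ((∑ s, stepOp s) Ψ c) (χ c) = ∑ c, fockForm (Ψ c) ((∑ s, stepOp s) χ c) := by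
  simp_rw [sum_stepOp_apply, map_sum, LinearMap.sum_apply]
  rw [Finset.sum_comm]
  conv_rhs => rw [Finset.sum_comm]
  refine Finset.sum_congr rfl fun s _ => ?_
  simp_rw [fockForm_fieldOp]
  rw [Finset.sum_comm]

lemma totalDegree_sum_stepOp_le {n : ℕ} {Ψ : Fin d → MvPolynomial (Bool × (Fin d × Fin p)) ℝ}
    (hΨ : ∀ c, (Ψ c).totalDegree ≤ n) (c : Fin d) :
    ((∑ s, stepOp s) Ψ c).totalDegree ≤ n + 2 := by
  rw [sum_stepOp_apply]
  exact totalDegree_sum_le fun s => totalDegree_fieldOp_le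
    (totalDegree_sum_le fun c' => totalDegree_fieldOp_le (hΨ c'))

lemma fockNormSq_sum_stepOp_le [Nonempty (Fin d)] [Nonempty (Fin p)] {n : ℕ}
    {Ψ : Fin d → MvPolynomial (Bool × (Fin d × Fin p)) ℝ} (hΨ : ∀ c, (Ψ c).totalDegree ≤ n) :
    fockNormSq ((∑ s, stepOp s) Ψ) ≤
      ((√(p + (n + 1 : ℕ)) + √(d + (n + 1 : ℕ))) ^ 2) ^ 2 * fockNormSq Ψ := by
  rw [sum_stepOp_apply]
  have h1 := fockNormSq_fieldOp_le (I := Fin d) (O := Fin p) (n := n + 1)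
    (J := Bool × (Fin d × Fin p))
    (e := fun s c => (true, (c, s))) (e' := fun s c => (false, (c, s))) (Ψ := Ψ)
    (fun x y h => Prod.ext (congrArg (fun z => z.2.2) h) (congrArg (fun z => z.2.1) h))
    (fun x y h => Prod.ext (congrArg (fun z => z.2.2) h) (congrArg (fun z => z.2.1) h))
    (fun c => (hΨ c).trans n.le_succ)
  have h2 := fockNormSq_fieldOp_le (I := Fin p) (O := Fin d) (n := n + 1)
    (J := Bool × (Fin d × Fin p))
    (e := fun c s => (false, (c, s))) (e' := fun c s => (true, (c, s)))
    (Ψ := fun s => ∑ c', fieldOp (true, (c', s)) (false, (c', s)) (Ψ c'))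
    (fun x y h => Prod.ext (congrArg (fun z => z.2.1) h) (congrArg (fun z => z.2.2) h))
    (fun x y h => Prod.ext (congrArg (fun z => z.2.1) h) (congrArg (fun z => z.2.2) h))
    (fun s => totalDegree_sum_le fun c' => totalDegree_fieldOp_le (hΨ c'))
  rw [Fintype.card_fin, Fintype.card_fin] at h1 h2
  refine h2.trans ((mul_le_mul_of_nonneg_left h1 (sq_nonneg _)).trans (le_of_eq ?_))
  ring

lemma totalDegree_sum_stepOp_pow_le (n : ℕ) (b c : Fin d) :
    (((∑ s : Fin p, stepOp s) ^ n) (Pi.single b 1) c).totalDegree ≤ 2 * n := by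
  induction n generalizing c with
  | zero =>
    rw [pow_zero, Module.End.one_apply, Pi.single_apply]
    split_ifs <;> simp
  | succ n ih =>
    rw [pow_succ', Module.End.mul_apply]
    exact totalDegree_sum_stepOp_le ih c

lemma fockNormSq_sum_stepOp_pow_le [Nonempty (Fin d)] [Nonempty (Fin p)] {n m : ℕ} (hn : 2 * n ≤ m)
    (b : Fin d) :
    fockNormSq (((∑ s : Fin p, stepOp s) ^ n) (Pi.single b 1)) ≤
      (√(p + m) + √(d + m)) ^ (4 * n) := by
  induction n with
  | zero =>
    rw [pow_zero, Module.End.one_apply, fockNormSq, Finset.sum_eq_single b]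
    · rw [Pi.single_eq_same, fockForm_one_left]
      simp
    · intro c _ hc
      rw [Pi.single_eq_of_ne hc, map_zero]
    · simp
  | succ n ih =>
    rw [pow_succ', Module.End.mul_apply]
    refine (fockNormSq_sum_stepOp_le (totalDegree_sum_stepOp_pow_le n b)).trans ?_
    have h1 : ((2 * n + 1 : ℕ) : ℝ) ≤ m := by exact_mod_cast (by omega)
    calc _ ≤ ((√(p + m) + √(d + m)) ^ 2) ^ 2 * (√(p + m) + √(d + m)) ^ (4 * n) := by
          refine mul_le_mul ?_ (ih (by omega)) (fockNormSq_nonneg _) (by positivity)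
          gcongr
      _ = _ := by ring

lemma fockForm_sum_stepOp_pow (n : ℕ) (Ψ χ : Fin d → MvPolynomial (Bool × (Fin d × Fin p)) ℝ) :
    ∑ c, fockForm (((∑ s : Fin p, stepOp s) ^ n) Ψ c) (χ c) =
      ∑ c, fockForm (Ψ c) (((∑ s : Fin p, stepOp s) ^ n) χ c) := by
  induction n generalizing χ with
  | zero => simp
  | succ n ih =>
    rw [pow_succ', Module.End.mul_apply, fockForm_sum_stepOp, ih, ← Module.End.mul_apply, ← pow_succ,
      pow_succ']

/-- By symmetry the vacuum expectation of the power `2 * n` is the squared norm of the power `n`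
applied to the basis vector. Each application raises the degree by at most two, so only degrees up
to `2 * n` enter the norm bounds. -/
lemma coeff_sum_stepOp_pow_le [Nonempty (Fin d)] [Nonempty (Fin p)] (n : ℕ) (b : Fin d) :
    coeff 0 (((∑ s : Fin p, stepOp s) ^ (2 * n)) (Pi.single b 1) b) ≤
      (√(p + (2 * n : ℕ)) + √(d + (2 * n : ℕ))) ^ (4 * n) := by
  refine le_trans (le_of_eq ?_) (fockNormSq_sum_stepOp_pow_le le_rfl b)
  rw [fockNormSq, fockForm_sum_stepOp_pow, ← Module.End.mul_apply, ← pow_add, ← two_mul,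
    Finset.sum_eq_single b]
  · rw [Pi.single_eq_same, fockForm_one_left]
  · intro c _ hc
    rw [Pi.single_eq_of_ne hc, map_zero, LinearMap.zero_apply]
  · simp

end Words

end Fock

/-! ### Gaussian expectations of words as vacuum expectations. -/

/-- A power of a sum is the sum over all words of the products of the letters. -/
lemma sum_pow_eq_sum_list_prod {R ι : Type*} [Semiring R] [Fintype ι] (a : ι → R) (m : ℕ) :
    (∑ s, a s) ^ m = ∑ w : Fin m → ι, ((List.ofFn w).map a).prod := by
  induction m with
  | zero => simp
  | succ m ih =>
    rw [pow_succ', ih, Finset.sum_mul_sum, ← Fintype.sum_prod_type',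
      ← (Fin.consEquiv fun _ => ι).sum_comp]
    exact Finset.sum_congr rfl fun x _ => by simp [Fin.consEquiv]

instance (v : NNReal) : IsGaussian (complexGaussian v) := by
  have : (fun z : ℝ × ℝ => (⟨z.1, z.2⟩ : ℂ)) =
      (Complex.equivRealProdCLM.symm.toContinuousLinearMap : ℝ × ℝ →L[ℝ] ℂ) := by
    ext z
    rfl
  unfold complexGaussian
  rw [this]
  infer_instance

open Complex in
lemma map_mul_complexGaussian (v : NNReal) (c : ℂ) :
    (complexGaussian v).map (c * ·) = complexGaussian (v * ‖c‖₊ ^ 2) := by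
  have : IsProbabilityMeasure ((complexGaussian v).map (c * ·)) :=
    Measure.isProbabilityMeasure_map (by fun_prop)
  apply Measure.ext_of_charFun
  ext t
  have h : charFun ((complexGaussian v).map (c * ·)) t =
      charFun (complexGaussian v) (starRingEnd ℂ c * t) := by
    rw [charFun_apply, charFun_apply, integral_map (by fun_prop) (by fun_prop)]
    refine integral_congr_ae (Filter.Eventually.of_forall fun z => ?_)
    simp only [Complex.inner]
    rw [map_mul]
    congr 4
    ring
  rw [h, charFun_complexGaussian, charFun_complexGaussian, norm_mul, RCLike.norm_conj]
  push_cast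
  ring_nf

lemma integrable_complexGaussian (v : NNReal) (a b : ℕ) :
    Integrable (fun z => z ^ a * (starRingEnd ℂ z) ^ b) (complexGaussian v) := by
  have h := (IsGaussian.memLp_id (complexGaussian v) (a + b : ℕ) (by simp)).integrable_norm_pow'
  refine h.mono' (by fun_prop) (Filter.Eventually.of_forall fun z => ?_)
  simp [pow_add]

open Complex in
lemma integral_complexGaussian_of_ne (v : NNReal) {a b : ℕ} (hab : a ≠ b) :
    ∫ z, z ^ a * (starRingEnd ℂ z) ^ b ∂complexGaussian v = 0 := by
  have hab' : (a : ℂ) - b ≠ 0 := sub_ne_zero.2 (by exact_mod_cast hab)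
  -- Rotation by this angle preserves the law and multiplies the integrand by `exp (i (a - b) θ) =
  -- -1`.
  set θ : ℝ := Real.pi / (a - b) with hθ
  have hc : ‖exp (θ * I)‖₊ = 1 := by
    ext
    simp
  have h := map_mul_complexGaussian v (exp (θ * I))
  rw [hc, one_pow, mul_one] at h
  have h2 : exp (θ * I) ^ a * (starRingEnd ℂ (exp (θ * I))) ^ b = -1 := by
    rw [← exp_conj, map_mul, conj_I, conj_ofReal, ← exp_nat_mul, ← exp_nat_mul, ← exp_add,
      ← exp_pi_mul_I]
    congr 1
    rw [hθ]
    push_cast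
    field_simp
    ring
  have h3 : ∫ z, z ^ a * (starRingEnd ℂ z) ^ b ∂complexGaussian v =
      -∫ z, z ^ a * (starRingEnd ℂ z) ^ b ∂complexGaussian v := by
    conv_lhs => rw [← h, integral_map (by fun_prop) (by fun_prop)]
    rw [← integral_neg]
    refine integral_congr_ae (Filter.Eventually.of_forall fun z => ?_)
    simp only
    rw [map_mul, mul_pow, mul_pow, mul_mul_mul_comm, h2, neg_one_mul]
  exact self_eq_neg.1 h3

/-- This is the radial moment in dimension `d = 1`, where the rising factorial is `a!`. -/
lemma integral_norm_pow_complexGaussian_half (a : ℕ) :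
    ∫ z, ‖z‖ ^ (2 * a) ∂complexGaussian (1 / 2) = a.factorial := by
  have h := (integral_pow_radialLaw one_pos a).2
  rw [radialLaw, integral_map (by fun_prop) (by fun_prop), gaussianVector,
    integral_map (by fun_prop) (by fun_prop)] at h
  have h1 : ∀ z : Fin 1 → ℂ, ‖(WithLp.toLp 2 z : LocalSpace 1)‖ ^ (2 * a) =
      ∏ i, ‖z i‖ ^ (2 * a) := by
    intro z
    rw [EuclideanSpace.norm_eq]
    simp
  simp_rw [h1] at h
  rw [integral_fintype_prod_eq_prod (f := fun (_ : Fin 1) (z : ℂ) => ‖z‖ ^ (2 * a))] at h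
  simp only [Finset.univ_unique, Finset.prod_singleton, Nat.cast_one, mul_one, div_one] at h
  rw [h, ← Finset.prod_range_add_one_eq_factorial]
  push_cast
  exact Finset.prod_congr rfl fun j _ => add_comm _ _

open Complex in
lemma integral_complexGaussian {d : ℕ} (hd : 0 < d) (a b : ℕ) :
    ∫ z, z ^ a * (starRingEnd ℂ z) ^ b ∂complexGaussian (1 / (2 * (d : NNReal))) =
      if a = b then (a.factorial / d ^ a : ℂ) else 0 := by
  split_ifs with hab
  · subst hab
    have hd' : (0 : ℝ) < d := by exact_mod_cast hd
    set c : ℂ := Complex.ofReal (√d)⁻¹ with hc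
    have hcn : ‖c‖ = (√d)⁻¹ := by rw [hc, norm_real, Real.norm_of_nonneg (by positivity)]
    have h := map_mul_complexGaussian (1 / 2) c
    have hv : (1 / 2 : NNReal) * ‖c‖₊ ^ 2 = 1 / (2 * (d : NNReal)) := by
      ext
      push_cast
      rw [hcn, inv_pow, Real.sq_sqrt hd'.le]
      field_simp
    rw [← hv, ← h, integral_map (by fun_prop) (by fun_prop)]
    have h2 : ∀ z : ℂ, (c * z) ^ a * (starRingEnd ℂ (c * z)) ^ a =
        (((d : ℝ) ^ a)⁻¹ * ‖z‖ ^ (2 * a) : ℝ) := by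
      intro z
      rw [← mul_pow, mul_conj, Complex.normSq_eq_norm_sq, norm_mul, hcn, mul_pow, inv_pow,
        Real.sq_sqrt hd'.le]
      push_cast
      rw [mul_pow, inv_pow, ← pow_mul]
    simp_rw [h2]
    rw [integral_complex_ofReal, integral_const_mul, integral_norm_pow_complexGaussian_half]
    push_cast
    ring
  · exact integral_complexGaussian_of_ne _ hab

section Words

variable {d p : ℕ}

/-- The coordinate, possibly conjugated, that is named by the variable `x`. -/
noncomputable def varVal (φ : Fin p → LocalSpace d) (x : Bool × (Fin d × Fin p)) : ℂ :=
  if x.1 then starRingEnd ℂ (φ x.2.2 x.2.1) else φ x.2.2 x.2.1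

lemma list_prod_varVal (φ : Fin p → LocalSpace d) (l : List (Bool × (Fin d × Fin p))) :
    (l.map (varVal φ)).prod = ∏ s, ∏ c, (φ s c ^ l.count (false, (c, s)) *
      (starRingEnd ℂ (φ s c)) ^ l.count (true, (c, s))) := by
  induction l with
  | nil => simp
  | cons x l ih =>
    obtain ⟨b, c, s⟩ := x
    rw [List.map_cons, List.prod_cons, ih]
    have h : ∀ (s' : Fin p) (c' : Fin d),
        (φ s' c' ^ ((b, (c, s)) :: l).count (false, (c', s')) *
          (starRingEnd ℂ (φ s' c')) ^ ((b, (c, s)) :: l).count (true, (c', s'))) =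
        (if s' = s then (if c' = c then varVal φ (b, (c, s)) else 1) else 1) *
        (φ s' c' ^ l.count (false, (c', s')) *
          (starRingEnd ℂ (φ s' c')) ^ l.count (true, (c', s'))) := by
      intro s' c'
      rw [List.count_cons, List.count_cons]
      by_cases hs : s' = s
      · by_cases hc : c' = c
        · subst hs hc
          cases b <;> simp [varVal, pow_succ] <;> ring
        · simp [hs, hc, Ne.symm hc]
      · simp [hs, Ne.symm hs]
    simp_rw [h, Finset.prod_mul_distrib]
    congr 1
    rw [Finset.prod_eq_single s (fun s' _ hs' => by simp [hs']) (by simp)]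
    simp

lemma integrable_list_prod_varVal (l : List (Bool × (Fin d × Fin p))) :
    Integrable (fun φ : Fin p → LocalSpace d => (l.map (varVal φ)).prod)
      (Measure.pi fun _ => gaussianVector d) := by
  simp_rw [list_prod_varVal]
  refine Integrable.fintype_prod (f := fun s (v : LocalSpace d) =>
    ∏ c, (v c ^ l.count (false, (c, s)) * (starRingEnd ℂ (v c)) ^ l.count (true, (c, s))))
    fun s => ?_
  rw [gaussianVector, integrable_map_measure (Measurable.aestronglyMeasurable (by fun_prop))
    (by fun_prop)]
  exact Integrable.fintype_prod (f := fun c (z : ℂ) =>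
    z ^ l.count (false, (c, s)) * (starRingEnd ℂ z) ^ l.count (true, (c, s)))
    fun c => integrable_complexGaussian _ _ _

lemma integral_list_prod_varVal (hd : 0 < d) (l : List (Bool × (Fin d × Fin p))) :
    ∫ φ : Fin p → LocalSpace d, (l.map (varVal φ)).prod ∂(Measure.pi fun _ => gaussianVector d) =
      ∏ s, ∏ c, if l.count (false, (c, s)) = l.count (true, (c, s)) then
        ((l.count (false, (c, s))).factorial / d ^ l.count (false, (c, s)) : ℂ) else 0 := by
  simp_rw [list_prod_varVal]
  rw [integral_fintype_prod_eq_prod (f := fun s (v : LocalSpace d) =>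
    ∏ c, (v c ^ l.count (false, (c, s)) * (starRingEnd ℂ (v c)) ^ l.count (true, (c, s))))]
  refine Finset.prod_congr rfl fun s _ => ?_
  rw [gaussianVector, integral_map (by fun_prop) (Measurable.aestronglyMeasurable (by fun_prop)),
    integral_fintype_prod_eq_prod (f := fun c (z : ℂ) =>
    z ^ l.count (false, (c, s)) * (starRingEnd ℂ z) ^ l.count (true, (c, s)))]
  exact Finset.prod_congr rfl fun c _ => integral_complexGaussian hd _ _

/-- The moments factor over the coordinates, and at the coordinate of `x` one factor of the
factorial splits off. This is the recursion of `vacuumMoment_cons` with covariance `1 / d`. -/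
lemma integral_list_prod_varVal_cons (hd : 0 < d) (x : Bool × (Fin d × Fin p))
    (l : List (Bool × (Fin d × Fin p))) :
    ∫ φ : Fin p → LocalSpace d, ((x :: l).map (varVal φ)).prod
        ∂(Measure.pi fun _ => gaussianVector d) =
      (l.count (!x.1, x.2) / d : ℂ) *
        ∫ φ : Fin p → LocalSpace d, ((l.erase (!x.1, x.2)).map (varVal φ)).prod
          ∂(Measure.pi fun _ => gaussianVector d) := by
  have hd' : (d : ℂ) ≠ 0 := by exact_mod_cast hd.ne'
  obtain ⟨b, c, s⟩ := x
  simp_rw [integral_list_prod_varVal hd, ← Fintype.prod_prod_type']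
  rw [← Finset.mul_prod_erase _ _ (Finset.mem_univ (s, c)),
    ← Finset.mul_prod_erase _ _ (Finset.mem_univ (s, c)), ← mul_assoc]
  congr 1
  · cases b
    · simp only [Bool.not_false, List.count_cons_self, List.count_erase_self]
      rw [List.count_cons_of_ne (by simp), List.count_erase_of_ne (by simp)]
      generalize l.count (false, (c, s)) = a
      generalize l.count (true, (c, s)) = b
      cases b with
      | zero => simp
      | succ b =>
        rw [Nat.add_sub_cancel]
        by_cases h : a = b
        · subst h
          rw [if_pos rfl, if_pos rfl, Nat.factorial_succ]
          push_cast
          field_simp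
          ring
        · rw [if_neg (by omega), if_neg h, mul_zero]
    · simp only [Bool.not_true, List.count_cons_self, List.count_erase_self]
      rw [List.count_cons_of_ne (by simp), List.count_erase_of_ne (by simp)]
      generalize l.count (false, (c, s)) = a
      generalize l.count (true, (c, s)) = b
      cases a with
      | zero => simp
      | succ a =>
        rw [Nat.add_sub_cancel]
        by_cases h : a = b
        · subst h
          rw [if_pos rfl, if_pos rfl, Nat.factorial_succ]
          push_cast
          field_simp
          ring
        · rw [if_neg (by omega), if_neg h, mul_zero]
  · refine Finset.prod_congr rfl fun y hy => ?_
    have hne : ∀ f g, ((f, (c, s)) : Bool × (Fin d × Fin p)) ≠ (g, (y.2, y.1)) := by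
      intro f g h
      refine Finset.ne_of_mem_erase hy ?_
      simp only [Prod.mk.injEq] at h
      exact Prod.ext h.2.2.symm h.2.1.symm
    rw [List.count_cons_of_ne (hne _ _), List.count_cons_of_ne (hne _ _),
      List.count_erase_of_ne (hne _ _).symm, List.count_erase_of_ne (hne _ _).symm]

/-- Both sides obey the same recursion; a factor `√d` per variable compensates the covariance `1 /
d` per pair. -/
lemma integral_list_prod_varVal_eq (hd : 0 < d) (l : List (Bool × (Fin d × Fin p))) :
    ((√d ^ l.length : ℝ) : ℂ) * ∫ φ : Fin p → LocalSpace d, (l.map (varVal φ)).prod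
        ∂(Measure.pi fun _ => gaussianVector d) = vacuumMoment l := by
  have hd' : (d : ℂ) ≠ 0 := by exact_mod_cast hd.ne'
  induction h : l.length using Nat.strong_induction_on generalizing l with
  | _ n ih =>
    cases l with
    | nil =>
      subst h
      simp [vacuumMoment_nil]
    | cons x l =>
      have hv : vacuumMoment (x :: l) =
          l.count (!x.1, x.2) * vacuumMoment (l.erase (!x.1, x.2)) := by
        convert vacuumMoment_cons x l using 2 <;> congr 3 <;> exact lawful_beq_subsingleton _ _
      rw [integral_list_prod_varVal_cons hd, hv]
      by_cases hm : (!x.1, x.2) ∈ l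
      · have hlen := List.length_erase_add_one hm
        rw [List.length_cons] at h
        have := ih _ (by omega) (l.erase (!x.1, x.2)) rfl
        rw [Complex.ofReal_mul, ← this, ← h, ← hlen, pow_succ, pow_succ]
        have hsq : (((√d : ℝ) : ℂ)) * ((√d : ℝ) : ℂ) = d := by
          rw [← Complex.ofReal_mul, Real.mul_self_sqrt (Nat.cast_nonneg d)]
          simp
        push_cast
        field_simp
        linear_combination ((√d : ℝ) : ℂ) ^ (l.erase (!x.1, x.2)).length *
          (l.count (!x.1, x.2) : ℂ) * (∫ φ : Fin p → LocalSpace d,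
          ((l.erase (!x.1, x.2)).map (varVal φ)).prod ∂(Measure.pi fun _ => gaussianVector d)) * hsq
      · simp [List.count_eq_zero_of_not_mem hm]

/-- The rank one matrix of a vector. -/
noncomputable def rankOneMat (v : LocalSpace d) : Matrix (Fin d) (Fin d) ℂ :=
  Matrix.of fun i j => v i * starRingEnd ℂ (v j)

/-- The product of the rank one matrices of the letters of a word. -/
noncomputable def wordMat (φ : Fin p → LocalSpace d) (w : List (Fin p)) :
    Matrix (Fin d) (Fin d) ℂ :=
  (w.map fun s => rankOneMat (φ s)).prod

lemma wordMat_cons_apply (φ : Fin p → LocalSpace d) (s : Fin p) (w : List (Fin p)) (a b : Fin d) :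
    wordMat φ (s :: w) a b = ∑ c, varVal φ (false, (a, s)) *
      (varVal φ (true, (c, s)) * wordMat φ w c b) := by
  rw [wordMat, List.map_cons, List.prod_cons, Matrix.mul_apply]
  exact Finset.sum_congr rfl fun c _ => by simp [rankOneMat, varVal, wordMat, mul_assoc]

lemma commute_varOp_list_prod (x : Bool × (Fin d × Fin p)) (l : List (Bool × (Fin d × Fin p))) :
    Commute (l.map varOp).prod (varOp x) :=
  Commute.list_prod_left _ _ fun y hy => by
    obtain ⟨z, _, rfl⟩ := List.mem_map.1 hy
    exact commute_varOp z x

/-- The prefix `l` makes the induction possible: peeling off a letter moves its two coordinates into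
`l`, on the operator side by commutativity of the `varOp`. -/
lemma gaussian_wordMat_aux (hd : 0 < d) (w : List (Fin p)) (l : List (Bool × (Fin d × Fin p)))
    (a b : Fin d) :
    Integrable (fun φ : Fin p → LocalSpace d => (l.map (varVal φ)).prod * wordMat φ w a b)
      (Measure.pi fun _ => gaussianVector d) ∧
    ((√d ^ (l.length + 2 * w.length) : ℝ) : ℂ) *
      ∫ φ : Fin p → LocalSpace d, (l.map (varVal φ)).prod * wordMat φ w a b
        ∂(Measure.pi fun _ => gaussianVector d) =
      (MvPolynomial.coeff 0 ((l.map varOp).prod ((w.map stepOp).prod (Pi.single b 1) a)) : ℝ) := by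
  induction w generalizing l a with
  | nil =>
    simp only [wordMat, List.map_nil, List.prod_nil, Matrix.one_apply, Module.End.one_apply,
      Pi.single_apply, List.length_nil, mul_zero, add_zero]
    split_ifs
    · simp only [mul_one]
      exact ⟨integrable_list_prod_varVal l, integral_list_prod_varVal_eq hd l⟩
    · simp
  | cons s w ih =>
    have h1 : ∀ φ : Fin p → LocalSpace d, (l.map (varVal φ)).prod * wordMat φ (s :: w) a b =
        ∑ c, (((false, (a, s)) :: (true, (c, s)) :: l).map (varVal φ)).prod * wordMat φ w c b := by
      intro φ
      rw [wordMat_cons_apply, Finset.mul_sum]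
      refine Finset.sum_congr rfl fun c _ => ?_
      simp only [List.map_cons, List.prod_cons]
      ring
    simp_rw [h1]
    refine ⟨integrable_finsetSum _ fun c _ => (ih _ c).1, ?_⟩
    rw [integral_finsetSum _ fun c _ => (ih _ c).1, Finset.mul_sum, List.map_cons, List.prod_cons,
      Module.End.mul_apply, stepOp_apply, map_sum, map_sum, MvPolynomial.coeff_sum]
    push_cast
    refine Finset.sum_congr rfl fun c _ => ?_
    have h2 := (ih ((false, (a, s)) :: (true, (c, s)) :: l) c).2
    simp only [List.map_cons, List.prod_cons, List.length_cons, Module.End.mul_apply] at h2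
    have h3 : ∀ f, (l.map varOp).prod (varOp (false, (a, s)) (varOp (true, (c, s)) f)) =
        varOp (false, (a, s)) (varOp (true, (c, s)) ((l.map varOp).prod f)) := by
      intro f
      rw [← Module.End.mul_apply, commute_varOp_list_prod, Module.End.mul_apply,
        ← Module.End.mul_apply (List.map varOp l).prod, commute_varOp_list_prod,
        Module.End.mul_apply]
    rw [h3, ← h2]
    simp only [List.map_cons, List.prod_cons, List.length_cons]
    push_cast
    ring_nf

lemma integrable_wordMat (hd : 0 < d) (w : List (Fin p)) (a b : Fin d) :
    Integrable (fun φ : Fin p → LocalSpace d => wordMat φ w a b)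
      (Measure.pi fun _ => gaussianVector d) := by
  simpa using (gaussian_wordMat_aux hd w [] a b).1

lemma integral_wordMat (hd : 0 < d) (w : List (Fin p)) (a b : Fin d) :
    (d ^ w.length : ℂ) * ∫ φ : Fin p → LocalSpace d, wordMat φ w a b
        ∂(Measure.pi fun _ => gaussianVector d) =
      (MvPolynomial.coeff 0 ((w.map stepOp).prod (Pi.single b 1) a) : ℝ) := by
  have h := (gaussian_wordMat_aux hd w [] a b).2
  simp only [List.length_nil, zero_add, List.map_nil, List.prod_nil, one_mul,
    Module.End.one_apply] at h
  rw [← h, pow_mul, Real.sq_sqrt (Nat.cast_nonneg d)]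
  push_cast
  rfl

/-- The Gaussian expectation of the trace of a word. -/
noncomputable def gaussianWord (d : ℕ) (w : List (Fin p)) : ℝ :=
  ∑ a : Fin d, MvPolynomial.coeff 0 ((w.map stepOp).prod (Pi.single a 1) a) / d ^ w.length

lemma integral_trace_wordMat (hd : 0 < d) (w : List (Fin p)) :
    ∫ φ : Fin p → LocalSpace d, (wordMat φ w).trace ∂(Measure.pi fun _ => gaussianVector d) =
      gaussianWord d w := by
  have hd' : (d : ℂ) ≠ 0 := by exact_mod_cast hd.ne'
  simp_rw [Matrix.trace, Matrix.diag]
  rw [integral_finsetSum _ fun c _ => integrable_wordMat hd w c c, gaussianWord]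
  push_cast
  refine Finset.sum_congr rfl fun a _ => ?_
  rw [← integral_wordMat hd]
  field_simp

/-- Expanding the word gives a sum of vacuum moments, each of which counts pairings. Positivity is
what later permits termwise comparison of words. -/
lemma coeff_stepOp_nonneg (w : List (Fin p)) (l : List (Bool × (Fin d × Fin p))) (a b : Fin d) :
    0 ≤ MvPolynomial.coeff 0 ((l.map varOp).prod ((w.map stepOp).prod (Pi.single b 1) a)) := by
  induction w generalizing l a with
  | nil =>
    simp only [List.map_nil, List.prod_nil, Module.End.one_apply, Pi.single_apply]
    split_ifs
    · exact vacuumMoment_nonneg l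
    · simp
  | cons s w ih =>
    rw [List.map_cons, List.prod_cons, Module.End.mul_apply, stepOp_apply, map_sum, map_sum,
      MvPolynomial.coeff_sum]
    refine Finset.sum_nonneg fun c _ => ?_
    have h := ih (l ++ [(false, (a, s)), (true, (c, s))]) c
    simpa using h

lemma gaussianWord_nonneg (w : List (Fin p)) : 0 ≤ gaussianWord d w :=
  Finset.sum_nonneg fun a _ => div_nonneg (by simpa using coeff_stepOp_nonneg w [] a a)
    (by positivity)

/-- The sum over words reassembles the power of `∑ s, stepOp s`, so this is the moment bound for a
single tensor factor. -/
lemma sum_gaussianWord_le (hd : 0 < d) (hp : 0 < p) (n : ℕ) :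
    ∑ w : Fin (2 * n) → Fin p, gaussianWord d (List.ofFn w) ≤
      d * ((√(p + (2 * n : ℕ)) + √(d + (2 * n : ℕ))) ^ 2 / d) ^ (2 * n) := by
  have : Nonempty (Fin d) := ⟨⟨0, hd⟩⟩
  have : Nonempty (Fin p) := ⟨⟨0, hp⟩⟩
  have hd' : (0 : ℝ) < d := by exact_mod_cast hd
  simp_rw [gaussianWord, List.length_ofFn]
  rw [Finset.sum_comm]
  calc _ ≤ ∑ a : Fin d, (√(p + (2 * n : ℕ)) + √(d + (2 * n : ℕ))) ^ (4 * n) / d ^ (2 * n) := by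
        refine Finset.sum_le_sum fun a _ => ?_
        rw [← Finset.sum_div]
        gcongr
        refine le_trans (le_of_eq ?_) (coeff_sum_stepOp_pow_le n a)
        rw [sum_pow_eq_sum_list_prod, LinearMap.sum_apply, Finset.sum_apply,
          MvPolynomial.coeff_sum]
    _ = _ := by
        rw [Finset.sum_const, Finset.card_univ, Fintype.card_fin, nsmul_eq_mul, div_pow, ← pow_mul]
        ring_nf

end Words

/-! ### Tensor products: expansion into words, and sphere words versus Gaussian words. -/

/-- Regroups the independent vectors by tensor factor instead of by letter, so that expectations of
products over the factors split. -/
lemma measurePreserving_flip {E : Type*} [MeasurableSpace E] (ι κ : Type*) [Fintype ι] [Fintype κ]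
    (ν : Measure E) [IsProbabilityMeasure ν] :
    MeasurePreserving (fun (φ : ι → κ → E) i s => φ s i)
      (Measure.pi fun _ : ι => Measure.pi fun _ : κ => ν)
      (Measure.pi fun _ : κ => Measure.pi fun _ : ι => ν) := by
  refine ⟨by fun_prop, ?_⟩
  have h1 := Measure.infinitePi_map_curry_symm (fun (_ : ι) (_ : κ) => ν)
  have h2 := Measure.infinitePi_map_piCongrLeft (fun _ : κ × ι => ν) (Equiv.prodComm ι κ)
  have h3 := Measure.infinitePi_map_curry (fun (_ : κ) (_ : ι) => ν)
  simp only [Measure.infinitePi_eq_pi] at h1 h2 h3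
  rw [← h3, ← h2, ← h1, Measure.map_map (by fun_prop) (by fun_prop),
    Measure.map_map (by fun_prop) (by fun_prop)]
  congr 1

lemma measurePreserving_comp_injective {E : Type*} [MeasurableSpace E] {ι κ : Type*} [Fintype ι]
    [Fintype κ] {σ : ι → κ} (hσ : σ.Injective) (ν : Measure E) [IsProbabilityMeasure ν] :
    MeasurePreserving (fun (φ : κ → E) i => φ (σ i)) (Measure.pi fun _ : κ => ν)
      (Measure.pi fun _ : ι => ν) := by
  refine ⟨by fun_prop, ?_⟩
  have h := (iIndepFun_pi (μ := fun _ : κ => ν) (X := fun _ => id)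
    fun _ => aemeasurable_id).precomp hσ
  have h2 := (iIndepFun_iff_map_fun_eq_pi_map fun i =>
    (measurable_pi_apply (σ i)).aemeasurable).1 h
  refine h2.trans ?_
  congr 1
  ext1 i
  exact (measurePreserving_eval (fun _ : κ => ν) (σ i)).map_eq

variable {d p k : ℕ}

lemma list_prod_vecMulVec_apply (φ : Fin p → Fin k → LocalSpace d) (w : List (Fin p))
    (i j : Fin k → Fin d) :
    (w.map fun s => Matrix.vecMulVec (productVector (φ s)) (star (productVector (φ s)))).prod i j =
      ∏ κ, wordMat (fun s => φ s κ) w (i κ) (j κ) := by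
  induction w generalizing i with
  | nil =>
    simp only [wordMat, List.map_nil, List.prod_nil, Matrix.one_apply]
    split_ifs with h
    · subst h; simp
    · obtain ⟨κ, hκ⟩ := Function.ne_iff.1 h
      exact (Finset.prod_eq_zero (Finset.mem_univ κ) (if_neg hκ)).symm
  | cons s w ih =>
    have h : ∀ κ, wordMat (fun s => φ s κ) (s :: w) (i κ) (j κ) =
        ∑ c, φ s κ (i κ) * starRingEnd ℂ (φ s κ c) * wordMat (fun s => φ s κ) w c (j κ) := by
      intro κ
      rw [wordMat_cons_apply]
      simp [varVal, mul_assoc]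
    simp_rw [h]
    rw [Finset.prod_univ_sum, Fintype.piFinset_univ, List.map_cons, List.prod_cons,
      Matrix.mul_apply]
    refine Finset.sum_congr rfl fun c _ => ?_
    rw [ih, Matrix.vecMulVec_apply, Finset.prod_mul_distrib, Finset.prod_mul_distrib]
    simp [productVector]

lemma trace_tensorSum_pow (φ : Fin p → Fin k → LocalSpace d) (m : ℕ) :
    (tensorSum φ ^ m).trace =
      ∑ w : Fin m → Fin p, ∏ κ, (wordMat (fun s => φ s κ) (List.ofFn w)).trace := by
  rw [tensorSum, sum_pow_eq_sum_list_prod, Matrix.trace_sum]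
  refine Finset.sum_congr rfl fun w _ => ?_
  simp_rw [Matrix.trace, Matrix.diag, list_prod_vecMulVec_apply]
  rw [Finset.prod_univ_sum, Fintype.piFinset_univ]

/-- For a fixed word the `k` tensor factors are independent copies of one another, whence the `k`-th
power of a single expectation. -/
lemma integral_trace_tensorSum_pow {ν : Measure (LocalSpace d)} [IsProbabilityMeasure ν]
    (hν : ∀ (w : List (Fin p)) (a b : Fin d),
      Integrable (fun φ : Fin p → LocalSpace d => wordMat φ w a b) (Measure.pi fun _ => ν)) (m : ℕ) :
    Integrable (fun φ => (tensorSum φ ^ m).trace) (iidFamily p d k ν) ∧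
    ∫ φ, (tensorSum φ ^ m).trace ∂iidFamily p d k ν =
      ∑ w : Fin m → Fin p,
        (∫ φ, (wordMat φ (List.ofFn w)).trace ∂Measure.pi fun _ : Fin p => ν) ^ k := by
  have htr : ∀ w : List (Fin p), Integrable (fun φ : Fin p → LocalSpace d => (wordMat φ w).trace)
      (Measure.pi fun _ => ν) := fun w => by
    simp_rw [Matrix.trace, Matrix.diag]
    exact integrable_finsetSum _ fun a _ => hν w a a
  have hflip := measurePreserving_flip (Fin p) (Fin k) ν
  have hint : ∀ w : List (Fin p), Integrable (fun φ : Fin p → Fin k → LocalSpace d =>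
      ∏ κ, (wordMat (fun s => φ s κ) w).trace) (iidFamily p d k ν) := fun w =>
    hflip.integrable_comp_of_integrable (Integrable.fintype_prod
      (f := fun (_ : Fin k) (ψ : Fin p → LocalSpace d) => (wordMat ψ w).trace) fun κ => htr w)
  simp_rw [trace_tensorSum_pow]
  refine ⟨integrable_finsetSum _ fun w _ => hint _, ?_⟩
  rw [integral_finsetSum _ fun w _ => hint _]
  refine Finset.sum_congr rfl fun w _ => ?_
  have h := integral_map (μ := iidFamily p d k ν) hflip.measurable.aemeasurable
    (f := fun ψ : Fin k → Fin p → LocalSpace d => ∏ κ, (wordMat (ψ κ) (List.ofFn w)).trace)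
    (by
      rw [iidFamily, hflip.map_eq]
      exact (Integrable.fintype_prod (f := fun (_ : Fin k) (ψ : Fin p → LocalSpace d) =>
        (wordMat ψ (List.ofFn w)).trace) fun κ => htr _).aestronglyMeasurable)
  rw [← h, iidFamily, hflip.map_eq, integral_fintype_prod_eq_prod
    (f := fun (_ : Fin k) (ψ : Fin p → LocalSpace d) => (wordMat ψ (List.ofFn w)).trace)]
  simp

lemma wordMat_map {P : ℕ} (σ : Fin p → Fin P) (φ : Fin P → LocalSpace d) (w : List (Fin p)) :
    wordMat φ (w.map σ) = wordMat (fun s => φ (σ s)) w := by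
  rw [wordMat, wordMat, List.map_map]
  rfl

/-- The letters are exchangeable: only the pattern of coincidences in a word matters. -/
lemma gaussianWord_map {P : ℕ} (hd : 0 < d) {σ : Fin p → Fin P} (hσ : σ.Injective)
    (w : List (Fin p)) : gaussianWord d (w.map σ) = gaussianWord d w := by
  have h := measurePreserving_comp_injective hσ (gaussianVector d)
  have hint : AEStronglyMeasurable (fun φ : Fin p → LocalSpace d => (wordMat φ w).trace)
      (Measure.pi fun _ => gaussianVector d) := by
    simp_rw [Matrix.trace, Matrix.diag]
    exact (integrable_finsetSum _ fun a _ => integrable_wordMat hd w a a).aestronglyMeasurable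
  have h2 := integral_trace_wordMat hd w
  rw [← h.map_eq, integral_map h.measurable.aemeasurable (by rwa [h.map_eq])] at h2
  simp_rw [← wordMat_map] at h2
  rw [integral_trace_wordMat hd] at h2
  exact_mod_cast h2

/-- The expectation of the trace of a word in the rank one projections on independent uniform unit
vectors. -/
noncomputable def sphereWord (d : ℕ) (w : List (Fin p)) : ℝ :=
  gaussianWord d w / ∏ s, ∫ r, r ^ (2 * w.count s) ∂radialLaw d

lemma one_le_prod_radial (hd : 0 < d) (w : List (Fin p)) :
    1 ≤ ∏ s, ∫ r, r ^ (2 * w.count s) ∂radialLaw d :=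
  Finset.prod_induction _ (1 ≤ ·) (fun _ _ => one_le_mul_of_one_le_of_one_le) le_rfl
    fun _ _ => one_le_integral_pow_radialLaw hd _

lemma sphereWord_nonneg (hd : 0 < d) (w : List (Fin p)) : 0 ≤ sphereWord d w :=
  div_nonneg (gaussianWord_nonneg w) (by linarith [one_le_prod_radial hd w])

lemma sphereWord_le_gaussianWord (hd : 0 < d) (w : List (Fin p)) :
    sphereWord d w ≤ gaussianWord d w :=
  div_le_self (gaussianWord_nonneg w) (one_le_prod_radial hd w)

/-- The radial moment of a letter occurring `n` times is at most `exp (n ^ 2 / (2 * d))`, and the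
squares of the multiplicities add up to at most the squared length. -/
lemma gaussianWord_le (hd : 0 < d) (w : List (Fin p)) :
    gaussianWord d w ≤ Real.exp (w.length ^ 2 / (2 * d)) * sphereWord d w := by
  have h1 := one_le_prod_radial hd w
  have hd' : (0 : ℝ) < d := by exact_mod_cast hd
  have hsum : ∑ s, w.count s = w.length := by
    rw [← List.sum_toFinset_count_eq_length]
    exact (Finset.sum_subset (Finset.subset_univ _) fun s _ hs =>
      List.count_eq_zero_of_not_mem (by simpa using hs)).symm
  rw [sphereWord, mul_div_assoc', le_div_iff₀ (by linarith), mul_comm]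
  refine mul_le_mul_of_nonneg_right ?_ (gaussianWord_nonneg w)
  calc ∏ s, ∫ r, r ^ (2 * w.count s) ∂radialLaw d
      ≤ ∏ s, Real.exp ((w.count s : ℝ) ^ 2 / (2 * d)) :=
        Finset.prod_le_prod
          (fun s _ => zero_le_one.trans (one_le_integral_pow_radialLaw hd _))
          fun s _ => integral_pow_radialLaw_le hd _
    _ = Real.exp (∑ s, (w.count s : ℝ) ^ 2 / (2 * d)) := (Real.exp_sum _ _).symm
    _ ≤ _ := by
        rw [← Finset.sum_div]
        gcongr
        rw [← hsum, Nat.cast_sum]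
        exact Finset.sum_sq_le_sq_sum_of_nonneg fun _ _ => Nat.cast_nonneg _

lemma sphereWord_map {P : ℕ} (hd : 0 < d) {σ : Fin p → Fin P} (hσ : σ.Injective)
    (w : List (Fin p)) : sphereWord d (w.map σ) = sphereWord d w := by
  rw [sphereWord, sphereWord, gaussianWord_map hd hσ]
  congr 1
  symm
  refine Fintype.prod_of_injective σ hσ _ _ (fun s hs => ?_) fun s => ?_
  · rw [List.count_eq_zero_of_not_mem]
    · simp
    · rintro h
      obtain ⟨t, -, rfl⟩ := List.mem_map.1 h
      exact hs ⟨t, rfl⟩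
  · rw [List.count_map_of_injective _ _ hσ]

lemma wordMat_smul (r : Fin p → ℝ) (u : Fin p → LocalSpace d) (w : List (Fin p)) :
    wordMat (fun s => r s • u s) w = ((∏ s, r s ^ (2 * w.count s) : ℝ) : ℂ) • wordMat u w := by
  induction w with
  | nil => simp [wordMat]
  | cons t w ih =>
    have h1 : rankOneMat (r t • u t) = ((r t ^ 2 : ℝ) : ℂ) • rankOneMat (u t) := by
      ext a b
      simp [rankOneMat]
      ring
    have h2 : ∏ s, r s ^ (2 * (t :: w).count s) = r t ^ 2 * ∏ s, r s ^ (2 * w.count s) := by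
      have : ∀ s, r s ^ (2 * (t :: w).count s) =
          (if s = t then r t ^ 2 else 1) * r s ^ (2 * w.count s) := by
        intro s
        rw [List.count_cons]
        by_cases h : s = t
        · subst h
          simp
          ring
        · simp [h, Ne.symm h]
      simp_rw [this]
      rw [Finset.prod_mul_distrib]
      simp
    have h3 : ∀ φ : Fin p → LocalSpace d, wordMat φ (t :: w) = rankOneMat (φ t) * wordMat φ w :=
      fun φ => by simp [wordMat]
    rw [h3, h3, ih, h1, h2]
    simp [smul_smul, mul_comm]


instance (d : ℕ) : SigmaFinite (uniformUnitVector d) := by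
  unfold uniformUnitVector
  infer_instance

lemma ae_norm_pi_uniformUnitVector (d : ℕ) {ι : Type*} [Fintype ι] :
    ∀ᵐ φ ∂Measure.pi fun _ : ι => uniformUnitVector d, ∀ s, ‖φ s‖ = 1 :=
  Filter.eventually_all.2 fun s =>
    (Measure.quasiMeasurePreserving_eval (fun _ => uniformUnitVector d) s).ae
      (ae_norm_uniformUnitVector d)

lemma measurePreserving_smul_pi (hd : 0 < d) (ι : Type*) [Fintype ι] :
    MeasurePreserving (fun (q : (ι → LocalSpace d) × (ι → ℝ)) s => q.2 s • q.1 s)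
      ((Measure.pi fun _ : ι => uniformUnitVector d).prod (Measure.pi fun _ : ι => radialLaw d))
      (Measure.pi fun _ : ι => gaussianVector d) := by
  have := isProbabilityMeasure_uniformUnitVector hd
  refine ⟨by fun_prop, ?_⟩
  rw [← (measurePreserving_arrowProdEquivProdArrow _ _ ι (fun _ => uniformUnitVector d)
    fun _ => radialLaw d).map_eq, Measure.map_map (by fun_prop) (by fun_prop)]
  have h := Measure.pi_map_pi (μ := fun _ : ι => (uniformUnitVector d).prod (radialLaw d))
    (f := fun _ q => q.2 • q.1) (hμ := fun _ => by
      rw [← gaussianVector_eq_map_smul hd]; infer_instance) fun _ => by fun_prop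
  rw [gaussianVector_eq_map_smul hd, ← h]
  rfl

lemma norm_wordMat_apply_le (φ : Fin p → LocalSpace d) (hφ : ∀ s, ‖φ s‖ = 1) (w : List (Fin p))
    (a b : Fin d) : ‖wordMat φ w a b‖ ≤ d ^ w.length := by
  induction w generalizing a with
  | nil =>
    simp only [wordMat, List.map_nil, List.prod_nil, Matrix.one_apply]
    split_ifs <;> simp
  | cons s w ih =>
    have h : ∀ c, ‖φ s c‖ ≤ 1 := fun c => (hφ s) ▸ PiLp.norm_apply_le (φ s) c
    rw [wordMat_cons_apply]
    refine (norm_sum_le _ _).trans ?_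
    calc _ ≤ ∑ c : Fin d, (d : ℝ) ^ w.length := by
          refine Finset.sum_le_sum fun c _ => ?_
          simp only [varVal, norm_mul, Bool.false_eq_true, if_true, if_false, RCLike.norm_conj]
          calc _ ≤ 1 * (1 * (d : ℝ) ^ w.length) := by
                gcongr
                · exact h a
                · exact h c
                · exact ih c
            _ = _ := by ring
      _ = _ := by simp [pow_succ, mul_comm]

lemma continuous_wordMat_apply (w : List (Fin p)) (a b : Fin d) :
    Continuous fun φ : Fin p → LocalSpace d => wordMat φ w a b := by
  induction w generalizing a with
  | nil => exact continuous_const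
  | cons s w ih =>
    simp_rw [wordMat_cons_apply, varVal]
    simp only [Bool.false_eq_true, if_true, if_false]
    fun_prop

lemma integrable_wordMat_uniform (hd : 0 < d) (w : List (Fin p)) (a b : Fin d) :
    Integrable (fun φ : Fin p → LocalSpace d => wordMat φ w a b)
      (Measure.pi fun _ => uniformUnitVector d) := by
  have := isProbabilityMeasure_uniformUnitVector hd
  refine Integrable.of_bound (continuous_wordMat_apply w a b).aestronglyMeasurable
    ((d : ℝ) ^ w.length) ?_
  filter_upwards [ae_norm_pi_uniformUnitVector d] with φ hφ
  exact norm_wordMat_apply_le φ hφ w a b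

/-- In polar coordinates a word is homogeneous of degree twice the multiplicity in each radius, and
the radii are independent of the directions. -/
lemma integral_wordMat_gaussian_eq (hd : 0 < d) (w : List (Fin p)) (a b : Fin d) :
    ∫ φ : Fin p → LocalSpace d, wordMat φ w a b ∂(Measure.pi fun _ => gaussianVector d) =
      ((∏ s, ∫ r, r ^ (2 * w.count s) ∂radialLaw d : ℝ) : ℂ) *
      ∫ φ : Fin p → LocalSpace d, wordMat φ w a b ∂(Measure.pi fun _ => uniformUnitVector d) := by
  have := isProbabilityMeasure_uniformUnitVector hd
  have h := measurePreserving_smul_pi hd (Fin p)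
  rw [← h.map_eq, integral_map h.measurable.aemeasurable
    (continuous_wordMat_apply w a b).aestronglyMeasurable]
  simp_rw [wordMat_smul, Matrix.smul_apply, smul_eq_mul]
  have h2 := integral_prod_mul (μ := Measure.pi fun _ : Fin p => uniformUnitVector d)
    (ν := Measure.pi fun _ : Fin p => radialLaw d) (fun φ => wordMat φ w a b)
    (fun r => ((∏ s, r s ^ (2 * w.count s) : ℝ) : ℂ))
  simp_rw [mul_comm (wordMat _ w a b)] at h2
  rw [h2, mul_comm, integral_complex_ofReal,
    integral_fintype_prod_eq_prod (f := fun s (r : ℝ) => r ^ (2 * w.count s))]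

lemma integral_trace_wordMat_uniform (hd : 0 < d) (w : List (Fin p)) :
    ∫ φ : Fin p → LocalSpace d, (wordMat φ w).trace ∂(Measure.pi fun _ => uniformUnitVector d) =
      sphereWord d w := by
  have h0 : ((∏ s, ∫ r, r ^ (2 * w.count s) ∂radialLaw d : ℝ) : ℂ) ≠ 0 := by
    exact_mod_cast (zero_lt_one.trans_le (one_le_prod_radial hd w)).ne'
  have h := integral_trace_wordMat hd w
  simp_rw [Matrix.trace, Matrix.diag] at h ⊢
  rw [integral_finsetSum _ fun a _ => integrable_wordMat hd w a a] at h
  rw [integral_finsetSum _ fun a _ => integrable_wordMat_uniform hd w a a, sphereWord,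
    Complex.ofReal_div, ← h, eq_div_iff h0, mul_comm, Finset.mul_sum]
  exact Finset.sum_congr rfl fun a _ => (integral_wordMat_gaussian_eq hd w a a).symm

lemma integral_trace_normalizedEnsemble (hd : 0 < d) (m : ℕ) :
    Integrable (fun φ => (tensorSum φ ^ m).trace) (normalizedEnsemble p d k) ∧
    ∫ φ, (tensorSum φ ^ m).trace ∂normalizedEnsemble p d k =
      ((∑ w : Fin m → Fin p, sphereWord d (List.ofFn w) ^ k : ℝ) : ℂ) := by
  have := isProbabilityMeasure_uniformUnitVector hd
  have h := integral_trace_tensorSum_pow (k := k) (fun w : List (Fin p) =>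
    integrable_wordMat_uniform hd w) m
  simp_rw [integral_trace_wordMat_uniform hd] at h
  exact ⟨h.1, h.2.trans (by push_cast; rfl)⟩

lemma integral_trace_gaussianEnsemble (hd : 0 < d) (m : ℕ) :
    Integrable (fun φ => (tensorSum φ ^ m).trace) (gaussianEnsemble p d k) ∧
    ∫ φ, (tensorSum φ ^ m).trace ∂gaussianEnsemble p d k =
      ((∑ w : Fin m → Fin p, gaussianWord d (List.ofFn w) ^ k : ℝ) : ℂ) := by
  have h := integral_trace_tensorSum_pow (k := k) (fun w : List (Fin p) =>
    integrable_wordMat hd w) m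
  simp_rw [integral_trace_wordMat hd] at h
  exact ⟨h.1, h.2.trans (by push_cast; rfl)⟩

/-! ### Averages over one random unit vector. -/

/-- The unit sphere of `ℂ^d`, as a type. -/
abbrev UnitVector (d : ℕ) : Type := Metric.sphere (0 : LocalSpace d) 1

/-- The uniform distribution on the unit sphere of `ℂ^d`. -/
noncomputable def sphereLaw (d : ℕ) : Measure (UnitVector d) :=
  ((volume : Measure (LocalSpace d)).toSphere Set.univ)⁻¹ •
    (volume : Measure (LocalSpace d)).toSphere

lemma map_coe_sphereLaw (d : ℕ) :
    (sphereLaw d).map Subtype.val = uniformUnitVector d := rfl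

lemma isProbabilityMeasure_sphereLaw {d : ℕ} (hd : 0 < d) :
    IsProbabilityMeasure (sphereLaw d) :=
  ⟨ENNReal.inv_mul_cancel (toSphere_univ_ne hd) (measure_ne_top _ _)⟩

lemma measurePreserving_coe_pi_sphereLaw {d : ℕ} (hd : 0 < d) (ι : Type*) [Fintype ι] :
    MeasurePreserving (fun (φ : ι → UnitVector d) s => (φ s : LocalSpace d))
      (Measure.pi fun _ => sphereLaw d) (Measure.pi fun _ => uniformUnitVector d) := by
  have := isProbabilityMeasure_sphereLaw hd
  refine ⟨by fun_prop, ?_⟩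
  exact Measure.pi_map_pi (μ := fun _ : ι => sphereLaw d) (f := fun _ u => (u : LocalSpace d))
    (hμ := fun _ => by rw [map_coe_sphereLaw]; infer_instance) fun _ => by fun_prop

/-- Resampling one coordinate keeps a product law; this serves to integrate out one letter at a
time. -/
lemma measurePreserving_update {E ι : Type*} [MeasurableSpace E] [Fintype ι] [DecidableEq ι]
    (μ : Measure E) [IsProbabilityMeasure μ] (s : ι) :
    MeasurePreserving (fun q : (ι → E) × E => Function.update q.1 s q.2)
      ((Measure.pi fun _ => μ).prod μ) (Measure.pi fun _ => μ) := by
  have hm : Measurable fun q : (ι → E) × E => Function.update q.1 s q.2 := by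
    rw [measurable_pi_iff]
    intro i
    by_cases h : i = s
    · subst h
      simpa using measurable_snd
    · simp only [Function.update_of_ne h]
      fun_prop
  refine ⟨hm, (Measure.pi_eq fun t ht => ?_).symm⟩
  rw [Measure.map_apply hm (MeasurableSet.univ_pi ht)]
  have : (fun q : (ι → E) × E => Function.update q.1 s q.2) ⁻¹' Set.univ.pi t =
      (Set.univ.pi (Function.update t s Set.univ)) ×ˢ t s := by
    ext q
    simp only [Set.mem_preimage, Set.mem_pi, Set.mem_univ, true_implies, Set.mem_prod]
    constructor
    · intro h
      refine ⟨fun i => ?_, by simpa using h s⟩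
      by_cases hi : i = s
      · subst hi; simp
      · simpa [Function.update_of_ne hi] using h i
    · rintro ⟨h1, h2⟩ i
      by_cases hi : i = s
      · subst hi; simpa using h2
      · simpa [Function.update_of_ne hi] using h1 i
  rw [this, Measure.prod_prod, Measure.pi_pi, ← Finset.prod_erase_mul _ _ (Finset.mem_univ s),
    ← Finset.prod_erase_mul _ (fun i => μ (t i)) (Finset.mem_univ s)]
  simp only [Function.update_self, measure_univ, mul_one]
  congr 1
  exact Finset.prod_congr rfl fun i hi => by rw [Function.update_of_ne (Finset.ne_of_mem_erase hi)]

section Moments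

variable {d : ℕ}

open scoped InnerProductSpace

lemma integrable_of_continuous {X E : Type*} [TopologicalSpace X] [CompactSpace X]
    [MeasurableSpace X] [OpensMeasurableSpace X] {μ : Measure X} [IsFiniteMeasure μ]
    [NormedAddCommGroup E] [SecondCountableTopologyEither X E] {f : X → E} (hf : Continuous f) :
    Integrable f μ := by
  obtain ⟨C, hC⟩ := (isCompact_range hf).isBounded.exists_norm_le
  exact Integrable.of_bound hf.aestronglyMeasurable C
    (Filter.Eventually.of_forall fun x => hC _ ⟨x, rfl⟩)

/-- The second moment of the radius is one, so the covariance on the sphere equals the Gaussian one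
and is read off from a word with a single letter. -/
lemma integral_coord_mul_conj (hd : 0 < d) (a b : Fin d) :
    ∫ u : UnitVector d, (u : LocalSpace d) a * starRingEnd ℂ ((u : LocalSpace d) b) ∂sphereLaw d =
      if a = b then (d : ℂ)⁻¹ else 0 := by
  have := isProbabilityMeasure_sphereLaw hd
  have hU := isProbabilityMeasure_uniformUnitVector hd
  have h := integral_wordMat_gaussian_eq (p := 1) hd [0] a b
  have hr : ∏ s : Fin 1, ∫ r, r ^ (2 * [(0 : Fin 1)].count s) ∂radialLaw d = 1 := by
    simpa using (integral_pow_radialLaw hd 1).2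
  rw [hr] at h
  have hw : ∀ φ : Fin 1 → LocalSpace d, wordMat φ [0] a b = φ 0 a * starRingEnd ℂ (φ 0 b) := by
    intro φ
    simp [wordMat, rankOneMat]
  have hw2 : ∀ φ : Fin 1 → LocalSpace d, wordMat φ [0] a b =
      ([(false, (a, 0)), (true, (b, 0))].map (varVal φ)).prod := by
    intro φ
    rw [hw]
    simp [varVal]
  have h2 : ∫ φ : Fin 1 → LocalSpace d, wordMat φ [0] a b ∂(Measure.pi fun _ => gaussianVector d) =
      if a = b then (d : ℂ)⁻¹ else 0 := by
    simp_rw [hw2]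
    rw [integral_list_prod_varVal_cons hd]
    by_cases hab : a = b
    · subst hab
      simp
    · have : (true, (b, (0 : Fin 1))) ≠ (true, (a, (0 : Fin 1))) := by simp [Ne.symm hab]
      simp [this, hab]
  rw [← h2, h]
  simp_rw [hw]
  have h3 := integral_fintype_prod_eq_prod (μ := fun _ : Fin 1 => uniformUnitVector d)
    (f := fun _ (v : LocalSpace d) => v a * starRingEnd ℂ (v b))
  simp only [Finset.univ_unique, Finset.prod_singleton, Fin.default_eq_zero] at h3
  rw [h3, ← map_coe_sphereLaw, integral_map (by fun_prop)
    (Continuous.aestronglyMeasurable (by fun_prop))]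
  simp

lemma integral_inner_smul (hd : 0 < d) (x : LocalSpace d) :
    ∫ u : UnitVector d, ⟪(u : LocalSpace d), x⟫_ℂ • (u : LocalSpace d) ∂sphereLaw d =
      (d : ℂ)⁻¹ • x := by
  have := isProbabilityMeasure_sphereLaw hd
  have hc : Continuous fun u : UnitVector d => ⟪(u : LocalSpace d), x⟫_ℂ • (u : LocalSpace d) := by
    fun_prop
  ext a
  have h : ∫ u : UnitVector d, (⟪(u : LocalSpace d), x⟫_ℂ • (u : LocalSpace d)) a ∂sphereLaw d =
      (∫ u : UnitVector d, ⟪(u : LocalSpace d), x⟫_ℂ • (u : LocalSpace d) ∂sphereLaw d) a :=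
    (EuclideanSpace.proj (𝕜 := ℂ) a).integral_comp_comm (integrable_of_continuous hc)
  rw [← h]
  simp only [PiLp.smul_apply, smul_eq_mul, PiLp.inner_apply, RCLike.inner_apply, Finset.sum_mul]
  rw [integral_finsetSum _ fun b _ => integrable_of_continuous (by fun_prop)]
  calc _ = ∑ b, x b * ∫ u : UnitVector d, (u : LocalSpace d) a *
        starRingEnd ℂ ((u : LocalSpace d) b) ∂sphereLaw d := by
        refine Finset.sum_congr rfl fun b _ => ?_
        rw [← integral_const_mul]
        congr 1
        ext u
        ring
    _ = _ := by
        simp_rw [integral_coord_mul_conj hd]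
        simp [mul_comm]

lemma integral_norm_inner_sq (hd : 0 < d) (x : LocalSpace d) :
    ∫ u : UnitVector d, ‖⟪(u : LocalSpace d), x⟫_ℂ‖ ^ 2 ∂sphereLaw d = ‖x‖ ^ 2 / d := by
  have := isProbabilityMeasure_sphereLaw hd
  have hc : Continuous fun u : UnitVector d => ⟪(u : LocalSpace d), x⟫_ℂ • (u : LocalSpace d) := by
    fun_prop
  have h := (innerSL ℂ x).integral_comp_comm (integrable_of_continuous hc (μ := sphereLaw d))
  rw [integral_inner_smul hd] at h
  simp only [innerSL_apply_apply, inner_smul_right, inner_self_eq_norm_sq_to_K] at h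
  have h2 : ∀ u : UnitVector d, ⟪(u : LocalSpace d), x⟫_ℂ * ⟪x, (u : LocalSpace d)⟫_ℂ =
      ((‖⟪(u : LocalSpace d), x⟫_ℂ‖ ^ 2 : ℝ) : ℂ) := by
    intro u
    rw [← inner_conj_symm x, Complex.mul_conj, Complex.normSq_eq_norm_sq]
  simp_rw [h2] at h
  rw [integral_complex_ofReal] at h
  apply_fun Complex.re at h
  rw [Complex.ofReal_re] at h
  rw [h, div_eq_inv_mul, ← Complex.ofReal_natCast, ← Complex.ofReal_inv, ← Complex.ofReal_re
    ((d : ℝ)⁻¹ * ‖x‖ ^ 2)]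
  push_cast
  rfl

lemma norm_integral_sq_le {X E : Type*} [MeasurableSpace X] {μ : Measure X} [IsProbabilityMeasure μ]
    [NormedAddCommGroup E] [NormedSpace ℝ E] {f : X → E}
    (hf : Integrable f μ) (hf2 : Integrable (fun x => ‖f x‖ ^ 2) μ) :
    ‖∫ x, f x ∂μ‖ ^ 2 ≤ ∫ x, ‖f x‖ ^ 2 ∂μ := by
  have h := norm_integral_le_integral_norm f (μ := μ)
  have h2 : 0 ≤ ∫ x, (‖f x‖ - ∫ y, ‖f y‖ ∂μ) ^ 2 ∂μ := integral_nonneg fun x => sq_nonneg _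
  set c := ∫ y, ‖f y‖ ∂μ with hc
  have h3 : ∫ x, (‖f x‖ - c) ^ 2 ∂μ = ∫ x, ‖f x‖ ^ 2 ∂μ - 2 * c * c + c ^ 2 := by
    have h4 : ∀ x, (‖f x‖ - c) ^ 2 = ‖f x‖ ^ 2 - 2 * c * ‖f x‖ + c ^ 2 := fun x => by ring
    simp_rw [h4]
    rw [integral_add (f := fun x => ‖f x‖ ^ 2 - 2 * c * ‖f x‖) (hf2.sub (hf.norm.const_mul _))
      (integrable_const _), integral_sub hf2 (hf.norm.const_mul _), integral_const_mul,
      integral_const, ← hc]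
    simp
  nlinarith [norm_nonneg (∫ x, f x ∂μ)]

/-- The map `Ψ ↦ 𝔼 ⟨u, Ψ u⟩ u` is adjoint to `x ↦ ⟨u, x⟩ u`, whose squared norm as a map into `L²`
is `1 / d` by `integral_norm_inner_sq`. -/
lemma norm_integral_inner_smul_sq_le (hd : 0 < d) {Ψ : UnitVector d → LocalSpace d}
    (hΨ : Continuous Ψ) :
    d * ‖∫ u, ⟪(u : LocalSpace d), Ψ u⟫_ℂ • (u : LocalSpace d) ∂sphereLaw d‖ ^ 2 ≤
      ∫ u, ‖Ψ u‖ ^ 2 ∂sphereLaw d := by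
  have := isProbabilityMeasure_sphereLaw hd
  have hd' : (0 : ℝ) < d := by exact_mod_cast hd
  have hc : Continuous fun u : UnitVector d => ⟪(u : LocalSpace d), Ψ u⟫_ℂ • (u : LocalSpace d) := by
    fun_prop
  set x := ∫ u, ⟪(u : LocalSpace d), Ψ u⟫_ℂ • (u : LocalSpace d) ∂sphereLaw d with hx
  have h := (innerSL ℂ x).integral_comp_comm (integrable_of_continuous hc (μ := sphereLaw d))
  rw [← hx] at h
  simp only [innerSL_apply_apply, inner_smul_right, inner_self_eq_norm_sq_to_K] at h
  have h1 : ‖x‖ ^ 2 = ‖∫ u : UnitVector d, ⟪(u : LocalSpace d), Ψ u⟫_ℂ *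
      ⟪x, (u : LocalSpace d)⟫_ℂ ∂sphereLaw d‖ := by
    rw [h]
    simp
  -- The arithmetic-geometric inequality is weighted by `d` so that the second term integrates to
  -- half of `‖x‖ ^ 2` and can be absorbed.
  have h2 : ‖x‖ ^ 2 ≤ ∫ u : UnitVector d, (‖Ψ u‖ ^ 2 / (2 * d) +
      d / 2 * ‖⟪(u : LocalSpace d), x⟫_ℂ‖ ^ 2) ∂sphereLaw d := by
    rw [h1]
    refine norm_integral_le_of_norm_le (integrable_of_continuous (by fun_prop))
      (Filter.Eventually.of_forall fun u => ?_)
    rw [norm_mul, norm_inner_symm x]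
    have h3 : ‖⟪(u : LocalSpace d), Ψ u⟫_ℂ‖ ≤ ‖Ψ u‖ := by
      simpa [norm_eq_of_mem_sphere u] using norm_inner_le_norm (𝕜 := ℂ) (u : LocalSpace d) (Ψ u)
    have h4 : ‖Ψ u‖ ^ 2 / (2 * d) + d / 2 * ‖⟪(u : LocalSpace d), x⟫_ℂ‖ ^ 2 -
        ‖Ψ u‖ * ‖⟪(u : LocalSpace d), x⟫_ℂ‖ =
        (‖Ψ u‖ - d * ‖⟪(u : LocalSpace d), x⟫_ℂ‖) ^ 2 / (2 * d) := by
      field_simp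
      ring
    have h5 : 0 ≤ (‖Ψ u‖ - d * ‖⟪(u : LocalSpace d), x⟫_ℂ‖) ^ 2 / (2 * d) := by positivity
    have h6 := mul_le_mul_of_nonneg_right h3 (norm_nonneg ⟪(u : LocalSpace d), x⟫_ℂ)
    linarith
  rw [integral_add (integrable_of_continuous (by fun_prop)) (integrable_of_continuous (by fun_prop)),
    integral_div, integral_const_mul, integral_norm_inner_sq hd] at h2
  have h3 : (d : ℝ) / 2 * (‖x‖ ^ 2 / d) = ‖x‖ ^ 2 / 2 := by field_simp
  rw [h3] at h2
  have h4 : ‖x‖ ^ 2 / 2 * (2 * d) ≤ ∫ u, ‖Ψ u‖ ^ 2 ∂sphereLaw d := by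
    rw [← le_div_iff₀ (by positivity)]
    linarith
  linarith

end Moments

/-! ### Every distinct letter of a word costs a factor `d`. -/

section WordBound

variable {d p : ℕ}

open scoped InnerProductSpace

/-- The product of the rank one operators of the letters of a word. -/
noncomputable def wordCLM (φ : Fin p → LocalSpace d) (w : List (Fin p)) :
    LocalSpace d →L[ℂ] LocalSpace d :=
  (w.map fun s => InnerProductSpace.rankOne ℂ (φ s) (φ s)).prod

lemma wordCLM_cons_apply (φ : Fin p → LocalSpace d) (s : Fin p) (w : List (Fin p))
    (x : LocalSpace d) : wordCLM φ (s :: w) x = ⟪φ s, wordCLM φ w x⟫_ℂ • φ s := by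
  simp [wordCLM]

lemma wordCLM_append_singleton_apply (φ : Fin p → LocalSpace d) (s : Fin p) (w : List (Fin p))
    (x : LocalSpace d) : wordCLM φ (w ++ [s]) x = wordCLM φ w (⟪φ s, x⟫_ℂ • φ s) := by
  simp [wordCLM]

lemma wordCLM_congr {φ ψ : Fin p → LocalSpace d} {w : List (Fin p)} (h : ∀ s ∈ w, φ s = ψ s) :
    wordCLM φ w = wordCLM ψ w := by
  rw [wordCLM, wordCLM]
  congr 1
  exact List.map_congr_left fun s hs => by rw [h s hs]

lemma wordCLM_single_apply (φ : Fin p → LocalSpace d) (w : List (Fin p)) (a b : Fin d) :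
    wordCLM φ w (EuclideanSpace.single b 1) a = wordMat φ w a b := by
  induction w generalizing a with
  | nil => simp [wordCLM, wordMat, Matrix.one_apply, PiLp.single_apply]
  | cons s w ih =>
    rw [wordCLM_cons_apply, wordMat_cons_apply]
    simp only [PiLp.smul_apply, PiLp.inner_apply, RCLike.inner_apply, smul_eq_mul, Finset.sum_mul,
      ih, varVal, Bool.false_eq_true, if_true, if_false]
    exact Finset.sum_congr rfl fun c _ => by ring

lemma continuous_wordCLM_apply {X : Type*} [TopologicalSpace X] {φ : X → Fin p → LocalSpace d}
    {x : X → LocalSpace d} (hφ : ∀ s, Continuous fun q => φ q s) (hx : Continuous x)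
    (w : List (Fin p)) : Continuous fun q => wordCLM (φ q) w (x q) := by
  induction w with
  | nil => simpa [wordCLM] using hx
  | cons s w ih =>
    simp_rw [wordCLM_cons_apply]
    have := hφ s
    fun_prop

lemma continuous_update_unitVector (s : Fin p) :
    Continuous fun q : (Fin p → UnitVector d) × UnitVector d => Function.update q.1 s q.2 :=
  continuous_fst.update s continuous_snd

lemma integral_eq_integral_update (hd : 0 < d) {E : Type*} [NormedAddCommGroup E] [NormedSpace ℝ E]
    [SecondCountableTopology E] {f : (Fin p → UnitVector d) → E} (hf : Continuous f) (s : Fin p) :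
    ∫ φ, f φ ∂(Measure.pi fun _ => sphereLaw d) =
      ∫ φ, ∫ v, f (Function.update φ s v) ∂sphereLaw d ∂(Measure.pi fun _ => sphereLaw d) := by
  have := isProbabilityMeasure_sphereLaw hd
  have h := measurePreserving_update (sphereLaw d) s
  rw [← integral_prod (f := fun q => f (Function.update q.1 s q.2))
    (integrable_of_continuous (hf.comp (continuous_update_unitVector s))),
    ← h.map_eq, integral_map h.measurable.aemeasurable hf.aestronglyMeasurable, h.map_eq]

/-- The projection of `Ψ` on the direction of `s`, averaged over that direction. -/
noncomputable def averagedProj (s : Fin p) (Ψ : (Fin p → UnitVector d) → LocalSpace d)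
    (φ : Fin p → UnitVector d) : LocalSpace d :=
  ∫ v : UnitVector d, ⟪(v : LocalSpace d), Ψ (Function.update φ s v)⟫_ℂ • (v : LocalSpace d)
    ∂sphereLaw d

lemma continuous_averagedProj (hd : 0 < d) (s : Fin p)
    {Ψ : (Fin p → UnitVector d) → LocalSpace d} (hΨ : Continuous Ψ) :
    Continuous (averagedProj s Ψ) := by
  have := isProbabilityMeasure_sphereLaw hd
  have h := hΨ.comp (continuous_update_unitVector (d := d) s)
  have h2 : Continuous (Function.uncurry fun (φ : Fin p → UnitVector d) (v : UnitVector d) =>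
      ⟪(v : LocalSpace d), Ψ (Function.update φ s v)⟫_ℂ • (v : LocalSpace d)) := by
    simp only [Function.comp_def] at h
    unfold Function.uncurry
    fun_prop
  have h3 := continuous_parametric_integral_of_continuous (μ := sphereLaw d) h2 isCompact_univ
  simp only [Measure.restrict_univ] at h3
  exact h3

/-- Letters are removed from the right and absorbed into the vector `Ψ`; `F` records letters on
which `Ψ` does not depend. In squared norm each letter gains one factor `1 / d` when its leftmost
occurrence is averaged, and another when its rightmost occurrence projects a vector independent of
it. Orthogonality of directions is used only on average, so no enumeration of pairings is needed. -/
lemma norm_integral_inner_wordCLM_le (hd : 0 < d) (u : LocalSpace d) (w : List (Fin p)) :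
    ∀ (F : Finset (Fin p)) (Ψ : (Fin p → UnitVector d) → LocalSpace d), Continuous Ψ →
      (∀ s ∈ F, ∀ φ v, Ψ (Function.update φ s v) = Ψ φ) →
      ‖∫ φ, ⟪u, wordCLM (fun s => (φ s : LocalSpace d)) w (Ψ φ)⟫_ℂ
          ∂(Measure.pi fun _ => sphereLaw d)‖ ^ 2 *
        (d : ℝ) ^ (w.toFinset.card + (w.toFinset ∩ F).card) ≤
      ‖u‖ ^ 2 * ∫ φ, ‖Ψ φ‖ ^ 2 ∂(Measure.pi fun _ => sphereLaw d) := by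
  have := isProbabilityMeasure_sphereLaw hd
  have hd' : (0 : ℝ) < d := by exact_mod_cast hd
  induction w using List.reverseRecOn with
  | nil =>
    intro F Ψ hΨ _
    simp only [wordCLM, List.map_nil, List.prod_nil, one_apply_eq_self,
      List.toFinset_nil, Finset.card_empty, Finset.empty_inter, add_zero, pow_zero, mul_one]
    refine (norm_integral_sq_le (integrable_of_continuous (by fun_prop))
      (integrable_of_continuous (by fun_prop))).trans ?_
    rw [← integral_const_mul]
    refine integral_mono (integrable_of_continuous (by fun_prop))
      (integrable_of_continuous (by fun_prop)) fun φ => ?_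
    simp only
    rw [← mul_pow]
    gcongr
    exact norm_inner_le_norm _ _
  | append_singleton w s ih =>
    intro F Ψ hΨ hF
    simp_rw [wordCLM_append_singleton_apply]
    by_cases hs : s ∈ w
    · have hw : (w ++ [s]).toFinset = w.toFinset := by
        ext t
        simp only [List.mem_toFinset, List.mem_append, List.mem_singleton]
        constructor
        · rintro (h | rfl)
          exacts [h, hs]
        · exact Or.inl
      have hc : Continuous fun φ : Fin p → UnitVector d =>
          ⟪(φ s : LocalSpace d), Ψ φ⟫_ℂ • (φ s : LocalSpace d) := by fun_prop
      have h := ih (F.erase s) _ hc fun t ht φ v => by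
        rw [hF t (Finset.mem_of_mem_erase ht),
          Function.update_of_ne (Finset.ne_of_mem_erase ht).symm]
      rw [hw]
      -- The letter occurs again further left, so it is not integrated yet. Projecting a vector
      -- independent of `φ s` gains `1 / d`, after which `s` must leave `F`; otherwise the
      -- projection is only a contraction.
      by_cases hsF : s ∈ F
      · have hcard : (w.toFinset ∩ F).card = (w.toFinset ∩ F.erase s).card + 1 := by
          rw [Finset.inter_erase, Finset.card_erase_add_one (by simp [hs, hsF])]
        have h2 : ∫ φ : Fin p → UnitVector d, ‖⟪(φ s : LocalSpace d), Ψ φ⟫_ℂ • (φ s : LocalSpace d)‖ ^ 2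
            ∂(Measure.pi fun _ => sphereLaw d) =
            (∫ φ, ‖Ψ φ‖ ^ 2 ∂(Measure.pi fun _ => sphereLaw d)) / d := by
          rw [integral_eq_integral_update hd (by fun_prop) s, ← integral_div]
          congr 1
          ext φ
          simp_rw [hF s hsF, Function.update_self, norm_smul, norm_eq_of_mem_sphere, mul_one]
          exact integral_norm_inner_sq hd _
        rw [h2] at h
        rw [hcard, ← add_assoc, pow_succ _ (w.toFinset.card + _), ← mul_assoc]
        calc _ ≤ ‖u‖ ^ 2 * ((∫ φ, ‖Ψ φ‖ ^ 2 ∂(Measure.pi fun _ => sphereLaw d)) / d) * d := by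
              gcongr
          _ = _ := by field_simp
      · rw [Finset.erase_eq_of_notMem hsF] at h
        refine h.trans ?_
        refine mul_le_mul_of_nonneg_left ?_ (sq_nonneg _)
        refine integral_mono (integrable_of_continuous (by fun_prop))
          (integrable_of_continuous (by fun_prop)) fun φ => ?_
        simp only [norm_smul, norm_eq_of_mem_sphere, mul_one]
        gcongr
        simpa using norm_inner_le_norm (𝕜 := ℂ) (φ s : LocalSpace d) (Ψ φ)
    -- No occurrence of `s` remains, so the average over `φ s` acts directly on the vector.
    · have hc := continuous_averagedProj hd s hΨ
      have hinv : ∀ t ∈ insert s F, ∀ φ v,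
          averagedProj s Ψ (Function.update φ t v) = averagedProj s Ψ φ := by
        intro t ht φ v
        rw [averagedProj, averagedProj]
        congr 1
        ext1 v'
        by_cases hts : t = s
        · subst hts
          rw [Function.update_idem]
        · rw [Function.update_comm hts, hF t (Finset.mem_of_mem_insert_of_ne ht hts)]
      have h := ih F _ hc fun t ht => hinv t (Finset.mem_insert_of_mem ht)
      have heq : ∫ φ : Fin p → UnitVector d, ⟪u, wordCLM (fun s => (φ s : LocalSpace d)) w
          (⟪(φ s : LocalSpace d), Ψ φ⟫_ℂ • (φ s : LocalSpace d))⟫_ℂ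
            ∂(Measure.pi fun _ => sphereLaw d) =
          ∫ φ : Fin p → UnitVector d, ⟪u, wordCLM (fun s => (φ s : LocalSpace d)) w
            (averagedProj s Ψ φ)⟫_ℂ ∂(Measure.pi fun _ => sphereLaw d) := by
        rw [integral_eq_integral_update hd (continuous_const.inner
          (continuous_wordCLM_apply (by fun_prop) (by fun_prop) w)) s]
        congr 1
        ext1 φ
        have hupd : ∀ v : UnitVector d, wordCLM (fun t => ((Function.update φ s v t : UnitVector d) :
            LocalSpace d)) w = wordCLM (fun t => (φ t : LocalSpace d)) w := fun v =>
          wordCLM_congr fun t ht => by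
            rw [Function.update_of_ne (by rintro rfl; exact hs ht)]
        simp_rw [hupd, Function.update_self]
        have hc2 : Continuous fun v : UnitVector d =>
            ⟪(v : LocalSpace d), Ψ (Function.update φ s v)⟫_ℂ • (v : LocalSpace d) := by
          have := hΨ.comp ((continuous_update_unitVector s).comp
            (Continuous.prodMk_right (Y := UnitVector d) φ))
          simp only [Function.comp_def] at this
          fun_prop
        exact ((innerSL ℂ u).comp (wordCLM (fun t => (φ t : LocalSpace d)) w)).integral_comp_comm
          (integrable_of_continuous hc2 (μ := sphereLaw d))
      have hsw : s ∉ w.toFinset := by simpa using hs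
      have hw : (w ++ [s]).toFinset = insert s w.toFinset := by
        ext t
        simp
      rw [heq, hw, Finset.card_insert_of_notMem hsw]
      set A := ‖∫ φ : Fin p → UnitVector d, ⟪u, wordCLM (fun s => (φ s : LocalSpace d)) w
        (averagedProj s Ψ φ)⟫_ℂ ∂(Measure.pi fun _ => sphereLaw d)‖ ^ 2
      by_cases hsF : s ∈ F
      -- The vector is independent of `φ s`, so this occurrence provides both gains at once: the
      -- averaged projection is multiplication by `1 / d`.
      · rw [Finset.insert_inter_of_mem hsF, Finset.card_insert_of_notMem (by simp [hs])]
        have h2 : ∀ φ, averagedProj s Ψ φ = (d : ℂ)⁻¹ • Ψ φ := fun φ => by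
          simp_rw [averagedProj, hF s hsF]
          exact integral_inner_smul hd _
        have h3 : ∫ φ, ‖averagedProj s Ψ φ‖ ^ 2 ∂(Measure.pi fun _ : Fin p => sphereLaw d) =
            (∫ φ, ‖Ψ φ‖ ^ 2 ∂(Measure.pi fun _ : Fin p => sphereLaw d)) / d ^ 2 := by
          rw [← integral_div]
          congr 1
          ext1 φ
          rw [h2, norm_smul, mul_pow, norm_inv, Complex.norm_natCast]
          field_simp
        rw [h3] at h
        calc _ = A *
            (d : ℝ) ^ (w.toFinset.card + (w.toFinset ∩ F).card) * d ^ 2 := by ring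
          _ ≤ ‖u‖ ^ 2 * ((∫ φ, ‖Ψ φ‖ ^ 2 ∂(Measure.pi fun _ => sphereLaw d)) / d ^ 2) * d ^ 2 := by
              gcongr
          _ = _ := by field_simp
      · rw [Finset.insert_inter_of_notMem hsF]
        have h3 : d * ∫ φ, ‖averagedProj s Ψ φ‖ ^ 2 ∂(Measure.pi fun _ : Fin p => sphereLaw d) ≤
            ∫ φ, ‖Ψ φ‖ ^ 2 ∂(Measure.pi fun _ : Fin p => sphereLaw d) := by
          rw [integral_eq_integral_update hd (f := fun φ => ‖Ψ φ‖ ^ 2) (by fun_prop) s,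
            ← integral_const_mul]
          have hc3 : Continuous fun q : (Fin p → UnitVector d) × UnitVector d =>
              ‖Ψ (Function.update q.1 s q.2)‖ ^ 2 :=
            (hΨ.comp (continuous_update_unitVector s)).norm.pow 2
          refine integral_mono (integrable_of_continuous (by fun_prop))
            (integrable_of_continuous hc3).integral_prod_left fun φ => ?_
          exact norm_integral_inner_smul_sq_le hd (hΨ.comp ((continuous_update_unitVector s).comp
            (Continuous.prodMk_right (Y := UnitVector d) φ)))
        calc _ = A *
            (d : ℝ) ^ (w.toFinset.card + (w.toFinset ∩ F).card) * d := by ring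
          _ ≤ ‖u‖ ^ 2 * (∫ φ, ‖averagedProj s Ψ φ‖ ^ 2 ∂(Measure.pi fun _ => sphereLaw d)) * d := by
              gcongr
          _ ≤ _ := by
              rw [mul_assoc, mul_comm _ (d : ℝ)]
              gcongr

lemma integral_pi_uniformUnitVector (hd : 0 < d) {E : Type*} [NormedAddCommGroup E]
    [NormedSpace ℝ E] [SecondCountableTopology E] {f : (Fin p → LocalSpace d) → E}
    (hf : Continuous f) :
    ∫ φ, f φ ∂(Measure.pi fun _ => uniformUnitVector d) =
      ∫ φ : Fin p → UnitVector d, f (fun s => φ s) ∂(Measure.pi fun _ => sphereLaw d) := by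
  have h := measurePreserving_coe_pi_sphereLaw hd (Fin p)
  rw [← h.map_eq, integral_map h.measurable.aemeasurable hf.aestronglyMeasurable]

/-- With a constant vector `Ψ` all letters lie in `F`, hence each distinct letter gains `d ^ 2` in
the squared norm and `d` in the norm; the trace has `d` diagonal entries. -/
lemma sphereWord_mul_pow_le (hd : 0 < d) (w : List (Fin p)) :
    sphereWord d w * (d : ℝ) ^ w.toFinset.card ≤ d := by
  have := isProbabilityMeasure_sphereLaw hd
  have hd' : (0 : ℝ) < d := by exact_mod_cast hd
  have h0 := sphereWord_nonneg hd w
  have h := integral_trace_wordMat_uniform hd w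
  simp_rw [Matrix.trace, Matrix.diag] at h
  rw [integral_finsetSum _ fun a _ => integrable_wordMat_uniform hd w a a] at h
  have h1 : ∀ a, ‖∫ φ : Fin p → LocalSpace d, wordMat φ w a a
      ∂(Measure.pi fun _ => uniformUnitVector d)‖ * (d : ℝ) ^ w.toFinset.card ≤ 1 := by
    intro a
    have h2 := norm_integral_inner_wordCLM_le hd (EuclideanSpace.single a 1) w Finset.univ
      (fun _ => EuclideanSpace.single a 1) continuous_const (by simp)
    simp only [EuclideanSpace.inner_single_left, wordCLM_single_apply, map_one, one_mul,
      PiLp.norm_single, norm_one, one_pow, integral_const, probReal_univ, smul_eq_mul,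
      mul_one, Finset.inter_univ] at h2
    rw [integral_pi_uniformUnitVector hd (continuous_wordMat_apply w a a)]
    rw [← two_mul, mul_comm 2, pow_mul, ← mul_pow] at h2
    exact (sq_le_one_iff₀ (by positivity)).1 h2
  have h2 : sphereWord d w = ‖(sphereWord d w : ℂ)‖ := by
    rw [Complex.norm_real, Real.norm_of_nonneg h0]
  rw [h2, ← h]
  calc _ ≤ (∑ a, ‖∫ φ : Fin p → LocalSpace d, wordMat φ w a a
      ∂(Measure.pi fun _ => uniformUnitVector d)‖) * (d : ℝ) ^ w.toFinset.card := by
        gcongr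
        exact norm_sum_le _ _
    _ ≤ ∑ a : Fin d, 1 := by
        rw [Finset.sum_mul]
        exact Finset.sum_le_sum fun a _ => h1 a
    _ = d := by simp

end WordBound

/-! ### Sums over words and exchange of alphabets. -/

section WordSum

variable {α β : Type*}

/-- The sum of `h` over the words of length `n` with letters in `A`. -/
def wordSum (A : Finset α) : ℕ → (List α → ℝ) → ℝ
  | 0, h => h []
  | n + 1, h => ∑ s ∈ A, wordSum A n fun w => h (s :: w)

lemma wordSum_zero (A : Finset α) (h : List α → ℝ) : wordSum A 0 h = h [] := rfl

lemma wordSum_succ (A : Finset α) (n : ℕ) (h : List α → ℝ) :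
    wordSum A (n + 1) h = ∑ s ∈ A, wordSum A n fun w => h (s :: w) := rfl

lemma sum_ofFn_eq_wordSum [Fintype α] (n : ℕ) (h : List α → ℝ) :
    ∑ w : Fin n → α, h (List.ofFn w) = wordSum Finset.univ n h := by
  induction n generalizing h with
  | zero => simp [wordSum_zero]
  | succ n ih =>
    rw [wordSum_succ, ← (Fin.consEquiv fun _ => α).sum_comp, Fintype.sum_prod_type]
    refine Finset.sum_congr rfl fun s _ => ?_
    rw [← ih]
    simp [Fin.consEquiv]

lemma wordSum_le_wordSum {A : Finset α} {n : ℕ} {h h' : List α → ℝ}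
    (hle : ∀ w, w.length = n → (∀ s ∈ w, s ∈ A) → h w ≤ h' w) : wordSum A n h ≤ wordSum A n h' := by
  induction n generalizing h h' with
  | zero => exact hle [] rfl (by simp)
  | succ n ih =>
    refine Finset.sum_le_sum fun s hs => ih fun w hw hA => hle _ (by simp [hw]) ?_
    simpa [hs] using hA

lemma wordSum_nonneg {A : Finset α} {n : ℕ} {h : List α → ℝ} (h0 : ∀ w, 0 ≤ h w) :
    0 ≤ wordSum A n h := by
  induction n generalizing h with
  | zero => exact h0 []
  | succ n ih => exact Finset.sum_nonneg fun s _ => ih fun w => h0 _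

lemma wordSum_mono_set {A B : Finset α} (hAB : A ⊆ B) {n : ℕ} {h : List α → ℝ}
    (h0 : ∀ w, 0 ≤ h w) : wordSum A n h ≤ wordSum B n h := by
  induction n generalizing h with
  | zero => exact le_rfl
  | succ n ih =>
    calc _ ≤ ∑ s ∈ A, wordSum B n fun w => h (s :: w) :=
          Finset.sum_le_sum fun s _ => ih fun w => h0 _
      _ ≤ _ := Finset.sum_le_sum_of_subset_of_nonneg hAB fun s _ _ => wordSum_nonneg fun w => h0 _

lemma wordSum_const_mul (A : Finset α) (n : ℕ) (c : ℝ) (h : List α → ℝ) :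
    wordSum A n (fun w => c * h w) = c * wordSum A n h := by
  induction n generalizing h with
  | zero => rfl
  | succ n ih =>
    rw [wordSum_succ, wordSum_succ, Finset.mul_sum]
    exact Finset.sum_congr rfl fun s _ => ih _

lemma wordSum_map (σ : α ↪ β) (A : Finset α) (n : ℕ) (h : List β → ℝ) :
    wordSum (A.map σ) n h = wordSum A n fun w => h (w.map σ) := by
  induction n generalizing h with
  | zero => rfl
  | succ n ih =>
    rw [wordSum_succ, wordSum_succ, Finset.sum_map]
    exact Finset.sum_congr rfl fun s _ => ih _

/-- Words are sorted by the first occurrence of `s`: either there is none, or `B` precedes it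
without using `s` and `C` is the arbitrary remainder. -/
lemma wordSum_insert [DecidableEq α] {A : Finset α} {s : α} (hs : s ∉ A) (n : ℕ) (h : List α → ℝ) :
    wordSum (insert s A) n h = wordSum A n h + ∑ j ∈ Finset.range n,
      wordSum A j fun B => wordSum (insert s A) (n - 1 - j) fun C => h (B ++ s :: C) := by
  induction n generalizing h with
  | zero => simp [wordSum_zero]
  | succ n ih =>
    rw [wordSum_succ, Finset.sum_insert hs, wordSum_succ, Finset.sum_range_succ']
    simp_rw [ih fun w => h (_ :: w), wordSum_zero, wordSum_succ]
    simp only [Finset.sum_add_distrib, add_tsub_cancel_right, tsub_zero, List.nil_append,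
      List.cons_append]
    rw [Finset.sum_comm, ← ih]
    have : ∀ j, n - 1 - j = n - (j + 1) := fun j => by omega
    simp_rw [this]
    ring

/-- Words with the same pattern of equal letters have the same weight under an invariant function;
penalizing every distinct letter by `c⁻¹` amounts to reducing the number of letters `c`-fold. -/
lemma wordSum_pattern_le [DecidableEq α] {f : List α → ℝ} (f0 : ∀ w, 0 ≤ f w)
    (hf : ∀ (σ : Equiv.Perm α) w, f (w.map σ) = f w) {c : ℝ} (hc : 0 < c) (A A' : Finset α)
    (n : ℕ) (u : List α) (σ : Equiv.Perm α) (hu : ∀ s ∈ u, σ s ∈ A')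
    (hcard : (A.card : ℝ) ≤ c * (A'.card - (u.length + n))) :
    wordSum A n (fun w => c⁻¹ ^ (u ++ w).toFinset.card * f (u ++ w)) ≤
      c⁻¹ ^ u.toFinset.card * wordSum A' n fun w => f (u.map σ ++ w) := by
  induction n generalizing u σ with
  | zero =>
    rw [wordSum_zero, wordSum_zero, List.append_nil, List.append_nil, hf]
  | succ n ih =>
    set R : α → ℝ := fun t => wordSum A' n fun w => f (u.map σ ++ t :: w) with hR
    have hR0 : ∀ t, 0 ≤ R t := fun t => wordSum_nonneg fun w => f0 _
    set L : α → ℝ := fun s =>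
      wordSum A n fun w => c⁻¹ ^ (u ++ s :: w).toFinset.card * f (u ++ s :: w) with hL
    have hcard' : (A.card : ℝ) ≤ c * (A'.card - ((u.length + 1 : ℕ) + n)) := by
      refine hcard.trans_eq ?_
      push_cast
      ring
    -- Here `u` is the part already read and `σ` the matching of its letters with letters of `A'`. A
    -- repeated letter must follow the matching and pays no new penalty.
    have hold : ∀ s ∈ u, L s ≤ c⁻¹ ^ u.toFinset.card * R (σ s) := by
      intro s hs
      have h := ih (u ++ [s]) σ (by
        intro t ht
        rcases List.mem_append.1 ht with h | h
        · exact hu t h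
        · rw [List.mem_singleton.1 h]
          exact hu s hs) (by simpa using hcard')
      have hset : (u ++ [s]).toFinset = u.toFinset := by
        ext t
        simp only [List.mem_toFinset, List.mem_append, List.mem_singleton]
        exact ⟨fun h => h.elim id fun h => h ▸ hs, Or.inl⟩
      rw [hset] at h
      simpa [hL, hR] using h
    -- A letter not yet read may be matched with any unused `t` in `A'` after a transposition that
    -- fixes the letters already matched; it pays one factor `c⁻¹`.
    have hnew : ∀ s ∉ u, ∀ t ∈ A' \ (u.map σ).toFinset,
        L s ≤ c⁻¹ ^ u.toFinset.card * (c⁻¹ * R t) := by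
      intro s hs t ht
      obtain ⟨htA, htu⟩ := Finset.mem_sdiff.1 ht
      have hne : ∀ r ∈ u, σ r ≠ σ s ∧ σ r ≠ t := fun r hr =>
        ⟨fun h => hs (σ.injective h ▸ hr), fun h => htu (by
          simpa using ⟨r, hr, h⟩)⟩
      have hfix : ∀ r ∈ u, (Equiv.swap (σ s) t * σ) r = σ r := fun r hr => by
        rw [Equiv.Perm.mul_apply, Equiv.swap_apply_of_ne_of_ne (hne r hr).1 (hne r hr).2]
      have hst : (Equiv.swap (σ s) t * σ) s = t := by simp
      have h := ih (u ++ [s]) (Equiv.swap (σ s) t * σ) (by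
        intro r hr
        rcases List.mem_append.1 hr with h | h
        · rw [hfix r h]
          exact hu r h
        · rw [List.mem_singleton.1 h, hst]
          exact htA) (by simpa using hcard')
      have hset : (u ++ [s]).toFinset = insert s u.toFinset := by
        ext t
        simp
      rw [hset, Finset.card_insert_of_notMem (by simpa using hs), List.map_append,
        List.map_congr_left hfix, List.map_singleton, hst, pow_succ, mul_assoc] at h
      simpa [hL, hR] using h
    have hsum : ∑ s ∈ A \ u.toFinset, L s ≤
        c⁻¹ ^ u.toFinset.card * ∑ t ∈ A' \ (u.map σ).toFinset, R t := by
      have hAu : ((A \ u.toFinset).card : ℝ) ≤ c * (A' \ (u.map σ).toFinset).card := by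
        have h1 : ((A \ u.toFinset).card : ℝ) ≤ A.card := by
          exact_mod_cast Finset.card_le_card Finset.sdiff_subset
        have h2 : (A'.card : ℝ) ≤ (A' \ (u.map σ).toFinset).card + u.length := by
          have h3 := Finset.card_le_card_sdiff_add_card (s := A') (t := (u.map σ).toFinset)
          have h4 := (List.toFinset_card_le (u.map σ)).trans_eq
            (List.length_map _)
          exact_mod_cast h3.trans (by omega)
        refine h1.trans (hcard.trans ?_)
        gcongr
        push_cast
        linarith [Nat.cast_nonneg (α := ℝ) n]
      rcases (A' \ (u.map σ).toFinset).eq_empty_or_nonempty with he | hne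
      · rw [he, Finset.card_empty, Nat.cast_zero, mul_zero] at hAu
        have : A \ u.toFinset = ∅ := Finset.card_eq_zero.1 (by
          exact_mod_cast le_antisymm hAu (Nat.cast_nonneg _))
        rw [this, he]
        simp
      -- All new letters are compared with the least favourable `t`. There are at most `c` times as
      -- many of them as unused letters of `A'`, which uses up the factor `c⁻¹`.
      · obtain ⟨t, ht, hmin⟩ := Finset.exists_min_image _ R hne
        calc _ ≤ ∑ s ∈ A \ u.toFinset, c⁻¹ ^ u.toFinset.card * (c⁻¹ * R t) :=
              Finset.sum_le_sum fun s hs => hnew s (by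
                simpa using (Finset.mem_sdiff.1 hs).2) t ht
          _ = (A \ u.toFinset).card * (c⁻¹ ^ u.toFinset.card * (c⁻¹ * R t)) := by simp
          _ ≤ (c * (A' \ (u.map σ).toFinset).card) * (c⁻¹ ^ u.toFinset.card * (c⁻¹ * R t)) := by
              have := hR0 t
              gcongr
          _ = c⁻¹ ^ u.toFinset.card * ((A' \ (u.map σ).toFinset).card • R t) := by
              rw [nsmul_eq_mul]
              field_simp
          _ ≤ _ := by
              gcongr
              exact Finset.card_nsmul_le_sum _ _ _ hmin
    have hsum2 : ∑ s ∈ A ∩ u.toFinset, L s ≤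
        c⁻¹ ^ u.toFinset.card * ∑ t ∈ A' ∩ (u.map σ).toFinset, R t := by
      calc _ ≤ ∑ s ∈ A ∩ u.toFinset, c⁻¹ ^ u.toFinset.card * R (σ s) :=
            Finset.sum_le_sum fun s hs => hold s (by simpa using (Finset.mem_inter.1 hs).2)
        _ = c⁻¹ ^ u.toFinset.card * ∑ t ∈ (A ∩ u.toFinset).map σ.toEmbedding, R t := by
            rw [← Finset.mul_sum, Finset.sum_map]
            rfl
        _ ≤ _ := by
            refine mul_le_mul_of_nonneg_left ?_ (by positivity)
            refine Finset.sum_le_sum_of_subset_of_nonneg (fun t ht => ?_) fun t _ _ => hR0 t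
            obtain ⟨s, hs, rfl⟩ := Finset.mem_map.1 ht
            have hsu : s ∈ u := by simpa using (Finset.mem_inter.1 hs).2
            exact Finset.mem_inter.2 ⟨hu s hsu, by simpa using hsu⟩
    rw [wordSum_succ, wordSum_succ]
    calc _ = ∑ s ∈ A ∩ u.toFinset, L s + ∑ s ∈ A \ u.toFinset, L s :=
          (Finset.sum_inter_add_sum_sdiff _ _ _).symm
      _ ≤ c⁻¹ ^ u.toFinset.card * ∑ t ∈ A' ∩ (u.map σ).toFinset, R t +
          c⁻¹ ^ u.toFinset.card * ∑ t ∈ A' \ (u.map σ).toFinset, R t := add_le_add hsum2 hsum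
      _ = _ := by rw [← mul_add, Finset.sum_inter_add_sum_sdiff]

end WordSum

/-! ### Growth of the weighted Catalan numbers. -/

section Catalan

/-- Weighted Catalan numbers, which are up to a shift the moments of the Marchenko-Pastur law. -/
noncomputable def weightedCatalan (x : ℝ) : ℕ → ℝ
  | 0 => 1
  | n + 1 => (1 + x) * weightedCatalan x n +
      x * ∑ i : Fin n, weightedCatalan x i * weightedCatalan x (n - 1 - i)

lemma weightedCatalan_zero (x : ℝ) : weightedCatalan x 0 = 1 := by
  rw [weightedCatalan]

lemma weightedCatalan_succ (x : ℝ) (n : ℕ) :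
    weightedCatalan x (n + 1) = (1 + x) * weightedCatalan x n + x * ∑ i ∈ Finset.range n,
      weightedCatalan x i * weightedCatalan x (n - 1 - i) := by
  rw [weightedCatalan, Finset.sum_range]

open PowerSeries in
-- The generating function is algebraic of degree two, so it satisfies a linear differential
-- equation with polynomial coefficients; comparing coefficients gives a recursion that, unlike the
-- convolution, controls ratios.
lemma weightedCatalan_three_term {x : ℝ} (hx : x ≠ 0) (j : ℕ) :
    (j + 4) * weightedCatalan x (j + 2) = (1 + x) * (2 * j + 5) * weightedCatalan x (j + 1) -
      (1 - x) ^ 2 * (j + 1) * weightedCatalan x j := by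
  set Y : PowerSeries ℝ := PowerSeries.mk (weightedCatalan x) with hY
  have hrec : Y = 1 + C (1 + x) * X * Y + C x * X ^ 2 * Y ^ 2 := by
    ext n
    rw [map_add, map_add, mul_assoc, mul_assoc, coeff_C_mul, coeff_C_mul]
    cases n with
    | zero => simp [hY, weightedCatalan_zero, coeff_zero_X_mul]
    | succ n =>
      rw [coeff_succ_X_mul, sq, mul_assoc, coeff_succ_X_mul, hY, coeff_mk, weightedCatalan_succ,
        coeff_mk, coeff_one, if_neg n.succ_ne_zero, zero_add]
      congr 2
      cases n with
      | zero => simp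
      | succ n =>
        rw [coeff_succ_X_mul, sq, coeff_mul, Finset.Nat.sum_antidiagonal_eq_sum_range_succ_mk]
        exact Finset.sum_congr rfl fun i _ => by simp
  -- The square root in the quadratic formula for `Y`: its square is a polynomial of degree two.
  set S : PowerSeries ℝ := C (2 * x) * X ^ 2 * Y + C (1 + x) * X - 1 with hS
  have hS2 : S ^ 2 = 1 - C (2 * (1 + x)) * X + C ((1 - x) ^ 2) * X ^ 2 := by
    have h1 : S ^ 2 = (C (1 + x) * X - 1) ^ 2 - C (4 * x) * X ^ 2 +
        C (4 * x) * X ^ 2 * (1 + C (1 + x) * X * Y + C x * X ^ 2 * Y ^ 2 - Y) := by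
      rw [hS]
      simp only [map_mul, map_add, map_one, map_ofNat]
      ring
    rw [h1, ← hrec]
    simp only [map_mul, map_add, map_sub, map_pow, map_one, map_ofNat]
    ring
  have hD : S * derivative ℝ S * 2 = -C (2 * (1 + x)) + C (2 * (1 - x) ^ 2) * X := by
    have h := congrArg (derivative ℝ) hS2
    rw [sq S, Derivation.leibniz] at h
    simp only [map_add, map_sub, derivative_one, Derivation.leibniz, smul_eq_mul, derivative_C,
      derivative_X, derivative_pow, mul_zero, add_zero, mul_one, zero_sub] at h
    rw [map_mul C 2 ((1 - x) ^ 2), map_ofNat C 2]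
    simp only [Nat.add_one_sub_one, pow_one, Nat.cast_ofNat] at h
    linear_combination h
  -- For a square root `S` of `P` this is the equation `2 * P * S' = P' * S`.
  have hS3 : derivative ℝ S * 2 - C (2 * (1 + x)) * (X * (derivative ℝ S * 2)) +
      C ((1 - x) ^ 2) * (X * (X * (derivative ℝ S * 2))) =
      C (2 * (1 - x) ^ 2) * (X * S) - C (2 * (1 + x)) * S := by
    linear_combination S * hD - derivative ℝ S * 2 * hS2
  have hcoeff : ∀ n, coeff (n + 2) S = 2 * x * weightedCatalan x n := by
    intro n
    rw [hS, map_sub, map_add, mul_assoc, coeff_C_mul, coeff_C_mul, sq, mul_assoc X, coeff_succ_X_mul,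
      coeff_succ_X_mul, hY, coeff_mk, coeff_X, coeff_one]
    simp
  have h := congrArg (coeff (j + 3)) hS3
  have h2 : ∀ n, coeff n (derivative ℝ S * 2) = 2 * (coeff (n + 1) S * (n + 1)) := by
    intro n
    rw [mul_comm, ← map_ofNat C 2, coeff_C_mul, coeff_derivative]
  simp only [map_add, map_sub, coeff_C_mul, coeff_succ_X_mul, h2, hcoeff] at h
  push_cast at h
  have h5 : (4 * x) * ((j + 4) * weightedCatalan x (j + 2)) =
      (4 * x) * ((1 + x) * (2 * j + 5) * weightedCatalan x (j + 1) -
      (1 - x) ^ 2 * (j + 1) * weightedCatalan x j) := by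
    linear_combination h
  exact mul_left_cancel₀ (by positivity) h5

/-- With `lam = (1 + √x) ^ 2` and `mu = (1 - √x) ^ 2` the coefficients of the three term recursion
are `(lam + mu) / 2` and `lam * mu`; the bound for one ratio, inserted in the negative term, gives
the bound for the next. -/
lemma weightedCatalan_ratio {x : ℝ} (hx : 0 < x) (j : ℕ) : 0 < weightedCatalan x j ∧
    (1 + √x) ^ 2 * (2 * j + 3) * weightedCatalan x j ≤ 2 * (j + 3) * weightedCatalan x (j + 1) := by
  have hsq : √x ^ 2 = x := Real.sq_sqrt hx.le
  have hs : 0 < √x := Real.sqrt_pos.2 hx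
  induction j with
  | zero =>
    rw [weightedCatalan_succ, weightedCatalan_zero]
    refine ⟨one_pos, ?_⟩
    simp only [Finset.range_zero, Finset.sum_empty]
    push_cast
    nlinarith [sq_nonneg (√x - 1)]
  | succ j ih =>
    obtain ⟨h0, h1⟩ := ih
    have h2 := weightedCatalan_three_term hx.ne' j
    have hpos : 0 < weightedCatalan x (j + 1) := by
      have : 0 < (1 + √x) ^ 2 * (2 * j + 3) * weightedCatalan x j := by positivity
      have h3 : (0 : ℝ) < 2 * (j + 3) := by positivity
      exact (mul_pos_iff_of_pos_left h3).1 (this.trans_le h1)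
    refine ⟨hpos, ?_⟩
    have hj : (0 : ℝ) ≤ j := Nat.cast_nonneg j
    have hb : (1 - x) ^ 2 = (1 + √x) ^ 2 * (1 - √x) ^ 2 := by
      nlinarith [hsq]
    set lam := (1 + √x) ^ 2 with hlam
    set mu := (1 - √x) ^ 2 with hmu
    have hsum : 2 * (1 + x) = lam + mu := by
      rw [hlam, hmu]
      linarith [hsq, add_sq 1 (√x), sub_sq 1 (√x)]
    have hmu0 : 0 ≤ mu := sq_nonneg _
    have h4 : mu * (j + 1) * (lam * (2 * j + 3) * weightedCatalan x j) ≤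
        mu * (j + 1) * (2 * (j + 3) * weightedCatalan x (j + 1)) := by gcongr
    have h5 : 0 ≤ mu * weightedCatalan x (j + 1) := mul_nonneg hmu0 hpos.le
    rw [hb] at h2
    push_cast
    have h6 : (2 * (j : ℝ) + 3) * (2 * (j + 4) * weightedCatalan x (j + 2)) =
        (2 * j + 3) * ((lam + mu) * (2 * j + 5) * weightedCatalan x (j + 1)) -
        2 * (mu * (j + 1) * (lam * (2 * j + 3) * weightedCatalan x j)) := by
      rw [← hsum]
      linear_combination (2 * (2 * (j : ℝ) + 3)) * h2
    have h7 : (2 * (j : ℝ) + 3) * (lam * (2 * (j + 1) + 3) * weightedCatalan x (j + 1)) ≤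
        (2 * (j : ℝ) + 3) * (2 * (j + 1 + 3) * weightedCatalan x (j + 1 + 1)) := by
      have h8 : (2 * (j : ℝ) + 3) * (2 * (j + 1 + 3) * weightedCatalan x (j + 1 + 1)) =
          (2 * (j : ℝ) + 3) * (2 * (j + 4) * weightedCatalan x (j + 2)) := by ring_nf
      rw [h8, h6]
      nlinarith
    exact le_of_mul_le_mul_left h7 (by positivity)

/-- The ratios fall short of `(1 + √x) ^ 2` by a factor `1 - O(1 / j)`, whose product loses only a
power of `j`; such a loss disappears after taking roots of order `√d`. -/
lemma pow_le_weightedCatalan {x : ℝ} (hx : 0 < x) (j : ℕ) :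
    ((1 + √x) ^ 2) ^ j ≤ (j + 1) ^ 2 * weightedCatalan x j := by
  induction j with
  | zero => simp [weightedCatalan_zero]
  | succ j ih =>
    obtain ⟨h0, h1⟩ := weightedCatalan_ratio hx j
    set lam := (1 + √x) ^ 2
    have hl : 0 ≤ lam := sq_nonneg _
    have h0' := (weightedCatalan_ratio hx (j + 1)).1
    have hj : (0 : ℝ) ≤ j := Nat.cast_nonneg j
    rw [pow_succ]
    push_cast
    have h2 : lam ^ j * lam * (2 * j + 3) ≤
        (j + 1) ^ 2 * (2 * (j + 3) * weightedCatalan x (j + 1)) := by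
      calc lam ^ j * lam * (2 * j + 3)
          ≤ ((j + 1) ^ 2 * weightedCatalan x j) * lam * (2 * j + 3) := by gcongr
        _ = (j + 1) ^ 2 * (lam * (2 * j + 3) * weightedCatalan x j) := by ring
        _ ≤ _ := by gcongr
    have h3 : (j + 1) ^ 2 * (2 * (j + 3) * weightedCatalan x (j + 1)) ≤
        ((j + 1 + 1) ^ 2 * weightedCatalan x (j + 1)) * (2 * j + 3) := by
      nlinarith [mul_nonneg hj h0'.le, mul_nonneg (mul_nonneg hj hj) h0'.le]
    exact le_of_mul_le_mul_right (h2.trans h3) (by positivity)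

end Catalan

/-! ### Nested loops of letters and the Catalan recursion. -/

/-- A lower bound for the total weight of words, for a weight that is multiplicative when a loop of
new letters is removed. -/
lemma weightedCatalan_le_wordSum {α : Type*} [DecidableEq α] {g : List α → ℝ} {N x : ℝ} (hN : 0 < N)
    (hx : 0 ≤ x) (g0 : ∀ w, 0 ≤ g w) (gnil : 1 ≤ g [])
    (gfresh : ∀ s w, s ∉ w → N⁻¹ * g w ≤ g (s :: w))
    (gloop : ∀ s v w, s ∉ v → v.Disjoint w → g v * g (s :: w) ≤ g (s :: v ++ s :: w)) (n : ℕ) :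
    (∀ (A : Finset α) (s : α), s ∉ A → N * x + n ≤ A.card →
      weightedCatalan x n ≤ N * wordSum (insert s A) n fun w => g (s :: w)) ∧
    ∀ A : Finset α, N * x + n ≤ A.card →
      (if n = 0 then 1 else x * weightedCatalan x (n - 1)) ≤ wordSum A n g := by
  -- The target for words with no marked letter, as opposed to `weightedCatalan x n` for words
  -- preceded by a marked letter `s`. Both bounds are proved in one induction.
  set z : ℕ → ℝ := fun n => if n = 0 then 1 else x * weightedCatalan x (n - 1) with hz
  have hW : ∀ n, 0 ≤ weightedCatalan x n := by
    intro n
    induction n using Nat.strong_induction_on with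
    | _ n ih =>
      cases n with
      | zero => rw [weightedCatalan_zero]; exact zero_le_one
      | succ n =>
        rw [weightedCatalan_succ]
        have h1 := ih n (by omega)
        have h2 : 0 ≤ ∑ i ∈ Finset.range n, weightedCatalan x i * weightedCatalan x (n - 1 - i) :=
          Finset.sum_nonneg fun i hi => mul_nonneg (ih i (by simp at hi; omega)) (ih _ (by omega))
        positivity
  induction n using Nat.strong_induction_on with
  | _ n ih =>
    have hZ : ∀ A : Finset α, N * x + n ≤ A.card → z n ≤ wordSum A n g := by
      intro A hA
      cases n with
      | zero => simpa [hz, wordSum_zero] using gnil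
      | succ n =>
        simp only [hz, n.succ_ne_zero, if_false, Nat.add_sub_cancel]
        rw [wordSum_succ]
        have h1 : ∀ s ∈ A, N⁻¹ * weightedCatalan x n ≤ wordSum A n fun w => g (s :: w) := by
          intro s hs
          have h2 := (ih n (by omega)).1 (A.erase s) s (Finset.notMem_erase s A) (by
            have h3 := Finset.card_erase_add_one hs
            have h4 : (A.card : ℝ) = (A.erase s).card + 1 := by exact_mod_cast h3.symm
            push_cast at hA
            linarith)
          rw [Finset.insert_erase hs] at h2
          rwa [inv_mul_le_iff₀ hN]
        -- Each of the at least `N * x` letters can start the word and serve as the marked letter of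
        -- the rest.
        have h2 := Finset.card_nsmul_le_sum _ _ _ h1
        refine le_trans ?_ h2
        have h3 : N * x ≤ A.card := by
          push_cast at hA
          linarith [Nat.cast_nonneg (α := ℝ) n]
        rw [nsmul_eq_mul]
        calc x * weightedCatalan x n = (N * x) * (N⁻¹ * weightedCatalan x n) := by field_simp
          _ ≤ _ := mul_le_mul_of_nonneg_right h3 (mul_nonneg (by positivity) (hW n))
    refine ⟨fun A s hs hA => ?_, hZ⟩
    -- Decomposition at the first return to the marked letter: no return, or a loop of length `j`
    -- and a remainder again preceded by `s`.
    have hrec : weightedCatalan x n = z n + ∑ j ∈ Finset.range n,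
        z j * weightedCatalan x (n - 1 - j) := by
      cases n with
      | zero => simp [hz, weightedCatalan_zero]
      | succ n =>
        have h1 : ∀ i, z (i + 1) * weightedCatalan x (n + 1 - 1 - (i + 1)) =
            x * (weightedCatalan x i * weightedCatalan x (n - 1 - i)) := by
          intro i
          rw [show n + 1 - 1 - (i + 1) = n - 1 - i by omega, ← mul_assoc]
          rfl
        have h2 : z (n + 1) = x * weightedCatalan x n := rfl
        have h3 : z 0 = 1 := rfl
        rw [weightedCatalan_succ, Finset.sum_range_succ']
        simp_rw [h1]
        rw [← Finset.mul_sum, h2, h3, Nat.add_sub_cancel, Nat.sub_zero]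
        ring
    rw [hrec, wordSum_insert hs, mul_add, Finset.mul_sum]
    refine add_le_add ?_ (Finset.sum_le_sum fun j hj => ?_)
    · refine (hZ A hA).trans ?_
      rw [← inv_mul_le_iff₀ hN, ← wordSum_const_mul]
      exact wordSum_le_wordSum fun w _ hw => gfresh s w fun h => hs (hw s h)
    · have hj' := Finset.mem_range.1 hj
      have hjn : (j : ℝ) + (n - 1 - j : ℕ) ≤ n := by
        exact_mod_cast (by omega : j + (n - 1 - j) ≤ n)
      have hZj := (ih j hj').2 A (by linarith [Nat.cast_nonneg (α := ℝ) (n - 1 - j)])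
      calc z j * weightedCatalan x (n - 1 - j)
          ≤ wordSum A j g * weightedCatalan x (n - 1 - j) :=
            mul_le_mul_of_nonneg_right hZj (hW _)
        _ = N * wordSum A j fun B => (N⁻¹ * weightedCatalan x (n - 1 - j)) * g B := by
            rw [wordSum_const_mul]
            field_simp
        _ ≤ _ := by
            refine mul_le_mul_of_nonneg_left (wordSum_le_wordSum fun B hBl hBA => ?_) hN.le
            have hsB : s ∉ B := fun h => hs (hBA s h)
            -- The remainder must avoid the letters of the loop. At most `j` letters are lost, which
            -- the slack `n` in the cardinality hypothesis covers.
            have hcard : (A.card : ℝ) ≤ (A \ B.toFinset).card + j := by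
              have h3 := Finset.card_le_card_sdiff_add_card (s := A) (t := B.toFinset)
              have h4 := (List.toFinset_card_le B).trans_eq hBl
              exact_mod_cast h3.trans (by omega)
            have hY := (ih (n - 1 - j) (by omega)).1 (A \ B.toFinset) s
              (fun h => hs (Finset.mem_sdiff.1 h).1) (by linarith)
            rw [← inv_mul_le_iff₀ hN] at hY
            calc _ ≤ (wordSum (insert s (A \ B.toFinset)) (n - 1 - j) fun w => g (s :: w)) * g B :=
                  mul_le_mul_of_nonneg_right hY (g0 B)
              _ = wordSum (insert s (A \ B.toFinset)) (n - 1 - j) fun w => g B * g (s :: w) := by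
                  rw [wordSum_const_mul, mul_comm]
              _ ≤ wordSum (insert s (A \ B.toFinset)) (n - 1 - j) fun w => g (s :: B ++ s :: w) := by
                  refine wordSum_le_wordSum fun w _ hw => gloop s B w hsB ?_
                  intro t htB htw
                  rcases Finset.mem_insert.1 (hw t htw) with h | h
                  · exact hsB (h ▸ htB)
                  · exact (Finset.mem_sdiff.1 h).2 (by simpa using htB)
              _ ≤ _ := wordSum_mono_set (Finset.insert_subset_insert _ Finset.sdiff_subset)
                  fun w => g0 _

/-! ### Words with scalar expectation on the sphere. -/

section Independence

variable {d p : ℕ}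

lemma integral_mul_of_disjoint {E : Type*} [MeasurableSpace E] [Zero E] {ν : Measure E}
    [IsProbabilityMeasure ν] {f g : (Fin p → E) → ℂ} (hf : Measurable f) (hg : Measurable g)
    {S T : Finset (Fin p)} (hST : Disjoint S T)
    (hfS : ∀ φ ψ : Fin p → E, (∀ s ∈ S, φ s = ψ s) → f φ = f ψ)
    (hgT : ∀ φ ψ : Fin p → E, (∀ s ∈ T, φ s = ψ s) → g φ = g ψ) :
    ∫ φ, f φ * g φ ∂(Measure.pi fun _ => ν) =
      (∫ φ, f φ ∂(Measure.pi fun _ => ν)) * ∫ φ, g φ ∂(Measure.pi fun _ => ν) := by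
  have hind := (iIndepFun_pi (μ := fun _ : Fin p => ν) (X := fun _ => id)
    fun _ => aemeasurable_id).indepFun_finset S T hST fun i => measurable_pi_apply i
  have hext : ∀ R : Finset (Fin p), Measurable fun (y : R → E) (s : Fin p) =>
      if h : s ∈ R then y ⟨s, h⟩ else 0 := by
    intro R
    rw [measurable_pi_iff]
    intro s
    by_cases h : s ∈ R
    · simp only [h, dif_pos]
      fun_prop
    · simp only [h, dif_neg, not_false_eq_true]
      fun_prop
  have h := (hind.comp (hf.comp (hext S)) (hg.comp (hext T))).integral_fun_mul_eq_mul_integral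
    (Measurable.aestronglyMeasurable ((hf.comp (hext S)).comp (by fun_prop)))
    (Measurable.aestronglyMeasurable ((hg.comp (hext T)).comp (by fun_prop)))
  have h1 : ∀ φ : Fin p → E, f (fun s => if s ∈ S then φ s else 0) = f φ := fun φ =>
    hfS _ _ fun s hs => if_pos hs
  have h2 : ∀ φ : Fin p → E, g (fun s => if s ∈ T then φ s else 0) = g φ := fun φ =>
    hgT _ _ fun s hs => if_pos hs
  simpa [Function.comp_def, h1, h2] using h

lemma wordMat_congr {φ ψ : Fin p → LocalSpace d} {w : List (Fin p)} (h : ∀ s ∈ w, φ s = ψ s) :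
    wordMat φ w = wordMat ψ w := by
  rw [wordMat, wordMat]
  congr 1
  exact List.map_congr_left fun s hs => by rw [h s hs]

/-- The expectation of a word in projections on independent uniform unit vectors. -/
noncomputable def expWord (d : ℕ) (w : List (Fin p)) : Matrix (Fin d) (Fin d) ℂ :=
  Matrix.of fun a b => ∫ φ : Fin p → LocalSpace d, wordMat φ w a b
    ∂(Measure.pi fun _ => uniformUnitVector d)

lemma trace_expWord (hd : 0 < d) (w : List (Fin p)) : (expWord d w).trace = sphereWord d w := by
  rw [← integral_trace_wordMat_uniform hd]
  simp_rw [Matrix.trace, Matrix.diag]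
  rw [integral_finsetSum _ fun a _ => integrable_wordMat_uniform hd w a a]
  rfl

lemma expWord_nil (hd : 0 < d) : expWord d ([] : List (Fin p)) = 1 := by
  have := isProbabilityMeasure_uniformUnitVector hd
  ext a b
  simp [expWord, wordMat]

lemma expWord_singleton (hd : 0 < d) (s : Fin p) :
    expWord d [s] = (d : ℂ)⁻¹ • (1 : Matrix (Fin d) (Fin d) ℂ) := by
  have := isProbabilityMeasure_uniformUnitVector hd
  have hs := isProbabilityMeasure_sphereLaw hd
  ext a b
  have h1 : (Measure.pi fun _ : Fin p => uniformUnitVector d).map (fun φ => φ s) =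
      uniformUnitVector d :=
    (measurePreserving_eval (fun _ : Fin p => uniformUnitVector d) s).map_eq
  have h2 := integral_map (μ := Measure.pi fun _ : Fin p => uniformUnitVector d)
    (measurable_pi_apply s).aemeasurable (f := fun v : LocalSpace d => v a * starRingEnd ℂ (v b))
    (Continuous.aestronglyMeasurable (by fun_prop))
  have h3 := integral_map (μ := sphereLaw d) measurable_subtype_coe.aemeasurable
    (f := fun v : LocalSpace d => v a * starRingEnd ℂ (v b))
    (Continuous.aestronglyMeasurable (by fun_prop))
  rw [h1, ← map_coe_sphereLaw, h3, integral_coord_mul_conj hd, map_coe_sphereLaw] at h2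
  have h4 : ∀ φ : Fin p → LocalSpace d, wordMat φ [s] a b = φ s a * starRingEnd ℂ (φ s b) := by
    intro φ
    simp [wordMat, rankOneMat]
  rw [expWord, Matrix.of_apply]
  simp_rw [h4]
  rw [← h2, Matrix.smul_apply, Matrix.one_apply]
  simp

/-- The letters of `v` occur nowhere else, so they can be averaged independently, which replaces `v`
by the scalar `c`. -/
lemma expWord_append_eq_of_disjoint (hd : 0 < d) {v w : List (Fin p)} (hvw : v.Disjoint w) {c : ℂ}
    (hv : expWord d v = c • 1) (u : List (Fin p)) (hu : v.Disjoint u) :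
    expWord d (u ++ (v ++ w)) = c • expWord d (u ++ w) := by
  have := isProbabilityMeasure_uniformUnitVector hd
  ext a b
  have hm : ∀ (x : List (Fin p)) i j, Measurable fun φ : Fin p → LocalSpace d => wordMat φ x i j :=
    fun x i j => (continuous_wordMat_apply x i j).measurable
  have happ : ∀ (φ : Fin p → LocalSpace d) (x y : List (Fin p)),
      wordMat φ (x ++ y) = wordMat φ x * wordMat φ y := fun φ x y => by simp [wordMat]
  have h1 : ∀ φ : Fin p → LocalSpace d, wordMat φ (u ++ (v ++ w)) a b =
      ∑ j, ∑ i, wordMat φ v i j * (wordMat φ u a i * wordMat φ w j b) := by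
    intro φ
    rw [happ, happ, Matrix.mul_apply, Finset.sum_comm]
    refine Finset.sum_congr rfl fun i _ => ?_
    rw [Matrix.mul_apply, Finset.mul_sum]
    exact Finset.sum_congr rfl fun j _ => by ring
  have hbd : ∀ (x y : List (Fin p)) i j i' j', Integrable (fun φ : Fin p → LocalSpace d =>
      wordMat φ x i j * wordMat φ y i' j') (Measure.pi fun _ => uniformUnitVector d) := by
    intro x y i j i' j'
    refine (integrable_wordMat_uniform hd y i' j').bdd_mul (hm x i j).aestronglyMeasurable
      (c := (d : ℝ) ^ x.length) ?_
    filter_upwards [ae_norm_pi_uniformUnitVector d] with φ hφ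
    exact norm_wordMat_apply_le φ hφ x i j
  have hbd3 : ∀ i j, Integrable (fun φ : Fin p → LocalSpace d => wordMat φ v i j *
      (wordMat φ u a i * wordMat φ w j b)) (Measure.pi fun _ => uniformUnitVector d) := by
    intro i j
    refine (hbd u w a i j b).bdd_mul (hm v i j).aestronglyMeasurable
      (c := (d : ℝ) ^ v.length) ?_
    filter_upwards [ae_norm_pi_uniformUnitVector d] with φ hφ
    exact norm_wordMat_apply_le φ hφ v i j
  have hind : ∀ i j, ∫ φ : Fin p → LocalSpace d, wordMat φ v i j *
      (wordMat φ u a i * wordMat φ w j b) ∂(Measure.pi fun _ => uniformUnitVector d) =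
      expWord d v i j * ∫ φ : Fin p → LocalSpace d, wordMat φ u a i * wordMat φ w j b
        ∂(Measure.pi fun _ => uniformUnitVector d) := by
    intro i j
    refine integral_mul_of_disjoint (S := v.toFinset) (T := u.toFinset ∪ w.toFinset)
      (hm v i j) ((hm u a i).mul (hm w j b)) ?_ ?_ ?_
    · rw [Finset.disjoint_left]
      intro t ht ht'
      rw [List.mem_toFinset] at ht
      rcases Finset.mem_union.1 ht' with h | h
      · exact hu ht (by simpa using h)
      · exact hvw ht (by simpa using h)
    · intro φ ψ h
      rw [wordMat_congr fun s hs => h s (by simpa using hs)]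
    · intro φ ψ h
      rw [wordMat_congr (w := u) fun s hs => h s (by simp [hs]),
        wordMat_congr (w := w) fun s hs => h s (by simp [hs])]
  rw [expWord, Matrix.of_apply]
  simp_rw [h1]
  rw [integral_finsetSum _ fun j _ => integrable_finsetSum _ fun i _ => hbd3 i j]
  simp_rw [integral_finsetSum _ fun i _ => hbd3 i _, hind, hv, Matrix.smul_apply, Matrix.one_apply]
  simp only [smul_eq_mul, mul_ite, mul_one, mul_zero, ite_mul, zero_mul, Finset.sum_ite_eq',
    Finset.mem_univ, if_true]
  rw [← Finset.mul_sum, ← integral_finsetSum _ fun j _ => hbd u w a j j b, expWord, Matrix.of_apply]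
  congr 2
  ext φ
  rw [happ, Matrix.mul_apply]

/-- The rank one matrix of a unit vector is idempotent. This closes a loop after its interior has
been averaged to a scalar, and is the reason to work with the normalized ensemble here. -/
lemma expWord_cons_cons_self (s : Fin p) (w : List (Fin p)) :
    expWord d (s :: s :: w) = expWord d (s :: w) := by
  ext a b
  rw [expWord, expWord, Matrix.of_apply, Matrix.of_apply]
  refine integral_congr_ae ?_
  filter_upwards [ae_norm_pi_uniformUnitVector d] with φ hφ
  have h : rankOneMat (φ s) * rankOneMat (φ s) = rankOneMat (φ s) := by
    have h1 : ∑ c, starRingEnd ℂ (φ s c) * φ s c = 1 := by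
      have h2 := EuclideanSpace.norm_sq_eq (φ s)
      rw [hφ s] at h2
      simp_rw [Complex.conj_mul']
      exact_mod_cast h2.symm.trans (by norm_num)
    ext a b
    rw [Matrix.mul_apply]
    simp only [rankOneMat, Matrix.of_apply]
    calc _ = φ s a * (∑ c, starRingEnd ℂ (φ s c) * φ s c) * starRingEnd ℂ (φ s b) := by
          rw [Finset.mul_sum, Finset.sum_mul]
          exact Finset.sum_congr rfl fun c _ => by ring
      _ = _ := by rw [h1, mul_one]
  simp only [wordMat, List.map_cons, List.prod_cons, ← mul_assoc, h]

/-- The normalized weight of a word whose expectation is a multiple of the identity; other words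
have weight zero. -/
noncomputable def scalarWeight (d k : ℕ) (w : List (Fin p)) : ℝ :=
  open Classical in
  if ∃ c : ℂ, expWord d w = c • 1 then (sphereWord d w / d) ^ k else 0

lemma eq_of_expWord_eq (hd : 0 < d) {w : List (Fin p)} {c : ℂ} (h : expWord d w = c • 1) :
    c = (sphereWord d w / d : ℝ) := by
  have h2 := trace_expWord hd w
  have hd' : (d : ℂ) ≠ 0 := by exact_mod_cast hd.ne'
  rw [h, Matrix.trace_smul, Matrix.trace_one, Fintype.card_fin, smul_eq_mul] at h2
  push_cast
  rw [← h2]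
  field_simp

lemma scalarWeight_of_eq (hd : 0 < d) (k : ℕ) {w : List (Fin p)} {c : ℝ}
    (h : expWord d w = (c : ℂ) • 1) : scalarWeight d k w = c ^ k := by
  rw [scalarWeight, if_pos ⟨_, h⟩]
  congr 1
  exact_mod_cast (eq_of_expWord_eq hd h).symm

lemma scalarWeight_nonneg (hd : 0 < d) (k : ℕ) (w : List (Fin p)) : 0 ≤ scalarWeight d k w := by
  have := sphereWord_nonneg hd w
  rw [scalarWeight]
  split_ifs <;> positivity

lemma scalarWeight_le (hd : 0 < d) (k : ℕ) (w : List (Fin p)) :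
    d ^ k * scalarWeight d k w ≤ sphereWord d w ^ k := by
  have := sphereWord_nonneg hd w
  have hd' : (0 : ℝ) < d := by exact_mod_cast hd
  rw [scalarWeight]
  split_ifs
  · rw [div_pow, mul_div_cancel₀ _ (by positivity)]
  · rw [mul_zero]
    positivity

/-- The scalar weights satisfy the axioms of `weightedCatalan_le_wordSum` with `N = d ^ k`: a new
letter averages to `1 / d` in each factor, and the interior of a loop can be pulled out as a scalar.
Words that are not scalar are discarded, their contribution being nonnegative. -/
lemma weightedCatalan_le_sum_sphereWord (hd : 0 < d) (k : ℕ) {x : ℝ} (hx : 0 ≤ x) {n : ℕ}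
    (hp : (d : ℝ) ^ k * x + (n + 1 : ℕ) ≤ p) :
    (d : ℝ) ^ k * (x * weightedCatalan x n) ≤
      ∑ w : Fin (n + 1) → Fin p, sphereWord d (List.ofFn w) ^ k := by
  have hd' : (0 : ℝ) < d := by exact_mod_cast hd
  have hscalar : ∀ w : List (Fin p), (∃ c : ℝ, expWord d w = (c : ℂ) • 1) ∨
      scalarWeight d k w = 0 := by
    intro w
    by_cases h : ∃ c : ℂ, expWord d w = c • 1
    · obtain ⟨c, hc⟩ := h
      exact Or.inl ⟨_, (eq_of_expWord_eq hd hc) ▸ hc⟩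
    · exact Or.inr (if_neg h)
  have h := (weightedCatalan_le_wordSum (g := scalarWeight (p := p) d k) (N := (d : ℝ) ^ k) (x := x)
    (by positivity) hx (scalarWeight_nonneg hd k) ?_ ?_ ?_ (n + 1)).2 Finset.univ (by simpa using hp)
  · rw [if_neg n.succ_ne_zero, Nat.add_sub_cancel] at h
    rw [sum_ofFn_eq_wordSum _ fun w => sphereWord d w ^ k]
    calc _ ≤ (d : ℝ) ^ k * wordSum Finset.univ (n + 1) (scalarWeight (p := p) d k) := by gcongr
      _ = wordSum Finset.univ (n + 1) fun w => (d : ℝ) ^ k * scalarWeight d k w :=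
          (wordSum_const_mul _ _ _ _).symm
      _ ≤ _ := wordSum_le_wordSum fun w _ _ => scalarWeight_le hd k w
  · rw [scalarWeight_of_eq hd k (c := 1) (by simp [expWord_nil hd])]
    simp
  · intro s w hs
    rcases hscalar w with ⟨c, hc⟩ | h0
    · have h1 := expWord_append_eq_of_disjoint hd (v := [s]) (w := w) (by simpa using hs)
        (expWord_singleton hd s) [] (by simp)
      have h2 : expWord d (s :: w) = (((d : ℝ)⁻¹ * c : ℝ) : ℂ) • 1 := by
        simp only [List.nil_append, List.singleton_append] at h1
        rw [h1, hc, smul_smul]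
        push_cast
        rfl
      rw [scalarWeight_of_eq hd k hc, scalarWeight_of_eq hd k h2, mul_pow, inv_pow]
    · rw [h0, mul_zero]
      exact scalarWeight_nonneg hd k _
  · intro s v w hsv hvw
    rcases hscalar v with ⟨c, hc⟩ | h0
    · rcases hscalar (s :: w) with ⟨c', hc'⟩ | h0
      · have h1 := expWord_append_eq_of_disjoint hd (v := v) (w := s :: w) (by
          intro t ht ht'
          rcases List.mem_cons.1 ht' with rfl | h
          · exact hsv ht
          · exact hvw ht h) hc [s] (by
          intro t ht ht'
          rw [List.mem_singleton] at ht'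
          exact hsv (ht' ▸ ht))
        have h2 : expWord d (s :: v ++ s :: w) = ((c * c' : ℝ) : ℂ) • 1 := by
          simp only [List.singleton_append] at h1
          rw [List.cons_append, h1, expWord_cons_cons_self, hc', smul_smul]
          push_cast
          rfl
        rw [scalarWeight_of_eq hd k hc, scalarWeight_of_eq hd k hc', scalarWeight_of_eq hd k h2,
          mul_pow]
      · rw [h0, mul_zero]
        exact scalarWeight_nonneg hd k _
    · rw [h0, zero_mul]
      exact scalarWeight_nonneg hd k _

end Independence

/-- This is the reduction to one tensor factor: `k` of the `k + 1` powers are replaced by the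
penalty `d ^ (-k)` per distinct letter, and the penalty by a smaller alphabet. -/
lemma sum_sphereWord_pow_le {d : ℕ} (hd : 0 < d) (k : ℕ) {p p' m : ℕ}
    (hp : (p : ℝ) ≤ d ^ k * (p' - m)) :
    ∑ w : Fin m → Fin p, sphereWord d (List.ofFn w) ^ (k + 1) ≤
      d ^ k * ∑ w : Fin m → Fin p', gaussianWord d (List.ofFn w) := by
  have hd' : (0 : ℝ) < d := by exact_mod_cast hd
  set f : List (Fin (p + p')) → ℝ := sphereWord d with hf
  have hpow : ∀ w : List (Fin (p + p')), f w ^ (k + 1) ≤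
      d ^ k * (((d : ℝ) ^ k)⁻¹ ^ w.toFinset.card * f w) := by
    intro w
    have h0 := sphereWord_nonneg hd w
    have h1 := sphereWord_mul_pow_le hd w
    rw [pow_succ, ← mul_assoc]
    refine mul_le_mul_of_nonneg_right ?_ h0
    have h2 : f w ≤ d * ((d : ℝ)⁻¹) ^ w.toFinset.card := by
      rw [inv_pow, ← div_eq_mul_inv, le_div_iff₀ (by positivity)]
      exact h1
    calc f w ^ k ≤ (d * ((d : ℝ)⁻¹) ^ w.toFinset.card) ^ k := by gcongr
      _ = _ := by
        rw [mul_pow, ← pow_mul, ← inv_pow, ← pow_mul, mul_comm k]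
  -- Both alphabets are embedded in `Fin (p + p')`, so that permutations can carry letters of one to
  -- the other.
  have key := wordSum_pattern_le (f := f) (fun w => sphereWord_nonneg hd w)
    (fun σ w => sphereWord_map hd σ.injective w) (c := (d : ℝ) ^ k) (by positivity)
    (Finset.univ.map (Fin.castAddEmb p' : Fin p ↪ Fin (p + p')))
    (Finset.univ.map (Fin.natAddEmb p : Fin p' ↪ Fin (p + p'))) m [] 1 (by simp) (by simpa using hp)
  simp only [List.nil_append, List.toFinset_nil, Finset.card_empty, pow_zero, one_mul,
    List.map_nil] at key
  rw [wordSum_map, wordSum_map] at key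
  rw [sum_ofFn_eq_wordSum m fun w : List (Fin p) => sphereWord d w ^ (k + 1),
    sum_ofFn_eq_wordSum m fun w : List (Fin p') => gaussianWord d w]
  calc _ ≤ wordSum Finset.univ m fun w : List (Fin p) =>
        d ^ k * (((d : ℝ) ^ k)⁻¹ ^ (w.map (Fin.castAddEmb p')).toFinset.card *
          f (w.map (Fin.castAddEmb p'))) := by
        refine wordSum_le_wordSum fun w _ _ => ?_
        rw [← sphereWord_map hd (Fin.castAddEmb p' : Fin p ↪ Fin (p + p')).injective w]
        exact hpow _
    _ ≤ d ^ k * wordSum Finset.univ m fun w : List (Fin p') => f (w.map (Fin.natAddEmb p)) := by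
        rw [wordSum_const_mul]
        gcongr
    _ ≤ _ := by
        refine mul_le_mul_of_nonneg_left (wordSum_le_wordSum fun w _ _ => ?_) (by positivity)
        rw [hf, sphereWord_map hd (Fin.natAddEmb p : Fin p' ↪ Fin (p + p')).injective w]
        exact sphereWord_le_gaussianWord hd w

/-! ### Trace moments and the operator norm. -/

section Matrices

open scoped ComplexOrder

variable {ι : Type*} [Fintype ι] [DecidableEq ι] {A : Matrix ι ι ℂ}

/-- The real part of the trace of the `n`-th power. -/
noncomputable def traceMoment (A : Matrix ι ι ℂ) (n : ℕ) : ℝ := (A ^ n).trace.re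

lemma trace_pow_eq_sum_eigenvalues (hA : A.IsHermitian) (n : ℕ) :
    (A ^ n).trace = ((∑ i, hA.eigenvalues i ^ n : ℝ) : ℂ) := by
  conv_lhs => rw [hA.spectral_theorem]
  rw [← map_pow, Unitary.conjStarAlgAut_apply, Matrix.trace_mul_comm, ← mul_assoc,
    Unitary.coe_star_mul_self, one_mul, Matrix.diagonal_pow, Matrix.trace_diagonal]
  simp

lemma traceMoment_eq (hA : A.IsHermitian) (n : ℕ) :
    traceMoment A n = ∑ i, hA.eigenvalues i ^ n := by
  rw [traceMoment, trace_pow_eq_sum_eigenvalues hA, Complex.ofReal_re]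

lemma trace_pow_eq_traceMoment (hA : A.IsHermitian) (n : ℕ) :
    (A ^ n).trace = (traceMoment A n : ℂ) := by
  rw [traceMoment_eq hA, trace_pow_eq_sum_eigenvalues hA]

open scoped Matrix.Norms.L2Operator in
lemma opNorm_eq_norm_eigenvalues (hA : A.IsHermitian) : opNorm A = ‖hA.eigenvalues‖ := by
  have h : opNorm A = ‖A‖ := rfl
  rw [h]
  conv_lhs => rw [hA.spectral_theorem]
  rw [Unitary.conjStarAlgAut_apply, ← Unitary.coe_star, CStarRing.norm_mul_coe_unitary, CStarRing.norm_coe_unitary_mul,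
    Matrix.l2_opNorm_diagonal]
  simp [Pi.norm_def]

lemma opNorm_nonneg (A : Matrix ι ι ℂ) : 0 ≤ opNorm A := norm_nonneg _

lemma traceMoment_nonneg (hA : A.PosSemidef) (n : ℕ) : 0 ≤ traceMoment A n := by
  rw [traceMoment_eq hA.1]
  exact Finset.sum_nonneg fun i _ => pow_nonneg (hA.eigenvalues_nonneg i) n

lemma eigenvalues_le_opNorm (hA : A.PosSemidef) (i : ι) : hA.1.eigenvalues i ≤ opNorm A := by
  rw [opNorm_eq_norm_eigenvalues hA.1]
  exact (Real.le_norm_self _).trans (norm_le_pi_norm hA.1.eigenvalues i)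

lemma traceMoment_le (hA : A.PosSemidef) (n : ℕ) :
    traceMoment A n ≤ Fintype.card ι * opNorm A ^ n := by
  rw [traceMoment_eq hA.1, ← nsmul_eq_mul, ← Finset.card_univ, ← Finset.sum_const]
  exact Finset.sum_le_sum fun i _ => pow_le_pow_left₀ (hA.eigenvalues_nonneg i)
    (eigenvalues_le_opNorm hA i) n

lemma eigenvalues_pow_le_traceMoment (hA : A.PosSemidef) (i : ι) (n : ℕ) :
    hA.1.eigenvalues i ^ n ≤ traceMoment A n := by
  rw [traceMoment_eq hA.1]
  exact Finset.single_le_sum (f := fun i => hA.1.eigenvalues i ^ n)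
    (fun i _ => pow_nonneg (hA.eigenvalues_nonneg i) n) (Finset.mem_univ i)

lemma opNorm_pow_le_traceMoment (hA : A.PosSemidef) {n : ℕ} (hn : n ≠ 0) :
    opNorm A ^ n ≤ traceMoment A n := by
  rcases isEmpty_or_nonempty ι with h | h
  · rw [opNorm_eq_norm_eigenvalues hA.1, traceMoment_eq hA.1]
    simp [Pi.norm_def, hn]
  · obtain ⟨i, hi⟩ := Finite.exists_max hA.1.eigenvalues
    have h1 : opNorm A ≤ hA.1.eigenvalues i := by
      rw [opNorm_eq_norm_eigenvalues hA.1]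
      refine (pi_norm_le_iff_of_nonneg (hA.eigenvalues_nonneg i)).2 fun j => ?_
      rw [Real.norm_of_nonneg (hA.eigenvalues_nonneg j)]
      exact hi j
    exact (pow_le_pow_left₀ (opNorm_nonneg A) h1 n).trans (eigenvalues_pow_le_traceMoment hA i n)

/-- Splitting off the `m`-th power, the remaining factor `λ ^ (m - 1)` is at most one or at most `λ
^ m`. This lets the gradient of a moment be bounded by the moment itself. -/
lemma traceMoment_two_mul_sub_one_le (hA : A.PosSemidef) (m : ℕ) :
    traceMoment A (2 * m - 1) ≤ (1 + traceMoment A m) * traceMoment A m := by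
  conv_lhs => rw [traceMoment_eq hA.1]
  conv_rhs => enter [2]; rw [traceMoment_eq hA.1]
  rw [Finset.mul_sum]
  refine Finset.sum_le_sum fun i _ => ?_
  have h0 := hA.eigenvalues_nonneg i
  have h1 := eigenvalues_pow_le_traceMoment hA i m
  rw [show 2 * m - 1 = (m - 1) + m by omega, pow_add]
  refine mul_le_mul_of_nonneg_right ?_ (pow_nonneg h0 m)
  rcases le_total (hA.1.eigenvalues i) 1 with h | h
  · exact (pow_le_one₀ h0 h).trans (by linarith [traceMoment_nonneg hA m])
  · exact (pow_le_pow_right₀ h (Nat.sub_le m 1)).trans (by linarith)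

end Matrices

section TensorSum

open scoped ComplexOrder

variable {d p k : ℕ}

lemma posSemidef_tensorSum (φ : Fin p → Fin k → LocalSpace d) : (tensorSum φ).PosSemidef :=
  Matrix.posSemidef_sum _ fun _ _ => Matrix.posSemidef_vecMulVec_self_star _

lemma norm_toLp_productVector (v : Fin k → LocalSpace d) :
    ‖(WithLp.toLp 2 (productVector v) : EuclideanSpace ℂ (Fin k → Fin d))‖ = ∏ i, ‖v i‖ := by
  rw [← Real.sqrt_sq (norm_nonneg (WithLp.toLp 2 (productVector v))),
    ← Real.sqrt_sq (Finset.prod_nonneg fun i _ => norm_nonneg (v i)), EuclideanSpace.norm_sq_eq,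
    ← Finset.prod_pow]
  simp_rw [EuclideanSpace.norm_sq_eq]
  rw [Finset.prod_univ_sum, Fintype.piFinset_univ]
  simp [productVector, Finset.prod_pow]

lemma continuous_tensorSum :
    Continuous (tensorSum : (Fin p → Fin k → LocalSpace d) → _) := by
  refine continuous_matrix fun i j => ?_
  simp only [tensorSum, Matrix.sum_apply, Matrix.vecMulVec_apply, productVector, Pi.star_apply,
    star_prod]
  fun_prop

lemma continuous_opNorm_tensorSum :
    Continuous fun φ : Fin p → Fin k → LocalSpace d => opNorm (tensorSum φ) := by
  have h : Continuous (Matrix.toEuclideanCLM (n := Fin k → Fin d) (𝕜 := ℂ)) :=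
    LinearMap.continuous_of_finiteDimensional
      (Matrix.toEuclideanCLM (n := Fin k → Fin d) (𝕜 := ℂ)).toAlgEquiv.toLinearMap
  exact (h.comp continuous_tensorSum).norm

lemma continuous_traceMoment_tensorSum (n : ℕ) :
    Continuous fun φ : Fin p → Fin k → LocalSpace d => traceMoment (tensorSum φ) n :=
  Complex.continuous_re.comp (continuous_tensorSum.pow n).matrix_trace

lemma integral_traceMoment {ν : Measure (Fin p → Fin k → LocalSpace d)} {n : ℕ} {c : ℝ}
    (h : Integrable (fun φ => (tensorSum φ ^ n).trace) ν ∧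
      ∫ φ, (tensorSum φ ^ n).trace ∂ν = (c : ℂ)) :
    Integrable (fun φ => traceMoment (tensorSum φ) n) ν ∧
      ∫ φ, traceMoment (tensorSum φ) n ∂ν = c := by
  refine ⟨h.1.re, ?_⟩
  have h2 := h.2
  have h3 : ∀ φ : Fin p → Fin k → LocalSpace d, (tensorSum φ ^ n).trace =
      (traceMoment (tensorSum φ) n : ℂ) := fun φ =>
    trace_pow_eq_traceMoment (posSemidef_tensorSum φ).1 n
  simp_rw [h3] at h2
  rw [integral_complex_ofReal] at h2
  exact_mod_cast h2

lemma integrable_opNorm_pow {ν : Measure (Fin p → Fin k → LocalSpace d)} {n : ℕ} (hn : n ≠ 0)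
    (h : Integrable (fun φ => traceMoment (tensorSum φ) n) ν) :
    Integrable (fun φ => opNorm (tensorSum φ) ^ n) ν :=
  h.mono' (continuous_opNorm_tensorSum.pow n).aestronglyMeasurable
    (Filter.Eventually.of_forall fun φ => by
      rw [Real.norm_of_nonneg (pow_nonneg (opNorm_nonneg _) _)]
      exact opNorm_pow_le_traceMoment (posSemidef_tensorSum φ) hn)

lemma integrable_opNorm_normalizedEnsemble (hd : 0 < d) :
    Integrable (fun φ => opNorm (tensorSum φ)) (normalizedEnsemble p d k) := by
  simpa using integrable_opNorm_pow one_ne_zero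
    (integral_traceMoment (integral_trace_normalizedEnsemble hd 1)).1

lemma integrable_opNorm_gaussianEnsemble (hd : 0 < d) :
    Integrable (fun φ => opNorm (tensorSum φ)) (gaussianEnsemble p d k) := by
  simpa using integrable_opNorm_pow one_ne_zero
    (integral_traceMoment (integral_trace_gaussianEnsemble hd 1)).1

/-- The quadratic form at one of the product vectors is at least its own contribution, which is one.
-/
lemma one_le_opNorm_tensorSum (hp : 0 < p) (φ : Fin p → Fin k → LocalSpace d)
    (hφ : ∀ s i, ‖φ s i‖ = 1) : 1 ≤ opNorm (tensorSum φ) := by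
  set s : Fin p := ⟨0, hp⟩
  set v : EuclideanSpace ℂ (Fin k → Fin d) := WithLp.toLp 2 (productVector (φ s)) with hv
  have hv1 : ‖v‖ = 1 := by
    rw [hv, norm_toLp_productVector]
    simp [hφ]
  have h1 : ‖inner ℂ v (Matrix.toEuclideanCLM (n := Fin k → Fin d) (𝕜 := ℂ) (tensorSum φ) v)‖ ≤
      opNorm (tensorSum φ) := by
    refine (norm_inner_le_norm _ _).trans ?_
    rw [hv1, one_mul]
    refine (ContinuousLinearMap.le_opNorm _ _).trans_eq ?_
    rw [hv1, mul_one]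
    rfl
  refine le_trans ?_ h1
  have h2 : inner ℂ v (Matrix.toEuclideanCLM (n := Fin k → Fin d) (𝕜 := ℂ) (tensorSum φ) v) =
      ∑ t, ((‖inner ℂ (WithLp.toLp 2 (productVector (φ t)) : EuclideanSpace ℂ (Fin k → Fin d)) v‖ ^ 2
        : ℝ) : ℂ) := by
    rw [tensorSum, map_sum, sum_apply, inner_sum]
    refine Finset.sum_congr rfl fun t _ => ?_
    have h3 : Matrix.toEuclideanCLM (n := Fin k → Fin d) (𝕜 := ℂ)
        (Matrix.vecMulVec (productVector (φ t)) (star (productVector (φ t)))) v =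
        inner ℂ (WithLp.toLp 2 (productVector (φ t)) : EuclideanSpace ℂ (Fin k → Fin d)) v •
          WithLp.toLp 2 (productVector (φ t)) := by
      ext j
      rw [Matrix.ofLp_toEuclideanCLM, Matrix.vecMulVec_mulVec]
      simp [EuclideanSpace.inner_eq_star_dotProduct, dotProduct_comm, mul_comm]
    rw [h3, inner_smul_right, ← inner_conj_symm v, Complex.mul_conj, Complex.normSq_eq_norm_sq]
  rw [h2, ← Complex.ofReal_sum, Complex.norm_real]
  refine le_trans ?_ (Real.le_norm_self _)
  refine le_trans ?_ (Finset.single_le_sum (fun t _ => sq_nonneg _) (Finset.mem_univ s))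
  rw [← hv, inner_self_eq_norm_sq_to_K, hv1]
  simp

end TensorSum

/-! ### The Gaussian Poincaré inequality by rotation. -/

section Poincare

lemma sq_intervalIntegral_le {c : ℝ} (hc : 0 < c) {h : ℝ → ℝ} (hh : Continuous h) :
    (∫ t in (0 : ℝ)..c, h t) ^ 2 ≤ c * ∫ t in (0 : ℝ)..c, h t ^ 2 := by
  set I := ∫ t in (0 : ℝ)..c, h t with hI
  have h1 : 0 ≤ ∫ t in (0 : ℝ)..c, (h t - I / c) ^ 2 :=
    intervalIntegral.integral_nonneg hc.le fun t _ => sq_nonneg _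
  have h2 : ∫ t in (0 : ℝ)..c, (h t - I / c) ^ 2 =
      (∫ t in (0 : ℝ)..c, h t ^ 2) - 2 * (I / c) * I + c * (I / c) ^ 2 := by
    have h3 : ∀ t, (h t - I / c) ^ 2 = h t ^ 2 - 2 * (I / c) * h t + (I / c) ^ 2 := fun t => by ring
    simp_rw [h3]
    rw [intervalIntegral.integral_add (f := fun t => h t ^ 2 - 2 * (I / c) * h t)
      (Continuous.intervalIntegrable (by fun_prop) _ _) (by simp),
      intervalIntegral.integral_sub (Continuous.intervalIntegrable (by fun_prop) _ _)
      (Continuous.intervalIntegrable (by fun_prop) _ _), intervalIntegral.integral_const_mul, intervalIntegral.integral_const, ← hI, sub_zero,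
      smul_eq_mul]
  rw [h2] at h1
  have h4 : 2 * (I / c) * I - c * (I / c) ^ 2 = I ^ 2 / c := by
    field_simp
    ring
  have h5 : I ^ 2 / c ≤ ∫ t in (0 : ℝ)..c, h t ^ 2 := by linarith
  rw [div_le_iff₀ hc] at h5
  linarith

variable {E : Type*} [NormedAddCommGroup E] [NormedSpace ℝ E]

/-- The two points are joined by the arc `cos t • x + sin t • y`, whose velocity is the second
component of the rotated pair; Cauchy-Schwarz in `t` finishes. -/
lemma sub_sq_le_rotation {G : E → ℝ} (hG : ContDiff ℝ 1 G) (q : E × E) :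
    (G q.1 - G q.2) ^ 2 ≤ Real.pi / 2 * ∫ t in (0 : ℝ)..(Real.pi / 2),
      (fderiv ℝ G (ContinuousLinearMap.rotation t q).1 (ContinuousLinearMap.rotation t q).2) ^ 2 := by
  have hfd : Continuous (fderiv ℝ G) := hG.continuous_fderiv one_ne_zero
  have hcont : Continuous fun t : ℝ =>
      fderiv ℝ G (ContinuousLinearMap.rotation t q).1 (ContinuousLinearMap.rotation t q).2 := by
    simp only [ContinuousLinearMap.rotation_apply]
    fun_prop
  have hderiv : ∀ t : ℝ, HasDerivAt (fun t => G (ContinuousLinearMap.rotation t q).1)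
      (fderiv ℝ G (ContinuousLinearMap.rotation t q).1 (ContinuousLinearMap.rotation t q).2) t := by
    intro t
    simp only [ContinuousLinearMap.rotation_apply]
    have h1 : HasDerivAt (fun t : ℝ => Real.cos t • q.1 + Real.sin t • q.2)
        (-Real.sin t • q.1 + Real.cos t • q.2) t :=
      ((Real.hasDerivAt_cos t).smul_const q.1).add ((Real.hasDerivAt_sin t).smul_const q.2)
    exact ((hG.differentiable one_ne_zero).differentiableAt.hasFDerivAt).comp_hasDerivAt t h1
  have h2 := intervalIntegral.integral_eq_sub_of_hasDerivAt (a := 0) (b := Real.pi / 2)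
    (fun t _ => hderiv t) (hcont.intervalIntegrable _ _)
  simp only [ContinuousLinearMap.rotation_apply, Real.cos_pi_div_two, Real.sin_pi_div_two,
    Real.cos_zero, Real.sin_zero, zero_smul, one_smul, zero_add, add_zero] at h2
  have h3 := sq_intervalIntegral_le (by positivity : 0 < Real.pi / 2) hcont
  simp only [ContinuousLinearMap.rotation_apply] at h3 ⊢
  rw [h2] at h3
  rwa [← neg_sub, neg_sq]

variable [FiniteDimensional ℝ E] [MeasurableSpace E] [BorelSpace E]

/-- The Gaussian Poincaré inequality, in symmetrized form and with a non-optimal constant. -/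
lemma lintegral_sub_sq_le {μ : Measure E} [IsGaussian μ] (hμ : ∀ L : StrongDual ℝ E, μ[L] = 0)
    {G : E → ℝ} (hG : ContDiff ℝ 1 G) :
    ∫⁻ q, ENNReal.ofReal ((G q.1 - G q.2) ^ 2) ∂(μ.prod μ) ≤
      ENNReal.ofReal ((Real.pi / 2) ^ 2) *
        ∫⁻ q, ENNReal.ofReal ((fderiv ℝ G q.1 q.2) ^ 2) ∂(μ.prod μ) := by
  have := FiniteDimensional.complete ℝ E
  have := FiniteDimensional.proper ℝ E
  have : SecondCountableTopology E := inferInstance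
  have hfd : Continuous (fderiv ℝ G) := hG.continuous_fderiv one_ne_zero
  have hF : Continuous fun q : E × E => ENNReal.ofReal ((fderiv ℝ G q.1 q.2) ^ 2) :=
    ENNReal.continuous_ofReal.comp (by fun_prop)
  have hjoint : Continuous fun z : (E × E) × ℝ => ENNReal.ofReal
      ((fderiv ℝ G (ContinuousLinearMap.rotation z.2 z.1).1
        (ContinuousLinearMap.rotation z.2 z.1).2) ^ 2) := by
    refine ENNReal.continuous_ofReal.comp ?_
    simp only [ContinuousLinearMap.rotation_apply]
    fun_prop
  calc ∫⁻ q, ENNReal.ofReal ((G q.1 - G q.2) ^ 2) ∂(μ.prod μ)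
      ≤ ∫⁻ q, (ENNReal.ofReal (Real.pi / 2) * ∫⁻ t in Set.Ioc 0 (Real.pi / 2), ENNReal.ofReal
          ((fderiv ℝ G (ContinuousLinearMap.rotation t q).1
            (ContinuousLinearMap.rotation t q).2) ^ 2)) ∂(μ.prod μ) := by
        refine lintegral_mono fun q => ?_
        have hcont : Continuous fun t : ℝ => (fderiv ℝ G (ContinuousLinearMap.rotation t q).1
            (ContinuousLinearMap.rotation t q).2) ^ 2 := by
          simp only [ContinuousLinearMap.rotation_apply]
          fun_prop
        rw [← ofReal_integral_eq_lintegral_ofReal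
          (hcont.integrableOn_Icc.mono_set Set.Ioc_subset_Icc_self)
          (Filter.Eventually.of_forall fun t => sq_nonneg _),
          ← ENNReal.ofReal_mul (by positivity), ← intervalIntegral.integral_of_le (by positivity)]
        exact ENNReal.ofReal_le_ofReal (sub_sq_le_rotation hG q)
    _ = ENNReal.ofReal (Real.pi / 2) * ∫⁻ t in Set.Ioc 0 (Real.pi / 2), ∫⁻ q, ENNReal.ofReal
          ((fderiv ℝ G (ContinuousLinearMap.rotation t q).1
            (ContinuousLinearMap.rotation t q).2) ^ 2) ∂(μ.prod μ) := by
        rw [lintegral_const_mul' _ _ ENNReal.ofReal_ne_top,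
          lintegral_lintegral_swap hjoint.measurable.aemeasurable]
    _ = ENNReal.ofReal (Real.pi / 2) * ∫⁻ t in Set.Ioc 0 (Real.pi / 2),
          ∫⁻ q, ENNReal.ofReal ((fderiv ℝ G q.1 q.2) ^ 2) ∂(μ.prod μ) := by
        congr 2
        ext t
        -- A pair of independent copies of a centred Gaussian is invariant under rotation, so the
        -- integral over `q` does not depend on `t`.
        have h := IsGaussian.map_rotation_eq_self_of_forall_strongDual_eq_zero hμ t
        conv_rhs => rw [← h]
        rw [lintegral_map hF.measurable (ContinuousLinearMap.continuous _).measurable]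
    _ = _ := by
        rw [lintegral_const, Measure.restrict_apply_univ, Real.volume_Ioc, sub_zero, sq,
          ENNReal.ofReal_mul (by positivity)]
        ring

end Poincare

/-! ### Covariance of the Gaussian product ensemble. -/

section Covariance

instance (d : ℕ) : IsGaussian (gaussianVector d) := by
  unfold gaussianVector
  have h : IsGaussian (Measure.pi fun _ : Fin d => complexGaussian (1 / (2 * (d : NNReal)))) := by
    have h := iIndepFun.hasGaussianLaw
      (P := Measure.pi fun _ : Fin d => complexGaussian (1 / (2 * (d : NNReal))))
      (X := fun i φ => φ i) (fun i => by
        have h1 := (measurePreserving_eval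
          (fun _ : Fin d => complexGaussian (1 / (2 * (d : NNReal)))) i).map_eq
        exact ⟨by rw [show (fun φ : Fin d → ℂ => φ i) = Function.eval i from rfl, h1]; infer_instance⟩)
      (iIndepFun_pi (X := fun _ => id) fun _ => aemeasurable_id)
    have h2 := h.isGaussian_map
    rwa [show (fun φ : Fin d → ℂ => fun i => φ i) = id from rfl, Measure.map_id] at h2
  have h3 : (WithLp.toLp 2 : (Fin d → ℂ) → LocalSpace d) =
      (PiLp.continuousLinearEquiv 2 ℝ (fun _ : Fin d => ℂ)).symm.toContinuousLinearMap := rfl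
  rw [h3]
  infer_instance

lemma isGaussian_pi {ι E : Type*} [Fintype ι] [NormedAddCommGroup E] [NormedSpace ℝ E]
    [MeasurableSpace E] [BorelSpace E] [SecondCountableTopology E] [CompleteSpace E]
    (ν : Measure E) [IsGaussian ν] : IsGaussian (Measure.pi fun _ : ι => ν) := by
  have h := iIndepFun.hasGaussianLaw (P := Measure.pi fun _ : ι => ν)
    (X := fun i φ => φ i) (fun i => by
      have h1 := (measurePreserving_eval (fun _ : ι => ν) i).map_eq
      exact ⟨by rw [show (fun φ : ι → E => φ i) = Function.eval i from rfl, h1]; infer_instance⟩)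
    (iIndepFun_pi (X := fun _ => id) fun _ => aemeasurable_id)
  have h2 := h.isGaussian_map
  rwa [show (fun φ : ι → E => fun i => φ i) = id from rfl, Measure.map_id] at h2

lemma dual_gaussianVector {d : ℕ} (L : StrongDual ℝ (LocalSpace d)) :
    (gaussianVector d)[L] = 0 ∧ Var[L; gaussianVector d] = ‖L‖ ^ 2 / (2 * d) := by
  set w := (InnerProductSpace.toDual ℝ (LocalSpace d)).symm L with hw
  have h1 := charFun_toDual_symm_eq_charFunDual (μ := gaussianVector d) L
  rw [charFun_gaussianVector, IsGaussian.charFunDual_eq, LinearIsometryEquiv.norm_map] at h1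
  have hmean : (gaussianVector d)[L] = 0 := by
    have hneg : (gaussianVector d).map (fun v => -v) = gaussianVector d := by
      have : IsProbabilityMeasure ((gaussianVector d).map (fun v => -v)) :=
        Measure.isProbabilityMeasure_map (by fun_prop)
      apply Measure.ext_of_charFun
      ext t
      have h : charFun ((gaussianVector d).map (fun v => -v)) t = charFun (gaussianVector d) (-t) := by
        rw [charFun_apply, charFun_apply, integral_map (by fun_prop) (by fun_prop)]
        simp
      rw [h, charFun_gaussianVector, charFun_gaussianVector, norm_neg]
    have h2 : ∫ v, L v ∂gaussianVector d = -∫ v, L v ∂gaussianVector d := by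
      conv_lhs => rw [← hneg, integral_map (by fun_prop) (by fun_prop)]
      simp [integral_neg]
    linarith
  refine ⟨hmean, ?_⟩
  rw [integral_complex_ofReal, hmean] at h1
  have h2 := congrArg (fun z : ℂ => ‖z‖) h1
  simp only [Complex.norm_exp] at h2
  have h3 := Real.exp_injective h2
  have e1 : (-((‖L‖ : ℂ) ^ 2 / (4 * d))) = ((-(‖L‖ ^ 2 / (4 * d)) : ℝ) : ℂ) := by push_cast; ring
  have e2 : (((0 : ℝ) : ℂ) * Complex.I - (Var[L; gaussianVector d] : ℂ) / 2) =
      ((-(Var[L; gaussianVector d] / 2) : ℝ) : ℂ) := by push_cast; ring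
  rw [e1, e2, Complex.ofReal_re, Complex.ofReal_re] at h3
  have e3 : ‖L‖ ^ 2 / (2 * d) = 2 * (‖L‖ ^ 2 / (4 * d)) := by ring
  rw [e3]
  linarith

lemma dual_pi {ι E : Type*} [Fintype ι] [DecidableEq ι] [NormedAddCommGroup E] [NormedSpace ℝ E]
    [MeasurableSpace E] [BorelSpace E] [SecondCountableTopology E] [CompleteSpace E]
    (ν : Measure E) [IsGaussian ν] (hν : ∀ L : StrongDual ℝ E, ν[L] = 0)
    (L : StrongDual ℝ (ι → E)) :
    (Measure.pi fun _ : ι => ν)[L] = 0 ∧ Var[L; Measure.pi fun _ : ι => ν] =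
      ∑ i, Var[L.comp (.single ℝ (fun _ => E) i); ν] := by
  have hL : (L : (ι → E) → ℝ) = ∑ i, fun φ : ι → E => L.comp (.single ℝ (fun _ => E) i) (φ i) := by
    ext φ
    rw [Finset.sum_apply]
    exact (ContinuousLinearMap.sum_comp_single ℝ (fun _ => E) L φ).symm
  constructor
  · rw [hL]
    simp only [Finset.sum_apply]
    rw [integral_finsetSum]
    · refine Finset.sum_eq_zero fun i _ => ?_
      have h := integral_map (μ := Measure.pi fun _ : ι => ν) (measurable_pi_apply i).aemeasurable
        (f := L.comp (.single ℝ (fun _ => E) i))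
        (ContinuousLinearMap.continuous _).aestronglyMeasurable
      have h1 : (Measure.pi fun _ : ι => ν).map (fun φ => φ i) = ν :=
        (measurePreserving_eval (fun _ : ι => ν) i).map_eq
      rw [← h, h1]
      exact hν _
    · intro i _
      exact (measurePreserving_eval (fun _ : ι => ν) i).integrable_comp_of_integrable
        (IsGaussian.integrable_dual ν (L.comp (.single ℝ (fun _ => E) i)))
  · rw [hL]
    exact variance_sum_pi (μ := fun _ : ι => ν) fun i =>
      IsGaussian.memLp_dual ν (L.comp (.single ℝ (fun _ => E) i)) 2 (by simp)

lemma isGaussian_gaussianEnsemble (p d k : ℕ) : IsGaussian (gaussianEnsemble p d k) := by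
  have := isGaussian_pi (ι := Fin k) (gaussianVector d)
  exact isGaussian_pi _

lemma integral_dual_gaussianEnsemble {p d k : ℕ}
    (L : StrongDual ℝ (Fin p → Fin k → LocalSpace d)) : (gaussianEnsemble p d k)[L] = 0 := by
  have := isGaussian_pi (ι := Fin k) (gaussianVector d)
  exact (dual_pi _ (fun L => (dual_pi _ (fun L => (dual_gaussianVector L).1) L).1) L).1

/-- The inclusion of the vector with indices `s` and `i`. -/
noncomputable def singleVector {p d k : ℕ} (s : Fin p) (i : Fin k) :
    LocalSpace d →L[ℝ] (Fin p → Fin k → LocalSpace d) :=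
  (ContinuousLinearMap.single ℝ (fun _ => Fin k → LocalSpace d) s).comp
    (ContinuousLinearMap.single ℝ (fun _ => LocalSpace d) i)

/-- Applied to a derivative `L`, this turns the average over the second Gaussian copy into a squared
gradient, block by block. -/
lemma lintegral_dual_sq_gaussianEnsemble {p d k : ℕ}
    (L : StrongDual ℝ (Fin p → Fin k → LocalSpace d)) :
    ∫⁻ φ, ENNReal.ofReal (L φ ^ 2) ∂gaussianEnsemble p d k =
      ENNReal.ofReal (∑ s, ∑ i, ‖L.comp (singleVector s i)‖ ^ 2 / (2 * d)) := by
  have h1 := isGaussian_pi (ι := Fin k) (gaussianVector d)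
  have h2 := isGaussian_gaussianEnsemble p d k
  have hm : ∀ L : StrongDual ℝ (Fin k → LocalSpace d),
      (Measure.pi fun _ : Fin k => gaussianVector d)[L] = 0 := fun L =>
    (dual_pi _ (fun L => (dual_gaussianVector L).1) L).1
  have hvar : Var[L; gaussianEnsemble p d k] =
      ∑ s, ∑ i, ‖L.comp (singleVector s i)‖ ^ 2 / (2 * d) := by
    rw [gaussianEnsemble, iidFamily, (dual_pi _ hm L).2]
    refine Finset.sum_congr rfl fun s _ => ?_
    rw [(dual_pi _ (fun L => (dual_gaussianVector L).1) _).2]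
    refine Finset.sum_congr rfl fun i _ => ?_
    rw [(dual_gaussianVector _).2]
    rfl
  rw [← hvar, variance_of_integral_eq_zero (by fun_prop) (integral_dual_gaussianEnsemble L),
    ofReal_integral_eq_lintegral_ofReal
      (IsGaussian.memLp_dual (gaussianEnsemble p d k) L 2 (by simp)).integrable_sq
      (Filter.Eventually.of_forall fun φ => sq_nonneg _)]

end Covariance

/-! ### Derivatives of trace moments along smoothed normalizations. -/

section Derivative

variable {ι : Type*} [Fintype ι] [DecidableEq ι]

lemma hasDerivAt_matrix_pow_apply {A : ℝ → Matrix ι ι ℂ} {A' : Matrix ι ι ℂ} {t : ℝ}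
    (hA : ∀ i j, HasDerivAt (fun t => A t i j) (A' i j) t) (n : ℕ) (i j : ι) :
    HasDerivAt (fun t => (A t ^ n) i j)
      ((∑ l ∈ Finset.range n, A t ^ l * A' * A t ^ (n - 1 - l)) i j) t := by
  induction n generalizing i j with
  | zero => simpa using hasDerivAt_const t _
  | succ n ih =>
    have h1 : HasDerivAt (fun t => ∑ c, A t i c * (A t ^ n) c j)
        (∑ c, (A' i c * (A t ^ n) c j +
          A t i c * (∑ l ∈ Finset.range n, A t ^ l * A' * A t ^ (n - 1 - l)) c j)) t :=
      HasDerivAt.fun_sum fun c _ => (hA i c).mul (ih c j)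
    have h2 : (∑ c, (A' i c * (A t ^ n) c j +
          A t i c * (∑ l ∈ Finset.range n, A t ^ l * A' * A t ^ (n - 1 - l)) c j)) =
        (∑ l ∈ Finset.range (n + 1), A t ^ l * A' * A t ^ (n + 1 - 1 - l)) i j := by
      rw [Finset.sum_add_distrib, ← Matrix.mul_apply, ← Matrix.mul_apply, ← Matrix.add_apply,
        Finset.sum_range_succ', Finset.mul_sum]
      have h3 : ∀ l, A t ^ (l + 1) * A' * A t ^ (n - (l + 1)) =
          A t * (A t ^ l * A' * A t ^ (n - 1 - l)) := fun l => by
        rw [pow_succ', show n - (l + 1) = n - 1 - l by omega]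
        simp only [mul_assoc]
      simp only [pow_zero, one_mul, Nat.add_sub_cancel, Nat.sub_zero, h3]
      rw [add_comm]
    rw [h2] at h1
    refine h1.congr_of_eventuallyEq (Filter.Eventually.of_forall fun t => ?_)
    simp only
    rw [pow_succ', Matrix.mul_apply]

lemma hasDerivAt_trace_pow {A : ℝ → Matrix ι ι ℂ} {A' : Matrix ι ι ℂ} {t : ℝ}
    (hA : ∀ i j, HasDerivAt (fun t => A t i j) (A' i j) t) (n : ℕ) :
    HasDerivAt (fun t => (A t ^ n).trace) (n * (A t ^ (n - 1) * A').trace) t := by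
  have h : HasDerivAt (fun t => ∑ i, (A t ^ n) i i)
      (∑ i, (∑ l ∈ Finset.range n, A t ^ l * A' * A t ^ (n - 1 - l)) i i) t :=
    HasDerivAt.fun_sum fun i _ => hasDerivAt_matrix_pow_apply hA n i i
  have h2 : ∑ i, (∑ l ∈ Finset.range n, A t ^ l * A' * A t ^ (n - 1 - l)) i i =
      n * (A t ^ (n - 1) * A').trace := by
    change (∑ l ∈ Finset.range n, A t ^ l * A' * A t ^ (n - 1 - l)).trace = _
    rw [Matrix.trace_sum, ← nsmul_eq_mul, ← Finset.card_range n, ← Finset.sum_const,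
      Finset.card_range]
    refine Finset.sum_congr rfl fun l hl => ?_
    rw [Matrix.trace_mul_comm, ← mul_assoc, ← pow_add]
    congr 3
    have := Finset.mem_range.1 hl
    omega
  rw [h2] at h
  exact h

end Derivative

section Regularization

variable {d : ℕ}

/-- A smooth approximation of the normalization of a vector. -/
noncomputable def smoothNormalize (ε : ℝ) (v : LocalSpace d) : LocalSpace d :=
  (√(‖v‖ ^ 2 + ε ^ 2))⁻¹ • v

lemma contDiff_smoothNormalize {ε : ℝ} (hε : ε ≠ 0) :
    ContDiff ℝ 1 (smoothNormalize ε : LocalSpace d → LocalSpace d) := by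
  have h : ∀ v : LocalSpace d, ‖v‖ ^ 2 + ε ^ 2 ≠ 0 := fun v => by positivity
  refine ContDiff.smul (ContDiff.inv (ContDiff.sqrt ?_ h) fun v => ?_) contDiff_id
  · exact (contDiff_norm_sq ℝ).add contDiff_const
  · have := h v
    positivity

lemma norm_smoothNormalize_le {ε : ℝ} (v : LocalSpace d) : ‖smoothNormalize ε v‖ ≤ 1 := by
  rw [smoothNormalize, norm_smul, norm_inv, Real.norm_of_nonneg (Real.sqrt_nonneg _)]
  have h : ‖v‖ ≤ √(‖v‖ ^ 2 + ε ^ 2) := Real.le_sqrt_of_sq_le (by nlinarith [sq_nonneg ε])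
  exact inv_mul_le_one_of_le₀ h (Real.sqrt_nonneg _)

lemma hasDerivAt_smoothNormalize {ε : ℝ} (hε : ε ≠ 0) (x v : LocalSpace d) :
    ∃ w : LocalSpace d, HasDerivAt (fun t : ℝ => smoothNormalize ε (x + t • v)) w 0 ∧
      ‖w‖ ≤ ‖v‖ / √(‖x‖ ^ 2 + ε ^ 2) := by
  set ρ := ‖x‖ ^ 2 + ε ^ 2 with hρ
  have hρ0 : 0 < ρ := by positivity
  set c := inner ℝ x v with hc
  -- The first term is the derivative without change of normalization; the second, radial one only
  -- shortens it, since `‖x‖ ^ 2 ≤ ρ`.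
  refine ⟨(√ρ)⁻¹ • v + (-(c / (√ρ * ρ))) • x, ?_, ?_⟩
  · have h1 : HasDerivAt (fun t : ℝ => x + t • v) v 0 := by
      simpa using ((hasDerivAt_id (0 : ℝ)).smul_const v).const_add x
    have h2 := ((h1.norm_sq).add_const (ε ^ 2)).sqrt (by simpa using hρ0.ne')
    have h3 := (h2.inv (by simpa using (Real.sqrt_pos.2 hρ0).ne')).smul h1
    refine h3.congr_deriv ?_
    simp only [zero_smul, add_zero]
    rw [← hρ, ← hc, Real.sq_sqrt hρ0.le]
    have h4 : (fun y : ℝ => √(‖x + y • v‖ ^ 2 + ε ^ 2))⁻¹ 0 = (√ρ)⁻¹ := by simp [hρ]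
    have h5 : -(2 * c / (2 * √ρ)) / ρ = -(c / (√ρ * ρ)) := by field_simp
    rw [h4, h5]
  · rw [← sq_le_sq₀ (norm_nonneg _) (by positivity), div_pow, Real.sq_sqrt hρ0.le,
      norm_add_sq_real, norm_smul, norm_smul, inner_smul_left, inner_smul_right, mul_pow, mul_pow]
    have hs : √ρ ^ 2 = ρ := Real.sq_sqrt hρ0.le
    have hs0 : √ρ ≠ 0 := (Real.sqrt_pos.2 hρ0).ne'
    simp only [norm_inv, norm_neg, Real.norm_eq_abs, sq_abs, conj_trivial, inv_pow, hs,
      div_pow, mul_pow]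
    rw [real_inner_comm, ← hc]
    have h4 : ρ⁻¹ * ‖v‖ ^ 2 + 2 * ((√ρ)⁻¹ * (-(c / (√ρ * ρ)) * c)) +
        c ^ 2 / (ρ * ρ ^ 2) * ‖x‖ ^ 2 = ‖v‖ ^ 2 / ρ - c ^ 2 * (2 * ρ - ‖x‖ ^ 2) / ρ ^ 3 := by
      have h5 : (√ρ)⁻¹ * (-(c / (√ρ * ρ)) * c) = -(c ^ 2 / ρ ^ 2) := by
        field_simp
        rw [hs]
        ring
      rw [h5]
      field_simp
      ring
    have h6 : 0 ≤ c ^ 2 * (2 * ρ - ‖x‖ ^ 2) / ρ ^ 3 := by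
      have : ‖x‖ ^ 2 ≤ ρ := by
        rw [hρ]
        nlinarith [sq_nonneg ε]
      have : 0 ≤ 2 * ρ - ‖x‖ ^ 2 := by linarith
      positivity
    linarith

variable {p k : ℕ}

/-- Smooth approximate normalization of all the vectors of a family. -/
noncomputable def regularize (ε : ℝ) (x : Fin p → Fin k → LocalSpace d) :
    Fin p → Fin k → LocalSpace d :=
  fun s i => smoothNormalize ε (x s i)

lemma contDiff_regularize {ε : ℝ} (hε : ε ≠ 0) :
    ContDiff ℝ 1 (regularize ε : (Fin p → Fin k → LocalSpace d) → _) :=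
  contDiff_pi.2 fun s => contDiff_pi.2 fun i =>
    (contDiff_smoothNormalize hε).comp (contDiff_apply_apply ℝ (LocalSpace d) s i)

lemma contDiff_traceMoment_tensorSum (n : ℕ) :
    ContDiff ℝ 1 fun φ : Fin p → Fin k → LocalSpace d => traceMoment (tensorSum φ) n := by
  have h0 : ∀ s i j, ContDiff ℝ 1 fun φ : Fin p → Fin k → LocalSpace d => φ s i j := by
    intro s i j
    exact ((EuclideanSpace.proj j : LocalSpace d →L[ℂ] ℂ).restrictScalars ℝ).contDiff.comp
      (contDiff_apply_apply ℝ (LocalSpace d) s i)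
  have h1 : ∀ i j, ContDiff ℝ 1 fun φ : Fin p → Fin k → LocalSpace d => tensorSum φ i j := by
    intro i j
    simp only [tensorSum, Matrix.sum_apply, Matrix.vecMulVec_apply, productVector, Pi.star_apply,
      star_prod]
    refine ContDiff.sum fun s _ => (contDiff_prod fun l _ => h0 s l (i l)).mul
      (contDiff_prod fun l _ => ?_)
    exact (starL' ℝ : ℂ ≃L[ℝ] ℂ).contDiff.comp (h0 s l (j l))
  have h2 : ∀ n i j, ContDiff ℝ 1 fun φ : Fin p → Fin k → LocalSpace d => (tensorSum φ ^ n) i j := by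
    intro n
    induction n with
    | zero => intro i j; simpa using contDiff_const
    | succ n ih =>
      intro i j
      simp only [pow_succ, Matrix.mul_apply]
      exact ContDiff.sum fun l _ => (ih i l).mul (h1 l j)
  exact Complex.reCLM.contDiff.comp (ContDiff.sum fun i _ => h2 n i i)

lemma productVector_update (f : Fin k → LocalSpace d) (i : Fin k) (w : LocalSpace d)
    (j : Fin k → Fin d) : productVector (Function.update f i w) j =
      w (j i) * ∏ l ∈ Finset.univ.erase i, f l (j l) := by
  rw [productVector, ← Finset.mul_prod_erase _ _ (Finset.mem_univ i), Function.update_self]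
  congr 1
  exact Finset.prod_congr rfl fun l hl => by rw [Function.update_of_ne (Finset.ne_of_mem_erase hl)]

lemma re_trace_mul_le {ι : Type*} [Fintype ι] [DecidableEq ι] {B : Matrix ι ι ℂ}
    (hB : B.IsHermitian) (u w : ι → ℂ) :
    |(B * (Matrix.vecMulVec w (star u) + Matrix.vecMulVec u (star w))).trace.re| ≤
      2 * (‖WithLp.toLp 2 (B.mulVec u)‖ * ‖WithLp.toLp 2 w‖) := by
  have h1 : (B.mulVec w) ⬝ᵥ star u = star ((B.mulVec u) ⬝ᵥ star w) := by
    rw [← Matrix.star_dotProduct_star, star_star, Matrix.star_mulVec, hB.eq,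
      dotProduct_comm, Matrix.dotProduct_mulVec, dotProduct_comm]
  have h2 : |((B.mulVec u) ⬝ᵥ star w).re| ≤
      ‖WithLp.toLp 2 (B.mulVec u)‖ * ‖WithLp.toLp 2 w‖ := by
    have h3 := norm_inner_le_norm (𝕜 := ℂ) (WithLp.toLp 2 w) (WithLp.toLp 2 (B.mulVec u))
    rw [EuclideanSpace.inner_toLp_toLp] at h3
    rw [mul_comm]
    exact (Complex.abs_re_le_norm _).trans h3
  rw [mul_add, Matrix.trace_add, Matrix.mul_vecMulVec, Matrix.mul_vecMulVec,
    Matrix.trace_vecMulVec, Matrix.trace_vecMulVec, h1, Complex.add_re]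
  simp only [Complex.star_def, Complex.conj_re]
  rw [← two_mul, abs_mul, abs_two]
  linarith

/-- A product vector is linear in each slot, so moving one vector perturbs the matrix by a
self-adjoint rank two term; the other slots have norm at most one after smoothing. -/
lemma hasDerivAt_traceMoment_regularize {ε : ℝ} (hε : ε ≠ 0) (x : Fin p → Fin k → LocalSpace d)
    (s : Fin p) (i : Fin k) (v : LocalSpace d) (m : ℕ) :
    ∃ c : ℝ, HasDerivAt
      (fun t : ℝ => traceMoment (tensorSum (regularize ε (x + t • singleVector s i v))) m) c 0 ∧
      |c| ≤ 2 * m * ‖WithLp.toLp 2 ((tensorSum (regularize ε x) ^ (m - 1)).mulVec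
        (productVector (regularize ε x s)))‖ / √(‖x s i‖ ^ 2 + ε ^ 2) * ‖v‖ := by
  obtain ⟨w, hw, hwn⟩ := hasDerivAt_smoothNormalize hε (x s i) v
  set φ := regularize ε x with hφ
  set y : ℝ → LocalSpace d := fun t => smoothNormalize ε (x s i + t • v) with hy
  have hy0 : y 0 = φ s i := by simp [hy, hφ, regularize]
  have h1 : ∀ t : ℝ, regularize ε (x + t • singleVector s i v) =
      Function.update φ s (Function.update (φ s) i (y t)) := by
    intro t
    funext s' i'
    by_cases hs : s' = s
    · subst hs
      by_cases hi : i' = i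
      · subst hi
        simp [regularize, singleVector, hy]
      · simp [regularize, singleVector, hi, hφ]
    · simp [regularize, singleVector, hs, hφ]
  have h10 : Function.update φ s (Function.update (φ s) i (y 0)) = φ := by
    rw [hy0, Function.update_eq_self, Function.update_eq_self]
  have h2 : ∀ t : ℝ, tensorSum (Function.update φ s (Function.update (φ s) i (y t))) =
      Matrix.vecMulVec (productVector (Function.update (φ s) i (y t)))
        (star (productVector (Function.update (φ s) i (y t)))) +
      ∑ s' ∈ Finset.univ.erase s, Matrix.vecMulVec (productVector (φ s'))
        (star (productVector (φ s'))) := by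
    intro t
    rw [tensorSum, ← Finset.add_sum_erase _ _ (Finset.mem_univ s), Function.update_self]
    congr 1
    exact Finset.sum_congr rfl fun s' hs' => by
      rw [Function.update_of_ne (Finset.ne_of_mem_erase hs')]
  have h3 : ∀ j, HasDerivAt (fun t => productVector (Function.update (φ s) i (y t)) j)
      (productVector (Function.update (φ s) i w) j) 0 := by
    intro j
    simp only [productVector_update]
    refine HasDerivAt.mul_const ?_ _
    exact ((EuclideanSpace.proj (j i) : LocalSpace d →L[ℂ] ℂ).restrictScalars
      ℝ).hasFDerivAt.comp_hasDerivAt 0 hw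
  set u := productVector (φ s) with hu
  have hu0 : productVector (Function.update (φ s) i (y 0)) = u := by
    rw [hy0, Function.update_eq_self]
  set w' := productVector (Function.update (φ s) i w) with hw'
  have h4 : ∀ j l, HasDerivAt (fun t => tensorSum (Function.update φ s (Function.update (φ s) i
      (y t))) j l) ((Matrix.vecMulVec w' (star u) + Matrix.vecMulVec u (star w')) j l) 0 := by
    intro j l
    simp only [h2, Matrix.add_apply]
    refine HasDerivAt.add_const _ ?_
    simp only [Matrix.vecMulVec_apply, Pi.star_apply]
    have h5 := (h3 j).mul (h3 l).star
    rw [hu0] at h5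
    exact h5
  have h6 := hasDerivAt_trace_pow h4 m
  rw [h10] at h6
  have h7 := Complex.reCLM.hasFDerivAt.comp_hasDerivAt 0 h6
  simp only [h1]
  refine ⟨_, h7, ?_⟩
  have h8 : ((m : ℂ) * (tensorSum φ ^ (m - 1) * (Matrix.vecMulVec w' (star u) +
      Matrix.vecMulVec u (star w'))).trace).re = m * (tensorSum φ ^ (m - 1) *
      (Matrix.vecMulVec w' (star u) + Matrix.vecMulVec u (star w'))).trace.re := by
    rw [← Complex.ofReal_natCast, Complex.re_ofReal_mul]
  rw [Complex.reCLM_apply, h8, abs_mul, Nat.abs_cast]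
  have h9 : ‖WithLp.toLp 2 w'‖ ≤ ‖w‖ := by
    rw [hw', norm_toLp_productVector, ← Finset.mul_prod_erase _ _ (Finset.mem_univ i),
      Function.update_self]
    refine mul_le_of_le_one_right (norm_nonneg _) (Finset.prod_le_one (fun _ _ => norm_nonneg _)
      fun l hl => ?_)
    rw [Function.update_of_ne (Finset.ne_of_mem_erase hl)]
    exact norm_smoothNormalize_le _
  have h11 := re_trace_mul_le ((posSemidef_tensorSum φ).1.pow (m - 1)) u w'
  calc _ ≤ (m : ℝ) * (2 * (‖WithLp.toLp 2 ((tensorSum φ ^ (m - 1)).mulVec u)‖ *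
        (‖v‖ / √(‖x s i‖ ^ 2 + ε ^ 2)))) := by
        gcongr
        refine h11.trans ?_
        gcongr
        exact h9.trans hwn
    _ = _ := by ring

/-- The smooth functional to which Gaussian concentration is applied. -/
noncomputable def momentPower (m : ℕ) (θ : ℝ) (φ : Fin p → Fin k → LocalSpace d) : ℝ :=
  (1 + traceMoment (tensorSum φ) m) ^ θ

lemma one_add_traceMoment_pos (φ : Fin p → Fin k → LocalSpace d) (m : ℕ) :
    0 < 1 + traceMoment (tensorSum φ) m := by
  have := traceMoment_nonneg (posSemidef_tensorSum φ) m
  linarith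

lemma contDiff_momentPower (m : ℕ) (θ : ℝ) :
    ContDiff ℝ 1 (momentPower m θ : (Fin p → Fin k → LocalSpace d) → ℝ) :=
  (contDiff_const.add (contDiff_traceMoment_tensorSum m)).rpow_const_of_ne
    fun φ => (one_add_traceMoment_pos φ m).ne'

lemma norm_fderiv_momentPower_regularize_le {ε θ : ℝ} (hε : ε ≠ 0) (hθ : 0 ≤ θ)
    (x : Fin p → Fin k → LocalSpace d) (s : Fin p) (i : Fin k) (m : ℕ) :
    ‖(fderiv ℝ (fun x => momentPower m θ (regularize ε x)) x).comp (singleVector s i)‖ ≤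
      θ * (1 + traceMoment (tensorSum (regularize ε x)) m) ^ (θ - 1) *
      (2 * m * ‖WithLp.toLp 2 ((tensorSum (regularize ε x) ^ (m - 1)).mulVec
        (productVector (regularize ε x s)))‖ / √(‖x s i‖ ^ 2 + ε ^ 2)) := by
  have hpos := one_add_traceMoment_pos (regularize ε x) m
  refine ContinuousLinearMap.opNorm_le_bound _ (by positivity) fun v => ?_
  obtain ⟨c, hc, hcn⟩ := hasDerivAt_traceMoment_regularize hε x s i v m
  have h1 : HasDerivAt (fun t : ℝ => x + t • singleVector s i v) (singleVector s i v) 0 := by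
    simpa using ((hasDerivAt_id (0 : ℝ)).smul_const (singleVector s i v)).const_add x
  have hd : DifferentiableAt ℝ (fun x => momentPower m θ (regularize ε x))
      (x + (0 : ℝ) • singleVector s i v) :=
    (((contDiff_momentPower m θ).comp (contDiff_regularize hε)).differentiable one_ne_zero) _
  have h2 := hd.hasFDerivAt.comp_hasDerivAt 0 h1
  rw [zero_smul, add_zero] at h2
  have h3 := (hc.const_add 1).rpow_const (p := θ) (Or.inl (by simpa using hpos.ne'))
  have h4 := h2.unique h3
  rw [zero_smul, add_zero] at h4
  rw [ContinuousLinearMap.comp_apply, h4, Real.norm_eq_abs, abs_mul, abs_mul,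
    abs_of_nonneg hθ, abs_of_pos (Real.rpow_pos_of_pos hpos _)]
  calc _ = θ * (1 + traceMoment (tensorSum (regularize ε x)) m) ^ (θ - 1) * |c| := by ring
    _ ≤ _ := by
      rw [mul_assoc (θ * _)]
      gcongr

/-- Each term is the trace of `M ^ (2 * m - 2)` times a rank one matrix, and these rank one matrices
add up to `M`. -/
lemma sum_norm_sq_mulVec_tensorSum (φ : Fin p → Fin k → LocalSpace d) {m : ℕ} (hm : 0 < m) :
    ∑ s, ‖WithLp.toLp 2 ((tensorSum φ ^ (m - 1)).mulVec (productVector (φ s)))‖ ^ 2 =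
      traceMoment (tensorSum φ) (2 * m - 1) := by
  have hH := ((posSemidef_tensorSum φ).1.pow (m - 1))
  have h1 : ∀ s, ((‖WithLp.toLp 2 ((tensorSum φ ^ (m - 1)).mulVec (productVector (φ s)))‖ ^ 2 : ℝ)
      : ℂ) = (tensorSum φ ^ (m - 1) * tensorSum φ ^ (m - 1) *
        Matrix.vecMulVec (productVector (φ s)) (star (productVector (φ s)))).trace := by
    intro s
    have h2 := inner_self_eq_norm_sq_to_K (𝕜 := ℂ)
      (WithLp.toLp 2 ((tensorSum φ ^ (m - 1)).mulVec (productVector (φ s))))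
    rw [EuclideanSpace.inner_toLp_toLp] at h2
    push_cast
    refine h2.symm.trans ?_
    rw [Matrix.mul_vecMulVec, Matrix.trace_vecMulVec, Matrix.star_mulVec, hH.eq, dotProduct_comm,
      ← Matrix.dotProduct_mulVec, Matrix.mulVec_mulVec, dotProduct_comm]
  have h3 : ((∑ s, ‖WithLp.toLp 2 ((tensorSum φ ^ (m - 1)).mulVec (productVector (φ s)))‖ ^ 2 : ℝ)
      : ℂ) = (tensorSum φ ^ (2 * m - 1)).trace := by
    rw [Complex.ofReal_sum, Finset.sum_congr rfl fun s _ => h1 s, ← Matrix.trace_sum,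
      ← Finset.mul_sum]
    change (_ * tensorSum φ).trace = _
    rw [← pow_add, ← pow_succ]
    congr 2
    omega
  rw [traceMoment, ← h3, Complex.ofReal_re]

/-- The smoothing parameter is dropped from the denominators, which makes the bound uniform in `ε`;
the inverse squares that remain are integrable under the radial law. -/
lemma sum_sq_norm_fderiv_le {ε θ : ℝ} (hε : ε ≠ 0) (hθ : 0 ≤ θ)
    (x : Fin p → Fin k → LocalSpace d) (hx : ∀ s i, x s i ≠ 0) {m : ℕ} :
    ∑ s, ∑ i, ‖(fderiv ℝ (fun x => momentPower m θ (regularize ε x)) x).comp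
        (singleVector s i)‖ ^ 2 / (2 * d) ≤
      2 * m ^ 2 * θ ^ 2 / d * ((1 + traceMoment (tensorSum (regularize ε x)) m) ^ (θ - 1)) ^ 2 *
      ∑ s, ‖WithLp.toLp 2 ((tensorSum (regularize ε x) ^ (m - 1)).mulVec
        (productVector (regularize ε x s)))‖ ^ 2 * ∑ i, (‖x s i‖ ^ 2)⁻¹ := by
  simp only [Finset.mul_sum]
  refine Finset.sum_le_sum fun s _ => Finset.sum_le_sum fun i _ => ?_
  have hpos := one_add_traceMoment_pos (regularize ε x) m
  have hx0 : 0 < ‖x s i‖ := norm_pos_iff.2 (hx s i)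
  have h1 : √(‖x s i‖ ^ 2 + ε ^ 2) ≥ ‖x s i‖ := Real.le_sqrt_of_sq_le (by nlinarith [sq_nonneg ε])
  have h2 : ‖(fderiv ℝ (fun x => momentPower m θ (regularize ε x)) x).comp (singleVector s i)‖ ≤
      θ * (1 + traceMoment (tensorSum (regularize ε x)) m) ^ (θ - 1) *
      (2 * m * ‖WithLp.toLp 2 ((tensorSum (regularize ε x) ^ (m - 1)).mulVec
        (productVector (regularize ε x s)))‖ / ‖x s i‖) := by
    refine (norm_fderiv_momentPower_regularize_le hε hθ x s i m).trans ?_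
    gcongr
  calc _ ≤ (θ * (1 + traceMoment (tensorSum (regularize ε x)) m) ^ (θ - 1) *
      (2 * m * ‖WithLp.toLp 2 ((tensorSum (regularize ε x) ^ (m - 1)).mulVec
        (productVector (regularize ε x s)))‖ / ‖x s i‖)) ^ 2 / (2 * d) := by gcongr
    _ = _ := by
      rw [mul_pow, mul_pow, div_pow, mul_pow, mul_pow]
      ring

end Regularization

/-! ### Concentration of trace moments for the normalized ensemble. -/

lemma measurePreserving_pi_prod {α β γ ι : Type*} [Fintype ι] [MeasurableSpace α]
    [MeasurableSpace β] [MeasurableSpace γ] {μ : Measure α} {ρ : Measure β} {ν : Measure γ}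
    [IsProbabilityMeasure μ] [IsProbabilityMeasure ρ] [IsProbabilityMeasure ν] {f : α × β → γ}
    (hf : MeasurePreserving f (μ.prod ρ) ν) :
    MeasurePreserving (fun (q : (ι → α) × (ι → β)) s => f (q.1 s, q.2 s))
      ((Measure.pi fun _ : ι => μ).prod (Measure.pi fun _ : ι => ρ))
      (Measure.pi fun _ : ι => ν) := by
  have hm := hf.measurable
  refine ⟨by fun_prop, ?_⟩
  rw [← (measurePreserving_arrowProdEquivProdArrow _ _ ι (fun _ => μ) fun _ => ρ).map_eq,
    Measure.map_map (by fun_prop) (by fun_prop)]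
  have h := Measure.pi_map_pi (μ := fun _ : ι => μ.prod ρ) (f := fun _ => f)
    (hμ := fun _ => by rw [hf.map_eq]; infer_instance) fun _ => by fun_prop
  rw [hf.map_eq] at h
  rw [← h]
  rfl

variable {p d k : ℕ}

/-- The joint law of the radial parts of the Gaussian product ensemble. -/
noncomputable def radialEnsemble (p d k : ℕ) : Measure (Fin p → Fin k → ℝ) :=
  Measure.pi fun _ : Fin p => Measure.pi fun _ : Fin k => radialLaw d

instance (p d k : ℕ) : IsProbabilityMeasure (radialEnsemble p d k) := by
  unfold radialEnsemble
  infer_instance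

instance (p d k : ℕ) : IsProbabilityMeasure (gaussianEnsemble p d k) := by
  unfold gaussianEnsemble iidFamily
  infer_instance

lemma isProbabilityMeasure_normalizedEnsemble (hd : 0 < d) :
    IsProbabilityMeasure (normalizedEnsemble p d k) := by
  have := isProbabilityMeasure_uniformUnitVector hd
  unfold normalizedEnsemble iidFamily
  infer_instance

/-- Polar coordinates for families of vectors. -/
noncomputable def polarMap (q : (Fin p → Fin k → LocalSpace d) × (Fin p → Fin k → ℝ)) :
    Fin p → Fin k → LocalSpace d :=
  fun s i => q.2 s i • q.1 s i

lemma continuous_polarMap : Continuous (polarMap : (Fin p → Fin k → LocalSpace d) × _ → _) := by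
  unfold polarMap
  fun_prop

lemma measurePreserving_polarMap (hd : 0 < d) :
    MeasurePreserving polarMap ((normalizedEnsemble p d k).prod (radialEnsemble p d k))
      (gaussianEnsemble p d k) := by
  have := isProbabilityMeasure_uniformUnitVector hd
  exact measurePreserving_pi_prod (measurePreserving_smul_pi hd (Fin k))

lemma ae_norm_normalizedEnsemble (p d k : ℕ) :
    ∀ᵐ φ ∂normalizedEnsemble p d k, ∀ s i, ‖φ s i‖ = 1 :=
  Filter.eventually_all.2 fun s =>
    (Measure.quasiMeasurePreserving_eval
      (fun _ => Measure.pi fun _ : Fin k => uniformUnitVector d) s).ae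
      (ae_norm_pi_uniformUnitVector d)

lemma ae_pos_radialEnsemble (hd : 0 < d) : ∀ᵐ r ∂radialEnsemble p d k, ∀ s i, 0 < r s i :=
  Filter.eventually_all.2 fun s => Filter.eventually_all.2 fun i =>
    (Measure.quasiMeasurePreserving_eval
      (fun _ => Measure.pi fun _ : Fin k => radialLaw d) s).ae
      ((Measure.quasiMeasurePreserving_eval (fun _ => radialLaw d) i).ae (ae_pos_radialLaw hd))

lemma measurePreserving_eval_radialEnsemble (s : Fin p) (i : Fin k) :
    MeasurePreserving (fun r : Fin p → Fin k → ℝ => r s i) (radialEnsemble p d k) (radialLaw d) :=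
  (measurePreserving_eval (fun _ : Fin k => radialLaw d) i).comp
    (measurePreserving_eval (fun _ : Fin p => Measure.pi fun _ : Fin k => radialLaw d) s)

lemma exists_bound_of_norm_le_one {g : (Fin p → Fin k → LocalSpace d) → ℝ} (hg : Continuous g) :
    ∃ C, ∀ φ, (∀ s i, ‖φ s i‖ ≤ 1) → ‖g φ‖ ≤ C := by
  obtain ⟨C, hC⟩ := (isCompact_closedBall (0 : Fin p → Fin k → LocalSpace d)
    1).exists_bound_of_continuousOn hg.continuousOn
  refine ⟨C, fun φ hφ => hC φ ?_⟩
  rw [mem_closedBall_zero_iff, pi_norm_le_iff_of_nonneg zero_le_one]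
  exact fun s => (pi_norm_le_iff_of_nonneg zero_le_one).2 (hφ s)

lemma integrable_normalizedEnsemble_of_continuous (hd : 0 < d)
    {g : (Fin p → Fin k → LocalSpace d) → ℝ} (hg : Continuous g) :
    Integrable g (normalizedEnsemble p d k) := by
  have := isProbabilityMeasure_normalizedEnsemble (p := p) (k := k) hd
  obtain ⟨C, hC⟩ := exists_bound_of_norm_le_one hg
  refine Integrable.of_bound hg.aestronglyMeasurable C ?_
  filter_upwards [ae_norm_normalizedEnsemble p d k] with φ hφ
  exact hC φ fun s i => (hφ s i).le

lemma tendsto_regularize_polarMap {q : (Fin p → Fin k → LocalSpace d) × (Fin p → Fin k → ℝ)}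
    (hu : ∀ s i, ‖q.1 s i‖ = 1) (hr : ∀ s i, 0 < q.2 s i) :
    Filter.Tendsto (fun n : ℕ => regularize (1 / ((n : ℝ) + 1)) (polarMap q)) Filter.atTop
      (nhds q.1) := by
  refine tendsto_pi_nhds.2 fun s => tendsto_pi_nhds.2 fun i => ?_
  have h1 : Filter.Tendsto (fun n : ℕ => √(‖q.2 s i • q.1 s i‖ ^ 2 + (1 / ((n : ℝ) + 1)) ^ 2))
      Filter.atTop (nhds (q.2 s i)) := by
    have h2 := ((tendsto_one_div_add_atTop_nhds_zero_nat (𝕜 := ℝ)).pow 2).const_add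
      (‖q.2 s i • q.1 s i‖ ^ 2)
    have h3 := h2.sqrt
    rw [norm_smul, hu, Real.norm_of_nonneg (hr s i).le] at h3 ⊢
    simpa [Real.sqrt_sq (hr s i).le] using h3
  have h4 := (h1.inv₀ (hr s i).ne').smul_const (q.2 s i • q.1 s i)
  rw [smul_smul, inv_mul_cancel₀ (hr s i).ne', one_smul] at h4
  exact h4

/-- The weight of the vector `φ s` in the squared gradient of `momentPower`. -/
noncomputable def gradientWeight (m : ℕ) (θ : ℝ) (s : Fin p) (φ : Fin p → Fin k → LocalSpace d) :
    ℝ :=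
  ((1 + traceMoment (tensorSum φ) m) ^ (θ - 1)) ^ 2 *
    ‖WithLp.toLp 2 ((tensorSum φ ^ (m - 1)).mulVec (productVector (φ s)))‖ ^ 2

lemma gradientWeight_nonneg (m : ℕ) (θ : ℝ) (s : Fin p) (φ : Fin p → Fin k → LocalSpace d) :
    0 ≤ gradientWeight m θ s φ := by
  unfold gradientWeight
  positivity

lemma continuous_gradientWeight (m : ℕ) (θ : ℝ) (s : Fin p) :
    Continuous (gradientWeight m θ s : (Fin p → Fin k → LocalSpace d) → ℝ) := by
  refine Continuous.mul (Continuous.pow (Continuous.rpow_const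
    (continuous_const.add (continuous_traceMoment_tensorSum m)) fun φ =>
      Or.inl (one_add_traceMoment_pos φ m).ne') 2) (Continuous.pow (Continuous.norm ?_) 2)
  refine (PiLp.continuous_toLp 2 _).comp ((continuous_tensorSum.pow (m - 1)).matrix_mulVec ?_)
  refine continuous_pi fun j => ?_
  unfold productVector
  fun_prop

/-- The functional is self-bounding: the squared gradient of `F ^ θ` is controlled by `F ^ (2 * θ)`,
with `F` equal to one plus the moment. -/
lemma sum_gradientWeight_le {m : ℕ} (hm : 0 < m) (θ : ℝ) (φ : Fin p → Fin k → LocalSpace d) :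
    ∑ s, gradientWeight m θ s φ ≤ momentPower m (2 * θ) φ := by
  have hpos := one_add_traceMoment_pos φ m
  unfold gradientWeight
  rw [← Finset.mul_sum, sum_norm_sq_mulVec_tensorSum φ hm]
  have h1 := traceMoment_two_mul_sub_one_le (posSemidef_tensorSum φ) m
  calc _ ≤ ((1 + traceMoment (tensorSum φ) m) ^ (θ - 1)) ^ 2 *
        (1 + traceMoment (tensorSum φ) m) ^ 2 := by
        gcongr
        nlinarith
    _ = _ := by
        rw [← mul_pow, Real.rpow_sub_one hpos.ne', div_mul_cancel₀ _ hpos.ne', ← Real.rpow_natCast,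
          ← Real.rpow_mul hpos.le, momentPower]
        congr 1
        push_cast
        ring

/-- The Gaussian inequality is applied to the functional composed with a smoothed normalization, and
the smoothing tends to zero. Fatou's lemma treats the left side; the right side converges by
domination, the weights being bounded on the unit ball. -/
lemma lintegral_momentPower_sub_sq_le (hd : 2 ≤ d) {m : ℕ} {θ : ℝ} (hθ : 0 ≤ θ) :
    ∫⁻ z, ENNReal.ofReal ((momentPower m θ z.1 - momentPower m θ z.2) ^ 2)
        ∂((normalizedEnsemble p d k).prod (normalizedEnsemble p d k)) ≤
      ENNReal.ofReal ((Real.pi / 2) ^ 2) * ∫⁻ q, ENNReal.ofReal (2 * m ^ 2 * θ ^ 2 / d *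
        ∑ s, gradientWeight m θ s q.1 * ∑ i, (q.2 s i ^ 2)⁻¹)
        ∂((normalizedEnsemble p d k).prod (radialEnsemble p d k)) := by
  have hd0 : 0 < d := by omega
  have hprob := isProbabilityMeasure_normalizedEnsemble (p := p) (k := k) hd0
  have hgauss := isGaussian_gaussianEnsemble p d k
  set U := normalizedEnsemble p d k
  set V := radialEnsemble p d k
  set ε : ℕ → ℝ := fun n => 1 / ((n : ℝ) + 1) with hε
  have hε0 : ∀ n, ε n ≠ 0 := fun n => by positivity
  set G : ℕ → (Fin p → Fin k → LocalSpace d) → ℝ :=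
    fun n x => momentPower m θ (regularize (ε n) x) with hG
  have hGc : ∀ n, ContDiff ℝ 1 (G n) := fun n =>
    (contDiff_momentPower m θ).comp (contDiff_regularize (hε0 n))
  have hF : Continuous (momentPower m θ : (Fin p → Fin k → LocalSpace d) → ℝ) :=
    (contDiff_momentPower m θ).continuous
  have hae : ∀ᵐ q ∂U.prod V, (∀ s i, ‖q.1 s i‖ = 1) ∧ ∀ s i, 0 < q.2 s i := by
    have h1 := (Measure.quasiMeasurePreserving_fst (μ := U) (ν := V)).ae
      (ae_norm_normalizedEnsemble p d k)
    have h2 := (Measure.quasiMeasurePreserving_snd (μ := U) (ν := V)).ae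
      (ae_pos_radialEnsemble hd0)
    exact h1.and h2
  have hpol := measurePreserving_polarMap (p := p) (k := k) hd0
  have hlim : ∀ᵐ q ∂U.prod V, Filter.Tendsto (fun n => G n (polarMap q)) Filter.atTop
      (nhds (momentPower m θ q.1)) := by
    filter_upwards [hae] with q hq
    exact (hF.tendsto _).comp (tendsto_regularize_polarMap hq.1 hq.2)
  set h : ℕ → (Fin p → Fin k → LocalSpace d) × (Fin p → Fin k → ℝ) → ENNReal :=
    fun n q => ENNReal.ofReal (2 * m ^ 2 * θ ^ 2 / d *
      ∑ s, gradientWeight m θ s (regularize (ε n) (polarMap q)) * ∑ i, (q.2 s i ^ 2)⁻¹) with hh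
  have hfatou : ∫⁻ z, ENNReal.ofReal ((momentPower m θ z.1 - momentPower m θ z.2) ^ 2)
      ∂(U.prod U) ≤ Filter.liminf (fun n => ∫⁻ z : _ × _, ENNReal.ofReal
        ((G n (polarMap z.1) - G n (polarMap z.2)) ^ 2) ∂((U.prod V).prod (U.prod V)))
        Filter.atTop := by
    have hfst : MeasurePreserving (Prod.fst : _ × _ → _) (U.prod V) U := measurePreserving_fst
    have hff := hfst.prod hfst
    rw [← hff.lintegral_comp (Continuous.measurable (by fun_prop)).ennreal_ofReal]
    have h1 : ∀ᵐ z ∂(U.prod V).prod (U.prod V), ENNReal.ofReal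
        ((momentPower m θ z.1.1 - momentPower m θ z.2.1) ^ 2) = Filter.liminf (fun n =>
          ENNReal.ofReal ((G n (polarMap z.1) - G n (polarMap z.2)) ^ 2)) Filter.atTop := by
      filter_upwards [Measure.quasiMeasurePreserving_fst.ae hlim,
        Measure.quasiMeasurePreserving_snd.ae hlim] with z h1 h2
      exact (ENNReal.tendsto_ofReal ((h1.sub h2).pow 2)).liminf_eq.symm
    refine (lintegral_congr_ae h1).le.trans (lintegral_liminf_le fun n => ?_)
    have h2 := (hGc n).continuous
    have h3 := continuous_polarMap (p := p) (d := d) (k := k)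
    exact (Continuous.measurable (by fun_prop)).ennreal_ofReal
  have hbound : ∀ n, ∫⁻ z : _ × _, ENNReal.ofReal
      ((G n (polarMap z.1) - G n (polarMap z.2)) ^ 2) ∂((U.prod V).prod (U.prod V)) ≤
      ENNReal.ofReal ((Real.pi / 2) ^ 2) * ∫⁻ q, h n q ∂(U.prod V) := by
    intro n
    have h1 := lintegral_sub_sq_le (integral_dual_gaussianEnsemble (p := p) (d := d) (k := k))
      (hGc n)
    have hfd : Continuous (fderiv ℝ (G n)) := (hGc n).continuous_fderiv one_ne_zero
    have hGn := (hGc n).continuous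
    rw [← (hpol.prod hpol).lintegral_comp (Continuous.measurable (by fun_prop)).ennreal_ofReal,
      lintegral_prod (fun q : _ × _ => ENNReal.ofReal ((fderiv ℝ (G n) q.1 q.2) ^ 2))
        (Continuous.measurable (by fun_prop)).ennreal_ofReal.aemeasurable] at h1
    refine h1.trans ?_
    gcongr
    simp_rw [lintegral_dual_sq_gaussianEnsemble]
    rw [← hpol.lintegral_comp (Continuous.measurable (by fun_prop)).ennreal_ofReal]
    refine lintegral_mono_ae ?_
    filter_upwards [hae] with q hq
    refine ENNReal.ofReal_le_ofReal ?_
    have hx : ∀ s i, polarMap q s i ≠ 0 := fun s i => by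
      have : q.1 s i ≠ 0 := norm_pos_iff.1 (by rw [hq.1]; exact one_pos)
      exact smul_ne_zero (hq.2 s i).ne' this
    refine (sum_sq_norm_fderiv_le (hε0 n) hθ _ hx).trans_eq ?_
    have hn : ∀ s i, ‖polarMap q s i‖ ^ 2 = q.2 s i ^ 2 := fun s i => by
      rw [polarMap, norm_smul, hq.1, mul_one, Real.norm_eq_abs, sq_abs]
    simp only [hn, gradientWeight]
    rw [mul_assoc, Finset.mul_sum]
    congr 1
    exact Finset.sum_congr rfl fun s _ => by ring
  have hconv : Filter.Tendsto (fun n => ∫⁻ q, h n q ∂(U.prod V)) Filter.atTop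
      (nhds (∫⁻ q, ENNReal.ofReal (2 * m ^ 2 * θ ^ 2 / d *
        ∑ s, gradientWeight m θ s q.1 * ∑ i, (q.2 s i ^ 2)⁻¹) ∂(U.prod V))) := by
    choose C hC using fun s : Fin p => exists_bound_of_norm_le_one
      (continuous_gradientWeight (d := d) (k := k) m θ s)
    have hC0 : ∀ s, 0 ≤ C s := fun s => (norm_nonneg _).trans (hC s 0 (by simp))
    have hint : Integrable (fun q : (Fin p → Fin k → LocalSpace d) × (Fin p → Fin k → ℝ) =>
        2 * m ^ 2 * θ ^ 2 / d * ∑ s, C s * ∑ i, (q.2 s i ^ 2)⁻¹) (U.prod V) := by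
      refine Integrable.const_mul (integrable_finsetSum _ fun s _ =>
        Integrable.const_mul (integrable_finsetSum _ fun i _ => ?_) _) _
      exact (((measurePreserving_eval_radialEnsemble s i).comp
        (measurePreserving_snd (μ := U) (ν := V))).integrable_comp_of_integrable
          (integral_inv_sq_radialLaw hd).1)
    refine tendsto_lintegral_of_dominated_convergence (fun q => ENNReal.ofReal
      (2 * m ^ 2 * θ ^ 2 / d * ∑ s, C s * ∑ i, (q.2 s i ^ 2)⁻¹)) (fun n => ?_) (fun n => ?_)
      hint.lintegral_lt_top.ne ?_
    · refine ENNReal.measurable_ofReal.comp (Measurable.const_mul (Finset.measurable_fun_sum _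
        fun s _ => Measurable.mul ?_ (by fun_prop)) _)
      exact ((continuous_gradientWeight m θ s).comp ((contDiff_regularize (hε0 n)).continuous.comp
        continuous_polarMap)).measurable
    · refine Filter.Eventually.of_forall fun q => ENNReal.ofReal_le_ofReal ?_
      gcongr with s
      exact (le_abs_self _).trans (hC s _ fun s i => norm_smoothNormalize_le _)
    · filter_upwards [hae] with q hq
      refine ENNReal.tendsto_ofReal (Filter.Tendsto.const_mul _ (tendsto_finsetSum _ fun s _ =>
        Filter.Tendsto.mul_const _ ?_))
      exact ((continuous_gradientWeight m θ s).tendsto _).comp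
        (tendsto_regularize_polarMap hq.1 hq.2)
  calc _ ≤ _ := hfatou
    _ ≤ Filter.liminf (fun n => ENNReal.ofReal ((Real.pi / 2) ^ 2) * ∫⁻ q, h n q ∂(U.prod V))
        Filter.atTop := Filter.liminf_le_liminf (Filter.Eventually.of_forall hbound)
    _ = _ := (ENNReal.Tendsto.const_mul hconv (Or.inr ENNReal.ofReal_ne_top)).liminf_eq

lemma variance_momentPower_le (hd : 2 ≤ d) {m : ℕ} (hm : 0 < m) {θ : ℝ} (hθ : 0 ≤ θ) :
    ∫ φ, momentPower m (2 * θ) φ ∂normalizedEnsemble p d k -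
        (∫ φ, momentPower m θ φ ∂normalizedEnsemble p d k) ^ 2 ≤
      5 * k * m ^ 2 / d * θ ^ 2 * ∫ φ, momentPower m (2 * θ) φ ∂normalizedEnsemble p d k := by
  have hd0 : 0 < d := by omega
  have hprob := isProbabilityMeasure_normalizedEnsemble (p := p) (k := k) hd0
  have hF := fun θ => integrable_normalizedEnsemble_of_continuous hd0
    (contDiff_momentPower (p := p) (d := d) (k := k) m θ).continuous
  have hK := fun s => integrable_normalizedEnsemble_of_continuous hd0
    (continuous_gradientWeight (p := p) (d := d) (k := k) m θ s)
  have hsq : ∀ φ : Fin p → Fin k → LocalSpace d,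
      momentPower m θ φ ^ 2 = momentPower m (2 * θ) φ := fun φ => by
    rw [momentPower, momentPower, ← Real.rpow_natCast, ← Real.rpow_mul
      (one_add_traceMoment_pos φ m).le, mul_comm]
    norm_num
  have h0 := lintegral_momentPower_sub_sq_le (p := p) (d := d) (k := k) (m := m) hd hθ
  set U := normalizedEnsemble p d k with hU
  set V := radialEnsemble p d k with hV
  have hi0 : Integrable (fun z : _ × _ => momentPower m (2 * θ) z.1 + momentPower m (2 * θ) z.2)
      (U.prod U) := ((hF (2 * θ)).comp_fst U).add ((hF (2 * θ)).comp_snd U)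
  have hi1 : Integrable (fun z : _ × _ => momentPower m (2 * θ) z.1 + momentPower m (2 * θ) z.2 -
      2 * (momentPower m θ z.1 * momentPower m θ z.2)) (U.prod U) :=
    hi0.sub (((hF θ).mul_prod (hF θ)).const_mul 2)
  have he : ∀ z : (Fin p → Fin k → LocalSpace d) × (Fin p → Fin k → LocalSpace d),
      (momentPower m θ z.1 - momentPower m θ z.2) ^ 2 =
      momentPower m (2 * θ) z.1 + momentPower m (2 * θ) z.2 -
      2 * (momentPower m θ z.1 * momentPower m θ z.2) := fun z => by
    rw [← hsq, ← hsq]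
    ring
  have hL : ∫⁻ z, ENNReal.ofReal ((momentPower m θ z.1 - momentPower m θ z.2) ^ 2)
      ∂(U.prod U) = ENNReal.ofReal (2 * (∫ φ, momentPower m (2 * θ) φ ∂U -
        (∫ φ, momentPower m θ φ ∂U) ^ 2)) := by
    rw [← ofReal_integral_eq_lintegral_ofReal (by simpa only [he] using hi1)
      (Filter.Eventually.of_forall fun _ => sq_nonneg _)]
    simp only [he]
    rw [integral_sub hi0 (((hF θ).mul_prod (hF θ)).const_mul 2), integral_add ((hF (2 * θ)).comp_fst U)
      ((hF (2 * θ)).comp_snd U), integral_const_mul, integral_prod_mul, integral_fun_fst,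
      integral_fun_snd]
    simp only [probReal_univ, one_smul]
    congr 1
    ring
  have hint : ∀ s, Integrable (fun q : (Fin p → Fin k → LocalSpace d) × (Fin p → Fin k → ℝ) =>
      gradientWeight m θ s q.1 * ∑ i, (q.2 s i ^ 2)⁻¹) (U.prod V) := fun s =>
    (hK s).mul_prod (integrable_finsetSum _ fun i _ =>
      (measurePreserving_eval_radialEnsemble s i).integrable_comp_of_integrable
        (integral_inv_sq_radialLaw hd).1)
  have hinv : ∀ (s : Fin p) (i : Fin k), Integrable (fun r : Fin p → Fin k → ℝ => (r s i ^ 2)⁻¹) V :=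
    fun s i => (measurePreserving_eval_radialEnsemble s i).integrable_comp_of_integrable
      (integral_inv_sq_radialLaw hd).1
  have hval : ∀ s i, ∫ r : Fin p → Fin k → ℝ, (r s i ^ 2)⁻¹ ∂V = ∫ r, (r ^ 2)⁻¹ ∂radialLaw d := fun s i => by
    have h1 := measurePreserving_eval_radialEnsemble (p := p) (d := d) (k := k) s i
    rw [← h1.map_eq, integral_map h1.measurable.aemeasurable
      (Measurable.aestronglyMeasurable (by fun_prop))]
  have hRR : ∫⁻ q, ENNReal.ofReal (2 * m ^ 2 * θ ^ 2 / d *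
        ∑ s, gradientWeight m θ s q.1 * ∑ i, (q.2 s i ^ 2)⁻¹) ∂(U.prod V) ≤
      ENNReal.ofReal (2 * m ^ 2 * θ ^ 2 / d *
        ((∫ φ, momentPower m (2 * θ) φ ∂U) * (k * 2))) := by
    rw [← ofReal_integral_eq_lintegral_ofReal
      ((integrable_finsetSum _ fun s _ => hint s).const_mul _)
      (Filter.Eventually.of_forall fun q => mul_nonneg (by positivity) (Finset.sum_nonneg fun s _ =>
        mul_nonneg (gradientWeight_nonneg _ _ _ _) (by positivity)))]
    refine ENNReal.ofReal_le_ofReal ?_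
    rw [integral_const_mul, integral_finsetSum _ fun s _ => hint s]
    refine mul_le_mul_of_nonneg_left ?_ (by positivity)
    calc _ ≤ ∑ s, (∫ φ, gradientWeight m θ s φ ∂U) * (k * 2) := by
          refine Finset.sum_le_sum fun s _ => ?_
          rw [integral_prod_mul (fun φ => gradientWeight m θ s φ)
            (fun r : Fin p → Fin k → ℝ => ∑ i, (r s i ^ 2)⁻¹)]
          refine mul_le_mul_of_nonneg_left ?_
            (integral_nonneg fun φ => gradientWeight_nonneg _ _ _ _)
          rw [integral_finsetSum _ fun i _ => hinv s i]
          simp only [hval, Finset.sum_const, Finset.card_univ, Fintype.card_fin, nsmul_eq_mul]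
          gcongr
          exact (integral_inv_sq_radialLaw hd).2
      _ = (∫ φ, ∑ s, gradientWeight m θ s φ ∂U) * (k * 2) := by
          rw [integral_finsetSum _ fun s _ => hK s, Finset.sum_mul]
      _ ≤ _ := by
          gcongr
          · exact integrable_finsetSum _ fun s _ => hK s
          · exact hF _
          · exact fun φ => sum_gradientWeight_le hm θ φ
  have hI : 0 ≤ ∫ φ, momentPower m (2 * θ) φ ∂U := integral_nonneg fun φ =>
    Real.rpow_nonneg (one_add_traceMoment_pos φ m).le _
  rw [hL] at h0
  have h1 := h0.trans (mul_le_mul_right hRR _)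
  rw [← ENNReal.ofReal_mul (by positivity), ENNReal.ofReal_le_ofReal_iff (by positivity)] at h1
  -- The constants combine to `π ^ 2 / 2`, which is rounded to `5`.
  have h2 : Real.pi ^ 2 ≤ 10 := by nlinarith [Real.pi_lt_d2, Real.pi_pos]
  calc _ ≤ (Real.pi / 2) ^ 2 * (2 * m ^ 2 * θ ^ 2 / d *
        ((∫ φ, momentPower m (2 * θ) φ ∂U) * (k * 2))) / 2 := by linarith
    _ = Real.pi ^ 2 * (k * m ^ 2 / d * θ ^ 2 * (∫ φ, momentPower m (2 * θ) φ ∂U)) / 2 := by ring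
    _ ≤ 10 * (k * m ^ 2 / d * θ ^ 2 * (∫ φ, momentPower m (2 * θ) φ ∂U)) / 2 := by gcongr
    _ = _ := by ring

variable {p d k : ℕ}

lemma one_le_momentPower (m : ℕ) {θ : ℝ} (hθ : 0 ≤ θ) (φ : Fin p → Fin k → LocalSpace d) :
    1 ≤ momentPower m θ φ :=
  Real.one_le_rpow (by
    have := traceMoment_nonneg (posSemidef_tensorSum φ) m
    linarith) hθ

/-- The variance bound reads `𝔼 F ^ (2 * θ) * (1 - θ ^ 2) ≤ (𝔼 F ^ θ) ^ 2`, a reverse Jensen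
inequality. Iterated while `θ` is halved, its losses sum to a geometric series. -/
lemma integral_momentPower_one_le (hd : 2 ≤ d) {m : ℕ} (hm : 0 < m) (hmd : 5 * k * m ^ 2 ≤ d)
    (J : ℕ) :
    ∫ φ, momentPower m 1 φ ∂normalizedEnsemble p d k ≤ Real.exp (1 - (1 / 2) ^ J) *
      (∫ φ, momentPower m ((1 / 2) ^ J) φ ∂normalizedEnsemble p d k) ^ 2 ^ J := by
  induction J with
  | zero => simp
  | succ J ih =>
    have hd0 : (0 : ℝ) < d := by
      have : 0 < d := by omega
      exact_mod_cast this
    set θ : ℝ := (1 / 2) ^ (J + 1) with hθ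
    have hθ0 : 0 ≤ θ := by positivity
    have hθ1 : θ ≤ 1 / 2 := by
      rw [hθ, pow_succ]
      have : ((1 : ℝ) / 2) ^ J ≤ 1 := pow_le_one₀ (by norm_num) (by norm_num)
      linarith
    have h2θ : 2 * θ = (1 / 2) ^ J := by
      rw [hθ, pow_succ]
      ring
    have h1 := variance_momentPower_le (p := p) (k := k) hd hm hθ0
    rw [← h2θ] at ih
    set A := ∫ φ, momentPower m (2 * θ) φ ∂normalizedEnsemble p d k with hA
    set B := ∫ φ, momentPower m θ φ ∂normalizedEnsemble p d k with hB
    have hA0 : 0 ≤ A := integral_nonneg fun φ =>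
      zero_le_one.trans (one_le_momentPower m (by positivity) φ)
    have hc : 5 * k * m ^ 2 / d ≤ (1 : ℝ) := by
      rw [div_le_one hd0]
      exact_mod_cast hmd
    have h2 : A ≤ Real.exp (2 * θ ^ 2) * B ^ 2 := by
      have h3 : A * (1 - θ ^ 2) ≤ B ^ 2 := by
        have : 5 * k * m ^ 2 / d * θ ^ 2 * A ≤ 1 * θ ^ 2 * A := by gcongr
        linarith
      have h4 : 1 ≤ (1 - θ ^ 2) * (1 + 2 * θ ^ 2) := by
        have h5 : θ ^ 2 ≤ 1 / 2 := by nlinarith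
        nlinarith [mul_nonneg (sq_nonneg θ) (sub_nonneg.2 h5)]
      have h5 : 1 + 2 * θ ^ 2 ≤ Real.exp (2 * θ ^ 2) := by
        have := Real.add_one_le_exp (2 * θ ^ 2)
        linarith
      calc A ≤ A * ((1 - θ ^ 2) * (1 + 2 * θ ^ 2)) := le_mul_of_one_le_right hA0 h4
        _ = (1 + 2 * θ ^ 2) * (A * (1 - θ ^ 2)) := by ring
        _ ≤ (1 + 2 * θ ^ 2) * B ^ 2 := by gcongr
        _ ≤ _ := by gcongr
    calc _ ≤ Real.exp (1 - 2 * θ) * A ^ 2 ^ J := ih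
      _ ≤ Real.exp (1 - 2 * θ) * (Real.exp (2 * θ ^ 2) * B ^ 2) ^ 2 ^ J := by gcongr
      -- Since `2 ^ J * (2 * θ) = 1`, the new loss `exp (2 * θ ^ 2)` raised to `2 ^ J` is `exp θ`.
      _ = Real.exp (1 - θ) * B ^ 2 ^ (J + 1) := by
        rw [mul_pow, ← pow_mul B, ← pow_succ', ← mul_assoc, ← Real.exp_nat_mul, ← Real.exp_add]
        congr 2
        have h6 : (2 : ℝ) ^ J * (2 * θ) = 1 := by
          rw [h2θ, ← mul_pow]
          norm_num
        push_cast
        linear_combination θ * h6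

/-- At `θ = 1 / m` the functional is at most `(2 * d ^ k) ^ (1 / m)` times the norm; `1 ≤ ‖M‖`
absorbs the added one. This is how a lower bound on moments becomes one on the expected norm. -/
lemma integral_traceMoment_le_integral_opNorm_pow (hd : 2 ≤ d) (hp : 0 < p) {J : ℕ}
    (hmd : 5 * k * (2 ^ J) ^ 2 ≤ d) :
    ∫ φ, traceMoment (tensorSum φ) (2 ^ J) ∂normalizedEnsemble p d k ≤
      2 * Real.exp 1 * d ^ k *
        (∫ φ, opNorm (tensorSum φ) ∂normalizedEnsemble p d k) ^ 2 ^ J := by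
  have hd0 : 0 < d := by omega
  have hprob := isProbabilityMeasure_normalizedEnsemble (p := p) (k := k) hd0
  set m : ℕ := 2 ^ J with hm
  have hm0 : 0 < m := by positivity
  have hN : (1 : ℝ) ≤ (d : ℝ) ^ k := one_le_pow₀ (by exact_mod_cast hd0)
  have hT := integrable_normalizedEnsemble_of_continuous hd0
    (continuous_traceMoment_tensorSum (p := p) (d := d) (k := k) m)
  have hF := fun θ => integrable_normalizedEnsemble_of_continuous hd0
    (contDiff_momentPower (p := p) (d := d) (k := k) m θ).continuous
  have h1 := integral_momentPower_one_le (p := p) hd hm0 hmd J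
  have hθ : ((1 : ℝ) / 2) ^ J = (m : ℝ)⁻¹ := by
    rw [hm]
    push_cast
    rw [one_div, inv_pow]
  have h2 : ∫ φ, momentPower m ((1 / 2) ^ J) φ ∂normalizedEnsemble p d k ≤
      (2 * (d : ℝ) ^ k) ^ ((m : ℝ)⁻¹) * ∫ φ, opNorm (tensorSum φ) ∂normalizedEnsemble p d k := by
    rw [← integral_const_mul]
    refine integral_mono_ae (hF _) ((integrable_opNorm_normalizedEnsemble hd0).const_mul _) ?_
    filter_upwards [ae_norm_normalizedEnsemble p d k] with φ hφ
    have h3 := one_le_opNorm_tensorSum hp φ hφ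
    have h4 := traceMoment_le (posSemidef_tensorSum φ) m
    rw [Fintype.card_fun, Fintype.card_fin, Fintype.card_fin] at h4
    push_cast at h4
    have h5 : 1 ≤ (d : ℝ) ^ k * opNorm (tensorSum φ) ^ m :=
      one_le_mul_of_one_le_of_one_le hN (one_le_pow₀ h3)
    calc momentPower m ((1 / 2) ^ J) φ ≤
          (2 * (d : ℝ) ^ k * opNorm (tensorSum φ) ^ m) ^ ((m : ℝ)⁻¹) := by
          rw [momentPower, hθ]
          exact Real.rpow_le_rpow (one_add_traceMoment_pos φ m).le (by linarith) (by positivity)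
      _ = _ := by
          rw [Real.mul_rpow (by positivity) (by positivity),
            Real.pow_rpow_inv_natCast (opNorm_nonneg _) hm0.ne']
  have h6 : ∫ φ, traceMoment (tensorSum φ) m ∂normalizedEnsemble p d k ≤
      ∫ φ, momentPower m 1 φ ∂normalizedEnsemble p d k := by
    refine integral_mono hT (hF _) fun φ => ?_
    simp only [momentPower, Real.rpow_one]
    linarith
  have h7 : 0 ≤ ∫ φ, momentPower m ((1 / 2) ^ J) φ ∂normalizedEnsemble p d k :=
    integral_nonneg fun φ => zero_le_one.trans (one_le_momentPower m (by positivity) φ)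
  calc _ ≤ _ := h6.trans h1
    _ ≤ Real.exp 1 * ((2 * (d : ℝ) ^ k) ^ ((m : ℝ)⁻¹) *
        ∫ φ, opNorm (tensorSum φ) ∂normalizedEnsemble p d k) ^ m := by
        gcongr
        simp
    _ = _ := by
        rw [mul_pow, Real.rpow_inv_natCast_pow (by positivity) hm0.ne']
        ring

/-! ### Comparison of the two ensembles by convexity. -/

lemma tensorSum_polarMap (u : Fin p → Fin k → LocalSpace d) (r : Fin p → Fin k → ℝ) :
    tensorSum (polarMap (u, r)) = ∑ s, ((∏ i, r s i ^ 2 : ℝ) : ℂ) •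
      Matrix.vecMulVec (productVector (u s)) (star (productVector (u s))) := by
  refine Finset.sum_congr rfl fun s _ => ?_
  ext i j
  simp only [Matrix.vecMulVec_apply, Matrix.smul_apply, Pi.star_apply, productVector, polarMap,
    PiLp.smul_apply, Complex.real_smul, Finset.prod_mul_distrib, star_mul', Finset.prod_pow,
    smul_eq_mul, ← Complex.ofReal_prod, Complex.star_def, Complex.conj_ofReal]
  push_cast
  ring

lemma integral_prod_sq_radialEnsemble (hd : 0 < d) (s : Fin p) :
    Integrable (fun r : Fin p → Fin k → ℝ => ∏ i, r s i ^ 2) (radialEnsemble p d k) ∧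
      ∫ r : Fin p → Fin k → ℝ, ∏ i, r s i ^ 2 ∂radialEnsemble p d k = 1 := by
  have hs := measurePreserving_eval (fun _ : Fin p => Measure.pi fun _ : Fin k => radialLaw d) s
  have h1 := integral_pow_radialLaw hd 1
  norm_num at h1
  refine ⟨?_, ?_⟩
  · exact hs.integrable_comp_of_integrable
      (g := fun r : Fin k → ℝ => ∏ i, r i ^ 2) (Integrable.fintype_prod fun _ => h1.1)
  · have h2 := integral_map (μ := radialEnsemble p d k) hs.measurable.aemeasurable
      (f := fun r : Fin k → ℝ => ∏ i, r i ^ 2) (Measurable.aestronglyMeasurable (by fun_prop))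
    rw [radialEnsemble, hs.map_eq, integral_fintype_prod_eq_prod (f := fun _ (r : ℝ) => r ^ 2), h1.2,
      Finset.prod_const_one] at h2
    exact h2.symm

/-- Each squared radius has mean one, so the average over the radii is the normalized matrix; the
norm of a mean is at most the mean of the norms. -/
lemma opNorm_tensorSum_le_integral (hd : 0 < d) (u : Fin p → Fin k → LocalSpace d) :
    opNorm (tensorSum u) ≤
      ∫ r, opNorm (tensorSum (polarMap (u, r))) ∂radialEnsemble p d k := by
  have h1 : ∀ r : Fin p → Fin k → ℝ, Matrix.toEuclideanCLM (n := Fin k → Fin d) (𝕜 := ℂ)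
      (tensorSum (polarMap (u, r))) = ∑ s, ((∏ i, r s i ^ 2 : ℝ) : ℂ) •
        Matrix.toEuclideanCLM (n := Fin k → Fin d) (𝕜 := ℂ)
          (Matrix.vecMulVec (productVector (u s)) (star (productVector (u s)))) := fun r => by
    rw [tensorSum_polarMap, map_sum]
    simp only [map_smul]
  have h3 : ∀ s, Integrable (fun r : Fin p → Fin k → ℝ => ((∏ i, r s i ^ 2 : ℝ) : ℂ) •
      Matrix.toEuclideanCLM (n := Fin k → Fin d) (𝕜 := ℂ)
        (Matrix.vecMulVec (productVector (u s)) (star (productVector (u s)))))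
      (radialEnsemble p d k) := fun s =>
    (integral_prod_sq_radialEnsemble hd s).1.ofReal.smul_const _
  have h2 : ∫ r, Matrix.toEuclideanCLM (n := Fin k → Fin d) (𝕜 := ℂ)
      (tensorSum (polarMap (u, r))) ∂radialEnsemble p d k =
      Matrix.toEuclideanCLM (n := Fin k → Fin d) (𝕜 := ℂ) (tensorSum u) := by
    simp only [h1]
    rw [integral_finsetSum _ fun s _ => h3 s]
    simp only [integral_smul_const, integral_complex_ofReal,
      (integral_prod_sq_radialEnsemble hd _).2, Complex.ofReal_one, one_smul]
    rw [tensorSum, map_sum]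
  rw [opNorm, ← h2]
  exact norm_integral_le_integral_norm _

lemma integral_opNorm_normalizedEnsemble_le (hd : 0 < d) :
    ∫ φ, opNorm (tensorSum φ) ∂normalizedEnsemble p d k ≤
      ∫ φ, opNorm (tensorSum φ) ∂gaussianEnsemble p d k := by
  have hprob := isProbabilityMeasure_normalizedEnsemble (p := p) (k := k) hd
  have hpol := measurePreserving_polarMap (p := p) (k := k) hd
  have hint : Integrable (fun q => opNorm (tensorSum (polarMap q)))
      ((normalizedEnsemble p d k).prod (radialEnsemble p d k)) :=
    hpol.integrable_comp_of_integrable (integrable_opNorm_gaussianEnsemble hd)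
  rw [← hpol.map_eq, integral_map hpol.measurable.aemeasurable
    continuous_opNorm_tensorSum.aestronglyMeasurable, integral_prod _ hint]
  exact integral_mono (integrable_opNorm_normalizedEnsemble hd) hint.integral_prod_left
    fun u => opNorm_tensorSum_le_integral hd u

lemma integral_opNorm_gaussianEnsemble_pow_le (hd : 0 < d) {m : ℕ} (hm : m ≠ 0) :
    (∫ φ, opNorm (tensorSum φ) ∂gaussianEnsemble p d k) ^ m ≤
      ∫ φ, traceMoment (tensorSum φ) m ∂gaussianEnsemble p d k := by
  have hT := (integral_traceMoment (integral_trace_gaussianEnsemble (p := p) (k := k) hd m)).1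
  have h1 := (convexOn_pow (𝕜 := ℝ) m).map_integral_le (μ := gaussianEnsemble p d k)
    (f := fun φ => opNorm (tensorSum φ)) (continuous_pow m).continuousOn isClosed_Ici
    (Filter.Eventually.of_forall fun φ => opNorm_nonneg _)
    (integrable_opNorm_gaussianEnsemble hd) (integrable_opNorm_pow hm hT)
  exact h1.trans (integral_mono (integrable_opNorm_pow hm hT) hT fun φ =>
    opNorm_pow_le_traceMoment (posSemidef_tensorSum φ) hm)

/-- Passing to the sphere costs the exponential factor and is needed only for the bound by distinct
letters; the single factor that remains returns to the Gaussian law, where the Fock space estimate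
applies. -/
lemma integral_traceMoment_gaussianEnsemble_le (hd : 0 < d) {p' n : ℕ} (hp' : 0 < p')
    (h : (p : ℝ) ≤ d ^ k * (p' - (2 * n : ℕ))) :
    ∫ φ, traceMoment (tensorSum φ) (2 * n) ∂gaussianEnsemble p d (k + 1) ≤
      Real.exp ((2 * n : ℕ) ^ 2 / (2 * d)) ^ (k + 1) * (d ^ (k + 1) *
        ((√(p' + (2 * n : ℕ)) + √(d + (2 * n : ℕ))) ^ 2 / d) ^ (2 * n)) := by
  rw [(integral_traceMoment (integral_trace_gaussianEnsemble (p := p) (k := k + 1) hd (2 * n))).2]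
  calc _ ≤ ∑ w : Fin (2 * n) → Fin p, Real.exp ((2 * n : ℕ) ^ 2 / (2 * d)) ^ (k + 1) *
        sphereWord d (List.ofFn w) ^ (k + 1) := by
        refine Finset.sum_le_sum fun w _ => ?_
        rw [← mul_pow]
        have := gaussianWord_le hd (List.ofFn w)
        rw [List.length_ofFn] at this
        exact pow_le_pow_left₀ (gaussianWord_nonneg _) this _
    _ ≤ _ := by
        rw [← Finset.mul_sum, pow_succ (d : ℝ), mul_assoc (_ ^ k)]
        gcongr
        refine (sum_sphereWord_pow_le hd k h).trans ?_
        gcongr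
        exact sum_gaussianWord_le hd hp' n

/-! ### Roots of moment bounds and choice of parameters. -/

lemma mul_exp_le_of_pow_le {l L Q : ℝ} {m : ℕ} (hm : m ≠ 0) (hl : 0 ≤ l) (hL : 0 ≤ L)
    (hQ : 0 < Q) (h : l ^ m ≤ Q * L ^ m) : l ≤ Real.exp (Real.log Q / m) * L := by
  rw [← pow_le_pow_iff_left₀ hl (by positivity) hm, mul_pow, ← Real.exp_nat_mul,
    mul_div_cancel₀ _ (by exact_mod_cast hm), Real.exp_log hQ]
  exact h

lemma mul_one_sub_le_of_pow_le {l L Q : ℝ} {m : ℕ} (hm : m ≠ 0) (hl : 0 ≤ l) (hL : 0 ≤ L)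
    (hQ : 0 < Q) (h : l ^ m ≤ Q * L ^ m) : l * (1 - Real.log Q / m) ≤ L := by
  have h1 := mul_exp_le_of_pow_le hm hl hL hQ h
  have h2 := Real.add_one_le_exp (-(Real.log Q / m))
  calc l * (1 - Real.log Q / m) ≤ l * Real.exp (-(Real.log Q / m)) := by
        gcongr
        linarith
    _ ≤ Real.exp (Real.log Q / m) * L * Real.exp (-(Real.log Q / m)) := by gcongr
    _ = L := by
        rw [mul_right_comm, ← Real.exp_add, add_neg_cancel, Real.exp_zero, one_mul]

lemma half_le_log_natCast {d : ℕ} (hd : 2 ≤ d) : 1 / 2 ≤ Real.log d := by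
  have h1 : Real.log 2 ≤ Real.log d := Real.log_le_log two_pos (by exact_mod_cast hd)
  linarith [Real.log_two_gt_d9]

lemma log_div_sqrt_le_two {d : ℕ} (hd : 0 < d) : Real.log d / √(d : ℝ) ≤ 2 := by
  have h0 : (0 : ℝ) < √(d : ℝ) := Real.sqrt_pos.2 (by exact_mod_cast hd)
  rw [div_le_iff₀ h0]
  have h1 := Real.log_le_sub_one_of_pos h0
  rw [Real.log_sqrt (by positivity)] at h1
  linarith

lemma one_add_sqrt_sq_sub_le {x y : ℝ} (hy : 0 ≤ y) (hyx : y ≤ x) (hx : 0 < x) :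
    (1 + √x) ^ 2 - (1 + √y) ^ 2 ≤ (x - y) * (1 + 2 / √x) := by
  have hs : 0 < √x := Real.sqrt_pos.2 hx
  have hxs := Real.sq_sqrt hx.le
  have hys := Real.sq_sqrt hy
  have h1 : √y ≤ √x := Real.sqrt_le_sqrt hyx
  have h2 : √x - √y ≤ (x - y) / √x := by
    rw [le_div_iff₀ hs]
    nlinarith [Real.sqrt_nonneg y]
  calc _ = (x - y) + 2 * (√x - √y) := by
        rw [← hxs, ← hys]
        simp only [Real.sqrt_sq (Real.sqrt_nonneg _)]
        ring
    _ ≤ (x - y) + 2 * ((x - y) / √x) := by gcongr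
    _ = _ := by ring

lemma sqrt_add_sqrt_sq_le {x η : ℝ} (hx : 0 < x) (hη : 0 ≤ η) :
    (√(x + η) + √(1 + η)) ^ 2 ≤ (1 + √x) ^ 2 + η * (2 + (1 + x + η) / √x) := by
  have hs : 0 < √x := Real.sqrt_pos.2 hx
  have hxs := Real.sq_sqrt hx.le
  have h1 : √(x + η) * √(1 + η) ≤ √x + η * (1 + x + η) / (2 * √x) := by
    rw [← Real.sqrt_mul (by positivity)]
    refine Real.sqrt_le_iff.2 ⟨by positivity, ?_⟩
    have h2 : (√x + η * (1 + x + η) / (2 * √x)) ^ 2 =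
        √x ^ 2 + η * (1 + x + η) + (η * (1 + x + η) / (2 * √x)) ^ 2 := by
      field_simp
      ring
    rw [h2, hxs]
    nlinarith [sq_nonneg (η * (1 + x + η) / (2 * √x))]
  have h3 := Real.sq_sqrt (show 0 ≤ x + η by positivity)
  have h4 := Real.sq_sqrt (show 0 ≤ 1 + η by positivity)
  have h5 : η * ((1 + x + η) / √x) = 2 * (η * (1 + x + η) / (2 * √x)) := by
    field_simp
  nlinarith

variable {p d k : ℕ}

lemma pow_le_integral_opNorm_normalizedEnsemble (hd : 2 ≤ d) (hp : 0 < p) {J : ℕ}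
    (hmd : 5 * k * (2 ^ J) ^ 2 ≤ d) {y : ℝ} (hy : 0 < y)
    (hyp : (d : ℝ) ^ k * y + (2 ^ J : ℕ) ≤ p) :
    ((1 + √y) ^ 2) ^ 2 ^ J ≤ 2 * Real.exp 1 * ((2 ^ J : ℕ) : ℝ) ^ 2 * (1 + √y) ^ 2 / y *
      (∫ φ, opNorm (tensorSum φ) ∂normalizedEnsemble p d k) ^ 2 ^ J := by
  have hd0 : 0 < d := by omega
  have hN : (0 : ℝ) < (d : ℝ) ^ k := by positivity
  have h1 := integral_traceMoment_le_integral_opNorm_pow hd hp hmd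
  rw [(integral_traceMoment (integral_trace_normalizedEnsemble (p := p) (k := k) hd0 (2 ^ J))).2]
    at h1
  obtain ⟨n, hn⟩ : ∃ n, 2 ^ J = n + 1 := Nat.exists_eq_succ_of_ne_zero (by positivity)
  rw [hn] at h1 hyp ⊢
  have h2 := weightedCatalan_le_sum_sphereWord hd0 k hy.le hyp
  have h3 := pow_le_weightedCatalan hy n
  set I := ∫ φ, opNorm (tensorSum φ) ∂normalizedEnsemble p d k
  set l := (1 + √y) ^ 2 with hl
  have hl0 : 0 < l := by positivity
  have h4 : y * weightedCatalan y n ≤ 2 * Real.exp 1 * I ^ (n + 1) := by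
    refine le_of_mul_le_mul_left ?_ hN
    linarith [h2.trans h1]
  push_cast
  calc l ^ (n + 1) ≤ ((n + 1) ^ 2 * weightedCatalan y n) * l := by
        rw [pow_succ]
        gcongr
    _ = (n + 1 : ℝ) ^ 2 * l / y * (y * weightedCatalan y n) := by
        field_simp
    _ ≤ (n + 1 : ℝ) ^ 2 * l / y * (2 * Real.exp 1 * I ^ (n + 1)) := by gcongr
    _ = _ := by ring

/-- The moment order must be a power of two for the halving argument; the largest power of four
below `d / (5 * k)` keeps it of order `√d`. -/
lemma exists_two_pow_sq_le (hk : 1 ≤ k) (h : 5 * k ≤ d) :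
    ∃ J : ℕ, 5 * k * (2 ^ J) ^ 2 ≤ d ∧ d ≤ 20 * k * (2 ^ J) ^ 2 := by
  have h0 : 0 < 5 * k := by omega
  refine ⟨Nat.log 4 (d / (5 * k)), ?_, ?_⟩
  · have h1 := Nat.pow_log_le_self 4 (Nat.div_pos h h0).ne'
    rw [← pow_mul, mul_comm _ 2, pow_mul, show 2 ^ 2 = 4 from rfl]
    exact (Nat.mul_le_mul_left _ h1).trans (Nat.mul_div_le _ _)
  · have h1 := Nat.lt_pow_succ_log_self (b := 4) (by norm_num) (d / (5 * k))
    rw [← pow_mul, mul_comm _ 2, pow_mul, show 2 ^ 2 = 4 from rfl]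
    rw [Nat.div_lt_iff_lt_mul h0, pow_succ] at h1
    refine h1.le.trans_eq ?_
    ring

lemma exists_lower_bound (hk : 1 ≤ k) {a b : ℝ} (ha : 0 < a) :
    ∃ C : ℝ, 0 < C ∧ ∀ d p : ℕ, ∀ x : ℝ, 2 ≤ d → x = (p : ℝ) / (d : ℝ) ^ k → a ≤ x → x ≤ b →
      (1 + √x) ^ 2 - C * (Real.log d / √(d : ℝ)) ≤
        ∫ φ, opNorm (tensorSum φ) ∂normalizedEnsemble p d k := by
  set B := (1 + √b) ^ 2 with hB
  -- Above this threshold a moment order exists and the shift `m / N` is at most `a / 2`; below it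
  -- the constant makes the lower bound nonpositive.
  set D : ℝ := 5 * k + 4 / a ^ 2 with hD
  set K : ℝ := 2 * |Real.log (4 * Real.exp 1 * B / a)| + 1 with hK
  have hB0 : 0 < B := by positivity
  have hsa : 0 < √a := Real.sqrt_pos.2 ha
  refine ⟨2 * B * √D + (B * (K * √(20 * k)) + 2 * (1 + 2 / √a)), by positivity, ?_⟩
  intro d p x hd hx hax hxb
  have hd0 : (0 : ℝ) < d := by
    have : 0 < d := by omega
    exact_mod_cast this
  have hd1 : (1 : ℝ) ≤ d := by
    have : 1 ≤ d := by omega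
    exact_mod_cast this
  have hsd : 0 < √(d : ℝ) := Real.sqrt_pos.2 hd0
  have hlog := half_le_log_natCast hd
  have hx0 : 0 < x := ha.trans_le hax
  have hxB : (1 + √x) ^ 2 ≤ B := by
    rw [hB]
    gcongr
  set L := Real.log d / √(d : ℝ) with hL
  have hL0 : 0 ≤ L := by positivity
  have hI0 : 0 ≤ ∫ φ, opNorm (tensorSum φ) ∂normalizedEnsemble p d k :=
    integral_nonneg fun φ => opNorm_nonneg _
  rcases le_or_gt D d with hDd | hDd
  swap
  · have h1 : B ≤ 2 * B * √D * L := by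
      have h2 : √(d : ℝ) ≤ √D := Real.sqrt_le_sqrt hDd.le
      have h3 : 1 ≤ √D * (2 * L) := by
        rw [hL, mul_div_assoc', mul_div_assoc', le_div_iff₀ hsd]
        nlinarith
      calc B = B * 1 := (mul_one B).symm
        _ ≤ B * (√D * (2 * L)) := by gcongr
        _ = _ := by ring
    have h2 : 0 ≤ (B * (K * √(20 * k)) + 2 * (1 + 2 / √a)) * L := by positivity
    linarith
  have h5k : 5 * k ≤ d := by
    have : (5 * k : ℝ) ≤ d := le_trans (by rw [hD]; linarith [show 0 < 4 / a ^ 2 by positivity]) hDd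
    exact_mod_cast this
  obtain ⟨J, hJ1, hJ2⟩ := exists_two_pow_sq_le hk h5k
  have hm0 : 2 ^ J ≠ 0 := by positivity
  have hp0 : 0 < p := by
    rcases Nat.eq_zero_or_pos p with h | h
    · rw [h] at hx
      simp at hx
      linarith
    · exact h
  have hcore := fun (y : ℝ) => pow_le_integral_opNorm_normalizedEnsemble (y := y) hd hp0 hJ1
  set I := ∫ φ, opNorm (tensorSum φ) ∂normalizedEnsemble p d k
  set m : ℕ := 2 ^ J with hm
  have hm' : (0 : ℝ) < m := by positivity
  have hmd : (m : ℝ) ^ 2 ≤ d := by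
    have : 1 * m ^ 2 ≤ 5 * k * m ^ 2 := Nat.mul_le_mul_right _ (by omega)
    have : m ^ 2 ≤ d := by omega
    exact_mod_cast this
  have hdm : √(d : ℝ) ≤ √(20 * k) * m := by
    rw [← Real.sqrt_sq hm'.le, ← Real.sqrt_mul (by positivity)]
    exact Real.sqrt_le_sqrt (by exact_mod_cast hJ2)
  have hms : (m : ℝ) ≤ √(d : ℝ) := Real.le_sqrt_of_sq_le hmd
  set N : ℝ := (d : ℝ) ^ k with hN
  have hN0 : 0 < N := by positivity
  have hdN : (d : ℝ) ≤ N := le_self_pow₀ hd1 (by omega)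
  have hmN : m / N ≤ 1 / √(d : ℝ) := by
    rw [div_le_div_iff₀ hN0 hsd, one_mul]
    nlinarith [Real.mul_self_sqrt hd0.le]
  have hsmall : 1 / √(d : ℝ) ≤ a / 2 := by
    have h1 : 4 / a ^ 2 ≤ d := le_trans (by rw [hD]; linarith [show (0 : ℝ) ≤ 5 * k by positivity]) hDd
    have h2 : 2 / a ≤ √(d : ℝ) := Real.le_sqrt_of_sq_le (by rw [div_pow]; norm_num; exact h1)
    rw [div_le_iff₀ ha] at h2
    rw [div_le_iff₀ hsd]
    linarith
  -- The Catalan bound needs `m` letters to spare, so it is applied with slightly fewer letters; the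
  -- loss is at most `1 / √d`.
  set y := x - m / N with hy
  have hya : a / 2 ≤ y := by linarith
  have hy0 : 0 < y := by linarith
  have hyx : y ≤ x := by
    have : 0 ≤ m / N := by positivity
    linarith
  have hyB : (1 + √y) ^ 2 ≤ B := by
    rw [hB]
    gcongr
    exact hyx.trans hxb
  have h1 := hcore y hy0 (by
    rw [hy, hx, mul_sub, mul_div_cancel₀ _ hN0.ne', mul_div_cancel₀ _ hN0.ne']
    linarith)
  set Q := 2 * Real.exp 1 * (m : ℝ) ^ 2 * (1 + √y) ^ 2 / y with hQ
  have hQ0 : 0 < Q := by positivity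
  have h2 := mul_one_sub_le_of_pow_le hm0 (by positivity) hI0 hQ0 h1
  have hQK : Real.log Q ≤ K * Real.log d := by
    have h3 : Q ≤ 4 * Real.exp 1 * B / a * d := by
      calc Q ≤ 2 * Real.exp 1 * d * B / (a / 2) := by
            rw [hQ]
            gcongr
        _ = _ := by
            field_simp
            ring
    have h4 := Real.log_le_log hQ0 h3
    rw [Real.log_mul (by positivity) hd0.ne'] at h4
    have h5 := le_abs_self (Real.log (4 * Real.exp 1 * B / a))
    have h6 := abs_nonneg (Real.log (4 * Real.exp 1 * B / a))
    rw [hK]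
    nlinarith
  have hQm : Real.log Q / m ≤ K * √(20 * k) * L := by
    rw [hL, mul_div_assoc', div_le_div_iff₀ hm' hsd]
    have h3 : 0 ≤ K * Real.log d := by positivity
    calc Real.log Q * √(d : ℝ) ≤ K * Real.log d * √(d : ℝ) := by gcongr
      _ ≤ K * Real.log d * (√(20 * k) * m) := by gcongr
      _ = _ := by ring
  have h3 : (1 + √y) ^ 2 * (Real.log Q / m) ≤ B * (K * √(20 * k)) * L := by
    calc _ ≤ (1 + √y) ^ 2 * (K * √(20 * k) * L) := by gcongr
      _ ≤ B * (K * √(20 * k) * L) := by gcongr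
      _ = _ := by ring
  have h4 := one_add_sqrt_sq_sub_le hy0.le hyx hx0
  have h5 : (x - y) * (1 + 2 / √x) ≤ 2 * (1 + 2 / √a) * L := by
    have h6 : x - y ≤ 2 * L := by
      have : x - y = m / N := by rw [hy]; ring
      rw [this]
      refine hmN.trans ?_
      rw [hL, mul_div_assoc']
      gcongr
      linarith
    calc (x - y) * (1 + 2 / √x) ≤ (2 * L) * (1 + 2 / √a) := by gcongr
      _ = _ := by ring
  have h7 : 0 ≤ 2 * B * √D * L := by positivity
  linarith

lemma exists_upper_bound (hk : 1 ≤ k) {a b : ℝ} (ha : 0 < a) :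
    ∃ C : ℝ, 0 < C ∧ ∀ d p : ℕ, ∀ x : ℝ, 2 ≤ d → x = (p : ℝ) / (d : ℝ) ^ k → a ≤ x → x ≤ b →
      ∫ φ, opNorm (tensorSum φ) ∂gaussianEnsemble p d k ≤
        (1 + √x) ^ 2 + C * (Real.log d / √(d : ℝ)) := by
  obtain ⟨k, rfl⟩ : ∃ j, k = j + 1 := Nat.exists_eq_succ_of_ne_zero (by omega)
  set B := (1 + √b) ^ 2 with hB
  -- The error factor of `sqrt_add_sqrt_sq_le`, with `η ≤ 9 / √d` and `1 + x + η ≤ 10 + |b|`.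
  set c : ℝ := 9 * (2 + (10 + |b|) / √a) with hc
  have hsa : 0 < √a := Real.sqrt_pos.2 ha
  have hc0 : 0 < c := by positivity
  -- The factor in `exp y ≤ 1 + y * exp y` for `y = 9 * (k + 1) * L`, where `L ≤ 2`.
  set E : ℝ := 9 * (k + 1) * Real.exp (18 * (k + 1)) with hE
  refine ⟨2 * c + (B + c) * E, by positivity, ?_⟩
  intro d p x hd hx hax hxb
  have hdn : 0 < d := by omega
  have hd0 : (0 : ℝ) < d := by exact_mod_cast hdn
  have hsd : 0 < √(d : ℝ) := Real.sqrt_pos.2 hd0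
  have hsd1 : 1 ≤ √(d : ℝ) := Real.one_le_sqrt.2 (by exact_mod_cast hdn)
  have hdd := Real.mul_self_sqrt hd0.le
  have hlog := half_le_log_natCast hd
  have hx0 : 0 < x := ha.trans_le hax
  have hxB : (1 + √x) ^ 2 ≤ B := by
    rw [hB]
    gcongr
  set L := Real.log d / √(d : ℝ) with hL
  have hL0 : 0 ≤ L := by positivity
  have hL2 : L ≤ 2 := log_div_sqrt_le_two hdn
  have hL1 : 1 / √(d : ℝ) ≤ 2 * L := by
    rw [hL, mul_div_assoc']
    gcongr
    linarith
  -- This order keeps the comparison factor `exp ((2 * n) ^ 2 / (2 * d))` bounded, while the root of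
  -- the dimension factor is `1 + O(log d / √d)`.
  set n : ℕ := ⌈√(d : ℝ)⌉₊ with hn
  have hn1 : √(d : ℝ) ≤ n := Nat.le_ceil _
  have hn2 : (n : ℝ) ≤ 2 * √(d : ℝ) := by
    have := (Nat.ceil_lt_add_one hsd.le).le
    linarith
  have hn0 : 0 < n := by
    have : (0 : ℝ) < n := hsd.trans_le hn1
    exact_mod_cast this
  -- The reduced alphabet: about `x * d` letters, plus the `2 * n` that the exchange of alphabets
  -- requires.
  set p' : ℕ := ⌈(p : ℝ) / d ^ k⌉₊ + 2 * n with hp'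
  have hp'0 : 0 < p' := by omega
  have hpk : (p : ℝ) / d ^ k = x * d := by
    rw [hx, pow_succ]
    field_simp
  have hdk : (0 : ℝ) < (d : ℝ) ^ k := by positivity
  have h1 := integral_traceMoment_gaussianEnsemble_le (p := p) (k := k) hdn (n := n) hp'0 (by
    rw [hp']
    push_cast
    rw [add_sub_cancel_right, ← div_le_iff₀' hdk]
    exact Nat.le_ceil _)
  have h2 := (integral_opNorm_gaussianEnsemble_pow_le (p := p) (k := k + 1) hdn
    (m := 2 * n) (by omega)).trans h1
  have hI0 : 0 ≤ ∫ φ, opNorm (tensorSum φ) ∂gaussianEnsemble p d (k + 1) :=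
    integral_nonneg fun φ => opNorm_nonneg _
  set I := ∫ φ, opNorm (tensorSum φ) ∂gaussianEnsemble p d (k + 1)
  set S : ℝ := (√(p' + (2 * n : ℕ)) + √(d + (2 * n : ℕ))) ^ 2 / d with hS
  have hS0 : 0 ≤ S := by positivity
  set η : ℝ := (1 + 4 * n) / d with hη
  have hη0 : 0 ≤ η := by positivity
  have hη1 : η ≤ 9 * (1 / √(d : ℝ)) := by
    rw [hη, mul_one_div, div_le_div_iff₀ hd0 hsd]
    nlinarith
  have hη9 : η ≤ 9 := hη1.trans (by
    have : 1 / √(d : ℝ) ≤ 1 := by rwa [div_le_one hsd]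
    linarith)
  have hηd : d * η = 1 + 4 * n := by
    rw [hη, mul_div_cancel₀ _ hd0.ne']
  have hSx : S ≤ (1 + √x) ^ 2 + c * (1 / √(d : ℝ)) := by
    have h3 : (p' : ℝ) + (2 * n : ℕ) ≤ d * (x + η) := by
      have := (Nat.ceil_lt_add_one (show (0 : ℝ) ≤ (p : ℝ) / d ^ k by positivity)).le
      rw [hp', mul_add, hηd]
      push_cast
      linarith
    have h4 : (d : ℝ) + (2 * n : ℕ) ≤ d * (1 + η) := by
      rw [mul_add, hηd]
      push_cast
      linarith
    have h5 : S ≤ (√(x + η) + √(1 + η)) ^ 2 := by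
      rw [hS, div_le_iff₀ hd0]
      calc _ ≤ (√(d * (x + η)) + √(d * (1 + η))) ^ 2 := by gcongr
        _ = (√(x + η) + √(1 + η)) ^ 2 * √(d : ℝ) ^ 2 := by
          rw [Real.sqrt_mul hd0.le, Real.sqrt_mul hd0.le]
          ring
        _ = _ := by rw [Real.sq_sqrt hd0.le]
    refine (h5.trans (sqrt_add_sqrt_sq_le hx0 hη0)).trans ?_
    have h6 : (1 + x + η) / √x ≤ (10 + |b|) / √a := by
      have h7 : 1 + x + η ≤ 10 + |b| := by linarith [le_abs_self b]
      refine (div_le_div_of_nonneg_right h7 (Real.sqrt_nonneg x)).trans ?_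
      gcongr
    calc _ ≤ (1 + √x) ^ 2 + 9 * (1 / √(d : ℝ)) * (2 + (10 + |b|) / √a) := by gcongr
      _ = _ := by rw [hc]; ring
  set Q : ℝ := Real.exp (8 * (k + 1)) * (d : ℝ) ^ (k + 1) with hQ
  have hQ0 : 0 < Q := by positivity
  have h3 : I ^ (2 * n) ≤ Q * S ^ (2 * n) := by
    refine h2.trans ?_
    rw [← mul_assoc, hQ]
    gcongr
    rw [← Real.exp_nat_mul]
    refine Real.exp_le_exp.2 ?_
    have h4 : (((2 * n : ℕ) : ℝ)) ^ 2 / (2 * d) ≤ 8 := by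
      rw [div_le_iff₀ (by positivity)]
      have h5 : (n : ℝ) * n ≤ 2 * √(d : ℝ) * (2 * √(d : ℝ)) := by gcongr
      push_cast
      linarith
    rw [mul_comm (8 : ℝ), Nat.cast_add_one]
    exact mul_le_mul_of_nonneg_left h4 (by positivity)
  have h4 := mul_exp_le_of_pow_le (by omega) hI0 hS0 hQ0 h3
  have h5 : Real.log Q / (2 * n : ℕ) ≤ 9 * (k + 1) * L := by
    rw [hQ, Real.log_mul (by positivity) (by positivity), Real.log_exp, Real.log_pow, hL,
      mul_div_assoc', div_le_div_iff₀ (by positivity) hsd]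
    push_cast
    have h6 : 0 ≤ (k + 1 : ℝ) * Real.log d := by positivity
    calc (8 * (k + 1) + (k + 1) * Real.log d) * √(d : ℝ) ≤
          (18 * ((k + 1) * Real.log d)) * √(d : ℝ) := by
          gcongr
          have h7 : (k + 1 : ℝ) * (1 / 2) ≤ (k + 1) * Real.log d := by gcongr
          linarith
      _ ≤ (18 * ((k + 1) * Real.log d)) * n := by gcongr
      _ = _ := by ring
  set y : ℝ := 9 * (k + 1) * L with hy
  have hy0 : 0 ≤ y := by positivity
  have h6 : Real.exp y ≤ 1 + E * L := by
    have h7 := Real.add_one_le_exp (-y)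
    have h8 : Real.exp y * Real.exp (-y) = 1 := by rw [← Real.exp_add, add_neg_cancel, Real.exp_zero]
    have h9 : Real.exp y ≤ Real.exp (18 * (k + 1)) := Real.exp_le_exp.2 (by
      have h10 : 9 * (k + 1) * L ≤ 9 * (k + 1) * 2 := by gcongr
      linarith)
    have h10 : Real.exp y * (1 - y) ≤ 1 := by
      rw [← h8]
      gcongr
      linarith
    have h11 : Real.exp y * y ≤ Real.exp (18 * (k + 1)) * y := by gcongr
    have h12 : Real.exp (18 * (k + 1)) * y = E * L := by
      rw [hE, hy]
      ring
    linarith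
  have hE0 : 0 ≤ E := by positivity
  have h7 : S ≤ B + c := by
    have : c * (1 / √(d : ℝ)) ≤ c * 1 := by
      gcongr
      rwa [div_le_one hsd]
    linarith
  calc I ≤ Real.exp y * S := by
        refine h4.trans ?_
        gcongr
    _ ≤ (1 + E * L) * S := by gcongr
    _ = S + S * (E * L) := by ring
    _ ≤ ((1 + √x) ^ 2 + c * (2 * L)) + (B + c) * (E * L) := by
        gcongr
        refine hSx.trans ?_
        gcongr
    _ = _ := by ring

lemma log_div_sqrt_le_log_div_rpow (hk : 1 ≤ k) (hd : 2 ≤ d) :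
    Real.log d / √(d : ℝ) ≤ Real.log d / (d : ℝ) ^ (1 / (2 * (k : ℝ))) := by
  have hd1 : (1 : ℝ) ≤ d := by
    have : 1 ≤ d := by omega
    exact_mod_cast this
  have hk' : (1 : ℝ) ≤ k := by exact_mod_cast hk
  have h1 : (d : ℝ) ^ (1 / (2 * (k : ℝ))) ≤ √(d : ℝ) := by
    rw [Real.sqrt_eq_rpow]
    refine Real.rpow_le_rpow_of_exponent_le hd1 ?_
    gcongr
    linarith
  have h2 := half_le_log_natCast hd
  gcongr

end RandomTensor

theorem mainTheorem2 (k : ℕ) (hk : 1 ≤ k) (a b : ℝ) (ha : 0 < a) :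
    ∃ C : ℝ, 0 < C ∧ ∀ d p : ℕ, ∀ x : ℝ, 2 ≤ d → x = (p : ℝ) / (d : ℝ) ^ k → a ≤ x → x ≤ b →
      (Integrable (fun φ => RandomTensor.opNorm (RandomTensor.tensorSum φ))
          (RandomTensor.normalizedEnsemble p d k) ∧
        (1 + √x) ^ 2 - C * (Real.log d / √(d : ℝ)) ≤
          ∫ φ, RandomTensor.opNorm (RandomTensor.tensorSum φ)
            ∂(RandomTensor.normalizedEnsemble p d k) ∧
        ∫ φ, RandomTensor.opNorm (RandomTensor.tensorSum φ)
            ∂(RandomTensor.normalizedEnsemble p d k) ≤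
          (1 + √x) ^ 2 + C * (Real.log d / (d : ℝ) ^ (1 / (2 * (k : ℝ))))) ∧
      (Integrable (fun φ => RandomTensor.opNorm (RandomTensor.tensorSum φ))
          (RandomTensor.gaussianEnsemble p d k) ∧
        (1 + √x) ^ 2 - C * (Real.log d / √(d : ℝ)) ≤
          ∫ φ, RandomTensor.opNorm (RandomTensor.tensorSum φ)
            ∂(RandomTensor.gaussianEnsemble p d k) ∧
        ∫ φ, RandomTensor.opNorm (RandomTensor.tensorSum φ)
            ∂(RandomTensor.gaussianEnsemble p d k) ≤
          (1 + √x) ^ 2 + C * (Real.log d / (d : ℝ) ^ (1 / (2 * (k : ℝ))))) := by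
  obtain ⟨C₁, hC₁, h1⟩ := RandomTensor.exists_lower_bound (k := k) hk (b := b) ha
  obtain ⟨C₂, hC₂, h2⟩ := RandomTensor.exists_upper_bound (k := k) hk (b := b) ha
  refine ⟨C₁ + C₂, by positivity, fun d p x hd hx hax hxb => ?_⟩
  have hd0 : 0 < d := by omega
  have hlog := RandomTensor.half_le_log_natCast hd
  have hL : 0 ≤ Real.log d / √(d : ℝ) := by positivity
  -- The upper bound holds with error `log d / √d`, which is at most the stated error.
  have hR := RandomTensor.log_div_sqrt_le_log_div_rpow hk hd
  have hl := h1 d p x hd hx hax hxb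
  have hu := h2 d p x hd hx hax hxb
  have hm := RandomTensor.integral_opNorm_normalizedEnsemble_le (p := p) (k := k) hd0
  have hlow : (1 + √x) ^ 2 - (C₁ + C₂) * (Real.log d / √(d : ℝ)) ≤
      (1 + √x) ^ 2 - C₁ * (Real.log d / √(d : ℝ)) := by
    have := mul_nonneg hC₂.le hL
    linarith
  have hupp : (1 + √x) ^ 2 + C₂ * (Real.log d / √(d : ℝ)) ≤
      (1 + √x) ^ 2 + (C₁ + C₂) * (Real.log d / (d : ℝ) ^ (1 / (2 * (k : ℝ)))) := by
    have h3 := mul_le_mul_of_nonneg_left hR hC₂.le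
    have h4 := mul_nonneg hC₁.le (hL.trans hR)
    linarith
  exact ⟨⟨RandomTensor.integrable_opNorm_normalizedEnsemble hd0, hlow.trans hl,
      (hm.trans hu).trans hupp⟩,
    RandomTensor.integrable_opNorm_gaussianEnsemble hd0, (hlow.trans hl).trans hm, hu.trans hupp⟩
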